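/- Let $K$ be a field, let $G$ be a finite simple graph on the vertex set $\{x_1,\dots,x_n\}$, and let $H_1,\dots,H_n$ be finite simple graphs, each with at least one vertex. Let $G'=G(H_1,\dots,H_n)$ be the graph on the disjoint union $V(G)\cup V(H_1)\cup\dots\cup V(H_n)$ whose edges are those of $G$, those of every $H_i$, and all pairs $\{x_i,z\}$ with $1\le i\le n$ and $z\in V(H_i)$. Suppose that each $H_i$ belongs to one of the following families: (a) unmixed chordal graphs, i.e. graphs in which every cycle of length at least $4$ has a chord and all minimal vertex covers have the same cardinality; (b) Cohen–Macaulay bipartite graphs, i.e. bipartite graphs $H$ such that the quotient of $K[z : z\in V(H)]$ by the edge ideal $(zz' : \{z,z'\}\in E(H))$ is a Cohen–Macaulay ring; (c) path graphs; (d) Cameron–Walker graphs whose bipartite part is complete, i.e. graphs consisting of a complete bipartite graph with non-empty vertex classes $X$ and $Y$, at least one leaf attached to each vertex of $X$, and possibly some pendant triangles attached to vertices of $Y$. Let $S$ be the polynomial ring over $K$ whose variables are the vertices of $G'$, and let $I_{G'}\subset S$ be the cover ideal, generated by the monomials $u_C=\prod_{v\in C}v$ where $C$ runs through the minimal vertex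 covers of $G'$. Then for every $k\ge 0$ the minimal monomial generating set of the power $I_{G'}^k$ can be ordered as $f_1,\dots,f_m$ so that each colon ideal $(f_1,\dots,f_{j-1}):f_j$, $1\le j\le m$, is generated by linear forms; and $I_{G'}^k$ is componentwise linear, that is, for each $j\geq 0$ the ideal generated by all homogeneous elements of degree $j$ of $I_{G'}^k$ has a linear resolution (the zero ideal being regarded as having one). -/

import Mathlib

noncomputable section

/-! ### Graphs -/

namespace CoverPowers

section Graphs

variable {V : Type*}

/-- Adjacency of `G(H_v : v ∈ V)` on `V ⊔ ⨆ v, W v`: the edges of `G`, the edges of every `H v`,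
and all edges joining `v` to the vertices of `H v`. -/
inductive AttachAdj {W : V → Type*} (G : SimpleGraph V) (H : ∀ v, SimpleGraph (W v)) :
    (V ⊕ (Σ v, W v)) → (V ⊕ (Σ v, W v)) → Prop
  | base {u v : V} (h : G.Adj u v) : AttachAdj G H (Sum.inl u) (Sum.inl v)
  | fiber {v : V} {a b : W v} (h : (H v).Adj a b) :
      AttachAdj G H (Sum.inr ⟨v, a⟩) (Sum.inr ⟨v, b⟩)
  | up (v : V) (a : W v) : AttachAdj G H (Sum.inl v) (Sum.inr ⟨v, a⟩)
  | down (v : V) (a : W v) : AttachAdj G H (Sum.inr ⟨v, a⟩) (Sum.inl v)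

/-- The graph `G(H_v : v ∈ V)` obtained from `G` by attaching `H v` to each vertex `v`, with `v`
joined to all vertices of `H v`. -/
def attach {W : V → Type*} (G : SimpleGraph V) (H : ∀ v, SimpleGraph (W v)) :
    SimpleGraph (V ⊕ (Σ v, W v)) where
  Adj := AttachAdj G H
  symm := ⟨by
    rintro _ _ (h | h | ⟨v, a⟩ | ⟨v, a⟩)
    · exact .base h.symm
    · exact .fiber h.symm
    · exact .down v a
    · exact .up v a⟩
  loopless := ⟨by
    rintro _ (h | h)
    · exact h.ne rfl
    · exact h.ne rfl⟩

/-- `C` is a minimal vertex cover of `G`. -/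
def IsMinVertexCover (G : SimpleGraph V) (C : Finset V) : Prop :=
  Minimal (fun D : Finset V => G.IsVertexCover (D : Set V)) C

/-- All minimal vertex covers have the same cardinality. -/
def IsUnmixed (G : SimpleGraph V) : Prop :=
  ∀ C D : Finset V, IsMinVertexCover G C → IsMinVertexCover G D → C.card = D.card

/-- Every cycle of length at least four has a chord. -/
def IsChordal (G : SimpleGraph V) : Prop :=
  ∀ (v : V) (c : G.Walk v v), c.IsCycle → 4 ≤ c.length →
    ∃ a ∈ c.support, ∃ b ∈ c.support, G.Adj a b ∧ s(a, b) ∉ c.edges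

/-- `G` is isomorphic to a path `P_r`. -/
def IsPathGraph (G : SimpleGraph V) : Prop :=
  ∃ r : ℕ, Nonempty (G ≃g SimpleGraph.pathGraph r)

/-- `v` is a leaf whose only neighbour is `x`. -/
def IsLeafAt (G : SimpleGraph V) (x v : V) : Prop :=
  ∀ w, G.Adj v w ↔ w = x

/-- `{y, v, v'}` is a pendant triangle at `y`: `v` and `v'` have degree two. -/
def IsPendantTriangleAt (G : SimpleGraph V) (y v v' : V) : Prop :=
  (∀ w, G.Adj v w ↔ w = y ∨ w = v') ∧ (∀ w, G.Adj v' w ↔ w = y ∨ w = v)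

/-- `G` is a Cameron–Walker graph with bipartite part on `X ⊔ Y`: a connected bipartite graph with
vertex classes `X` and `Y`, together with at least one leaf attached to each vertex of `X` and
possibly some pendant triangles attached to vertices of `Y`. -/
structure IsCameronWalkerOn (G : SimpleGraph V) (X Y : Set V) : Prop where
  disjoint : Disjoint X Y
  nonempty_left : X.Nonempty
  nonempty_right : Y.Nonempty
  indep_left : ∀ a ∈ X, ∀ b ∈ X, ¬ G.Adj a b
  indep_right : ∀ a ∈ Y, ∀ b ∈ Y, ¬ G.Adj a b
  connected : (G.induce (X ∪ Y)).Connected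
  exists_leaf : ∀ x ∈ X, ∃ v ∉ X ∪ Y, IsLeafAt G x v
  rest : ∀ v ∉ X ∪ Y, (∃ x ∈ X, IsLeafAt G x v) ∨
    (∃ y ∈ Y, ∃ v' ∉ X ∪ Y, IsPendantTriangleAt G y v v')

/-- `G` is a Cameron–Walker graph whose bipartite part is a complete bipartite graph. -/
def IsCompleteCameronWalker (G : SimpleGraph V) : Prop :=
  ∃ X Y : Set V, IsCameronWalkerOn G X Y ∧ ∀ x ∈ X, ∀ y ∈ Y, G.Adj x y

end Graphs

/-! ### Cohen–Macaulay rings -/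

/-- A (Noetherian) local ring is Cohen–Macaulay if its maximal ideal contains a regular sequence
whose length is the Krull dimension. -/
def IsCohenMacaulayLocal (R : Type*) [CommRing R] [IsLocalRing R] : Prop :=
  ∃ rs : List R, (∀ r ∈ rs, r ∈ IsLocalRing.maximalIdeal R) ∧
    RingTheory.Sequence.IsRegular R rs ∧ ((rs.length : ℕ) : WithBot ℕ∞) = ringKrullDim R

/-- A (Noetherian) ring is Cohen–Macaulay if all its local rings are. -/
def IsCohenMacaulay (R : Type*) [CommRing R] : Prop :=
  ∀ (p : Ideal R) [p.IsPrime], IsCohenMacaulayLocal (Localization.AtPrime p)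

section Ideals

variable {σ : Type*} (K : Type*) [Field K]

/-! ### Edge ideal and cover ideal -/

/-- The edge ideal `(x_a x_b : {a, b} an edge)`. -/
def edgeIdeal (G : SimpleGraph σ) : Ideal (MvPolynomial σ K) :=
  Ideal.span {f | ∃ a b, G.Adj a b ∧ f = MvPolynomial.X a * MvPolynomial.X b}

/-- `G` is Cohen–Macaulay over `K`: the quotient by its edge ideal is a Cohen–Macaulay ring. -/
def IsCohenMacaulayGraph (G : SimpleGraph σ) : Prop :=
  IsCohenMacaulay (MvPolynomial σ K ⧸ edgeIdeal K G)

/-- The cover ideal, generated by `u_C = ∏ v ∈ C, x_v` for the minimal vertex covers `C`. -/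
def coverIdeal (G : SimpleGraph σ) : Ideal (MvPolynomial σ K) :=
  Ideal.span {f | ∃ C : Finset σ, IsMinVertexCover G C ∧ f = ∏ v ∈ C, MvPolynomial.X v}

variable {K}

/-! ### Linear quotients and componentwise linearity -/

/-- The monomials in `I` that are minimal with respect to divisibility; for a monomial ideal this
is its minimal monomial generating set. -/
def minimalMonomials (I : Ideal (MvPolynomial σ K)) : Set (MvPolynomial σ K) :=
  {f | ∃ s : σ →₀ ℕ, Minimal (fun t => MvPolynomial.monomial t (1 : K) ∈ I) s ∧
    f = MvPolynomial.monomial s 1}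

/-- For `l = [f_0, f_1, …]`, every colon ideal `(f_0, …, f_{j-1}) : f_j` is generated by linear
forms. -/
def IsLinearQuotientsOrder (l : List (MvPolynomial σ K)) : Prop :=
  ∀ (j : ℕ) (hj : j < l.length), ∃ L : Set (MvPolynomial σ K), (∀ f ∈ L, f.IsHomogeneous 1) ∧
    Submodule.colon (Ideal.span {f | f ∈ l.take j}) {l[j]} = Ideal.span L

/-- `I` is generated by its minimal monomials, which are finitely many and can be enumerated
without repetition in an order of linear quotients. -/
def HasLinearQuotientsOnMinGens (I : Ideal (MvPolynomial σ K)) : Prop :=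
  ∃ l : List (MvPolynomial σ K), l.Nodup ∧ {f | f ∈ l} = minimalMonomials I ∧
    Ideal.span {f | f ∈ l} = I ∧ IsLinearQuotientsOrder l

/-- `I` has a `d`-linear resolution
`⋯ → S(-d-2)^{b 2} → S(-d-1)^{b 1} → S(-d)^{b 0} → I → 0`: the generators are homogeneous of
degree `d`, the entries of the matrices of the differentials are linear forms, and the complex is
exact. (Such a resolution is minimal, as all entries lie in the irrelevant maximal ideal; the zero
ideal has the zero resolution.) -/
def HasLinearResolution (d : ℕ) (I : Ideal (MvPolynomial σ K)) : Prop :=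
  ∃ (b : ℕ → ℕ) (g : Fin (b 0) → MvPolynomial σ K)
    (D : ∀ i, Matrix (Fin (b i)) (Fin (b (i + 1))) (MvPolynomial σ K)),
    (∀ a, (g a).IsHomogeneous d) ∧
    (∀ i a c, (D i a c).IsHomogeneous 1) ∧
    Ideal.span (Set.range g) = I ∧
    Function.Exact (D 0).mulVecLin (Fintype.linearCombination (MvPolynomial σ K) g) ∧
    ∀ i, Function.Exact (D (i + 1)).mulVecLin (D i).mulVecLin

/-- For each `j`, the ideal generated by the homogeneous elements of degree `j` of `I` has a linear
resolution. -/
def IsComponentwiseLinear (I : Ideal (MvPolynomial σ K)) : Prop :=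
  ∀ j : ℕ, HasLinearResolution j (Ideal.span {f | f ∈ I ∧ f.IsHomogeneous j})

end Ideals

end CoverPowers

end

namespace CoverPowers

/-! ### Linear quotients for sets of exponent vectors -/

section LinQuot

variable {σ τ : Type*}

/-! Everything is translated into exponent vectors. The monomials of the `k`-th power of the cover
ideal are the vectors in `coverSums k`, those lying above a sum of `k` indicators of vertex covers,
and linear quotients become the combinatorial statement `LinQuot` about the minimal vectors.

Reduction to the attached graphs. A vertex cover of the big graph is a cover of `G` together with,
over each `v`, a cover of `H v` if `v` is chosen and all of `W v` if it is not. A generator of the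
`k`-th power therefore has a base part `a` on `V`, and its part over `v` is a generator of the `a
v`-th power of the cover ideal of `H v`, shifted by `k - a v` (`mem_coverSums_attach`). Raising `a
v` by one permits strictly smaller exponents over `v`, because `W v` is non-empty. Listing
generators by decreasing total exponent on `V`, then by the orders in the fibres, gives linear
quotients (`linQuot_fibered`). It remains to treat all powers for each single `H v`.

The four families. An unmixed chordal graph is partitioned into cliques each containing a vertex
with no neighbour outside its clique, and one trades such free vertices for others
(`linQuot_coverSums_of_cliques`). For bipartite graphs `coverSums k` is cut out by the inequalities
`k ≤ t u + t v` on edges. On a path these are solved by repeated splitting at a vertex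
(`linQuot_pathSums`). In the Cohen–Macaulay bipartite case, connectedness of links of the
independence complex provides a trade along an edge (`exists_exchange`). A Cameron–Walker graph is
once more of fibered form, over its bipartite part.

From linear quotients to componentwise linearity. Each degree component of an ideal with linear
quotients again has linear quotients (`LinQuot.component`). When all generators have the same
degree, linear quotients give linear syzygies that inherit the same structure
(`LinSyz.exists_syzygies`), and iteration builds the resolution. -/

/-- `g` divides `x_i f`, in terms of exponents. -/
def LeUp (i : σ) (g f : σ → ℕ) : Prop := g i ≤ f i + 1 ∧ ∀ j, j ≠ i → g j ≤ f j

theorem LeUp.mono_left {i : σ} {g h f : σ → ℕ} (hf : LeUp i h f) (hgh : g ≤ h) : LeUp i g f :=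
  ⟨(hgh i).trans hf.1, fun j hj => (hgh j).trans (hf.2 j hj)⟩

/-- A set of exponent vectors has linear quotients: every refinement of the order by `key` to a
linear order is an order of linear quotients. -/
def LinQuotOn (M : Set (σ → ℕ)) : Prop :=
  ∃ key : (σ → ℕ) → ℕ, ∀ f ∈ M, ∀ f' ∈ M, f' ≠ f → key f' ≤ key f →
    ∃ i, f i < f' i ∧ ∃ g ∈ M, key g < key f ∧ LeUp i g f

/-- The minimal elements of a set of exponent vectors. -/
def minElts (U : Set (σ → ℕ)) : Set (σ → ℕ) := {f | Minimal (· ∈ U) f}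

/-- The minimal generators of the monomial ideal with exponents `U` have linear quotients. -/
def LinQuot (U : Set (σ → ℕ)) : Prop := LinQuotOn (minElts U)

theorem minElts_eq_of_le {U : Set (σ → ℕ)} {f g : σ → ℕ} (hf : f ∈ minElts U) (hg : g ∈ U)
    (h : g ≤ f) : g = f :=
  le_antisymm h (hf.2 hg h)

theorem exists_minElts_le [Finite σ] {U : Set (σ → ℕ)} {f : σ → ℕ} (hf : f ∈ U) :
    ∃ g ∈ minElts U, g ≤ f := by
  obtain ⟨g, hg, h⟩ := exists_minimal_le_of_wellFoundedLT (· ∈ U) f hf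
  exact ⟨g, h, hg⟩

theorem finite_minElts [Finite σ] (U : Set (σ → ℕ)) : (minElts U).Finite :=
  (setOfPred_minimal_antichain _).finite_of_partiallyWellOrderedOn
    (Set.isPWO_of_wellQuasiOrderedLE _)

/-- On a finite set a key in any linear order can be replaced by its rank, the number of elements
with strictly smaller key. This allows lexicographic and reversed orders below. -/
theorem LinQuotOn.of_key {α : Type*} [LinearOrder α] {M : Set (σ → ℕ)} (hM : M.Finite)
    (key : (σ → ℕ) → α)
    (h : ∀ f ∈ M, ∀ f' ∈ M, f' ≠ f → key f' ≤ key f →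
      ∃ i, f i < f' i ∧ ∃ g ∈ M, key g < key f ∧ LeUp i g f) : LinQuotOn M := by
  have hlt : ∀ f ∈ M, ∀ g, key f < key g →
      {h ∈ M | key h < key f}.ncard < {h ∈ M | key h < key g}.ncard := by
    intro f hf g hfg
    refine Set.ncard_lt_ncard ⟨fun x hx => ⟨hx.1, hx.2.trans hfg⟩, fun hs => ?_⟩
      (hM.subset fun x hx => hx.1)
    exact lt_irrefl _ (hs (show f ∈ {h ∈ M | key h < key g} from ⟨hf, hfg⟩)).2
  refine ⟨fun f => {h ∈ M | key h < key f}.ncard, fun f hf f' hf' hne hle => ?_⟩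
  have hle' : key f' ≤ key f := not_lt.1 fun hl => absurd (hlt f hf f' hl) (not_lt.2 hle)
  obtain ⟨i, hi, g, hg, hgk, hgf⟩ := h f hf f' hf' hne hle'
  exact ⟨i, hi, g, hg, hlt g hg f hgk, hgf⟩

theorem linQuot_Ici (l : σ → ℕ) : LinQuot {c : σ → ℕ | l ≤ c} := by
  have key : ∀ f ∈ minElts {c : σ → ℕ | l ≤ c}, f = l := fun f hf =>
    (minElts_eq_of_le hf (le_refl l) hf.1).symm
  exact ⟨fun _ => 0, fun f hf f' hf' hne => absurd ((key f' hf').trans (key f hf).symm) hne⟩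

theorem LinQuot.comp_equiv (e : σ ≃ τ) {U : Set (τ → ℕ)} (hU : LinQuot U) :
    LinQuot {t : σ → ℕ | t ∘ e.symm ∈ U} := by
  have hmin : ∀ f : σ → ℕ, f ∈ minElts {t : σ → ℕ | t ∘ e.symm ∈ U} ↔
      f ∘ e.symm ∈ minElts U := by
    intro f
    constructor
    · refine fun hf => ⟨hf.1, fun g hg hgf => ?_⟩
      have hge : (g ∘ e) ∘ e.symm = g := by ext; simp
      have := hf.2 (y := g ∘ e) (by simpa [hge] using hg) fun x => by simpa using hgf (e x)
      exact fun x => by simpa using this (e.symm x)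
    · refine fun hf => ⟨hf.1, fun g hg hgf x => ?_⟩
      simpa using hf.2 (y := g ∘ e.symm) hg (fun y => hgf _) (e x)
  obtain ⟨key, h⟩ := hU
  refine ⟨fun f => key (f ∘ e.symm), fun f hf f' hf' hne hle => ?_⟩
  obtain ⟨i, hi, g, hg, hgk, h1, h2⟩ := h _ ((hmin f).1 hf) _ ((hmin f').1 hf')
    (fun h' => hne (funext fun x => by simpa using congrFun h' (e x))) hle
  have hge : (g ∘ e) ∘ e.symm = g := by ext; simp
  refine ⟨e.symm i, hi, g ∘ e, (hmin _).2 (by rwa [hge]), ?_, ?_, fun j hj => ?_⟩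
  · change key ((g ∘ e) ∘ e.symm) < _
    rwa [hge]
  · simpa using h1
  · simpa using h2 (e j) fun h' => hj (by simp [← h'])

theorem LinQuot.add_const {U : Set (σ → ℕ)} (hU : LinQuot U) (c : ℕ) :
    LinQuot {s : σ → ℕ | ∃ m ∈ U, ∀ w, m w + c ≤ s w} := by
  have hmin : ∀ f ∈ minElts {s : σ → ℕ | ∃ m ∈ U, ∀ w, m w + c ≤ s w},
      ∃ m ∈ minElts U, f = fun w => m w + c := by
    intro f hf
    obtain ⟨m, hm, hmf⟩ := hf.1
    have hfm : (fun w => m w + c) = f := minElts_eq_of_le hf ⟨m, hm, fun w => le_rfl⟩ hmf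
    refine ⟨m, ⟨hm, fun m' hm' hle w => ?_⟩, hfm.symm⟩
    have h1 : m' w + c = f w := congrFun (minElts_eq_of_le hf (g := fun w => m' w + c)
      ⟨m', hm', fun w => le_rfl⟩ fun w => (Nat.add_le_add_right (hle w) c).trans (hmf w)) w
    have h2 : m w + c = f w := congrFun hfm w
    change m w ≤ m' w
    omega
  have hmin' : ∀ m ∈ minElts U,
      (fun w => m w + c) ∈ minElts {s : σ → ℕ | ∃ m ∈ U, ∀ w, m w + c ≤ s w} := by
    refine fun m hm => ⟨⟨m, hm.1, fun w => le_rfl⟩, ?_⟩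
    rintro s ⟨m', hm', hs⟩ hle w
    have := hm.2 hm' (fun w => Nat.le_of_add_le_add_right ((hs w).trans (hle w))) w
    exact (Nat.add_le_add_right this c).trans (hs w)
  obtain ⟨key, h⟩ := hU
  refine ⟨fun f => key fun w => f w - c, fun f hf f' hf' hne hle => ?_⟩
  obtain ⟨m, hm, rfl⟩ := hmin f hf
  obtain ⟨m', hm', rfl⟩ := hmin f' hf'
  simp only [Nat.add_sub_cancel] at hle
  obtain ⟨i, hi, g, hg, hgk, h1, h2⟩ := h m hm m' hm' (fun h' => hne (by rw [h'])) hle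
  refine ⟨i, by simpa using hi, fun w => g w + c, hmin' g hg, by simpa using hgk, ?_, ?_⟩
  · change g i + c ≤ m i + c + 1
    omega
  · intro j hj
    exact Nat.add_le_add_right (h2 j hj) c

/-- Splitting at a variable: the generators with exponent of `x_i` above `t` come first. -/
theorem LinQuot.split [Finite σ] {U U₂ : Set (σ → ℕ)} (i : σ) (t : ℕ)
    (h₁ : LinQuot {c ∈ U | t < c i}) (h₂ : LinQuot U₂) (hsub : U₂ ⊆ U)
    (hU₂ : ∀ c ∈ U, c i ≤ t → c ∈ U₂) (hmin₂ : ∀ c ∈ minElts U₂, c i ≤ t)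
    (hup : ∀ c ∈ minElts U₂, ∃ d ∈ U, t < d i ∧ LeUp i d c ∧ ∃ w, d w < c w) : LinQuot U := by
  -- `m1`–`m4`: the minimal elements of `U` are the disjoint union of those of `U₂` and those of the
  -- part with exponent above `t` at `i`.
  have m1 : ∀ c ∈ minElts U, c i ≤ t → c ∈ minElts U₂ := fun c hc hci =>
    ⟨hU₂ c hc.1 hci, fun d hd hdc => hc.2 (hsub hd) hdc⟩
  have m2 : ∀ c ∈ minElts U, t < c i → c ∈ minElts {c ∈ U | t < c i} := fun c hc hci =>
    ⟨⟨hc.1, hci⟩, fun d hd hdc => hc.2 hd.1 hdc⟩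
  have m3 : ∀ c ∈ minElts U₂, c ∈ minElts U := fun c hc =>
    ⟨hsub hc.1, fun d hd hdc => hc.2 (hU₂ d hd ((hdc i).trans (hmin₂ c hc))) hdc⟩
  have m4 : ∀ c ∈ minElts {c ∈ U | t < c i}, c ∈ minElts U := by
    refine fun c hc => ⟨hc.1.1, fun d hd hdc => ?_⟩
    by_cases hdi : t < d i
    · exact hc.2 ⟨hd, hdi⟩ hdc
    · exfalso
      -- A divisor of `c` with exponent at most `t` at `i` can be traded upwards at `i`. The result
      -- still divides `c`, has exponent above `t`, and is strictly smaller at `w`, against the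
      -- minimality of `c`.
      obtain ⟨d', hd', hdd⟩ := exists_minElts_le (hU₂ d hd (not_lt.1 hdi))
      obtain ⟨e, heU, hei, he, w, hw⟩ := hup d' hd'
      have hdc' := hdd.trans hdc
      have hec : e ≤ c := by
        intro j
        by_cases hj : j = i
        · subst hj
          have := he.1
          have := hmin₂ d' hd'
          have : t < c j := hc.1.2
          change e j ≤ c j
          omega
        · exact (he.2 j hj).trans (hdc' j)
      exact absurd (hc.2 ⟨heU, hei⟩ hec w) (not_le.2 (hw.trans_le (hdc' w)))
  obtain ⟨k₁, h₁⟩ := h₁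
  obtain ⟨k₂, h₂⟩ := h₂
  classical
  refine LinQuotOn.of_key (α := ℕ ×ₗ ℕ) (finite_minElts U)
    (fun c => if t < c i then toLex (0, k₁ c) else toLex (1, k₂ c)) fun f hf f' hf' hne hle => ?_
  by_cases hfi : t < f i
  · by_cases hfi' : t < f' i
    · simp only [hfi, hfi', if_true] at hle
      obtain ⟨l, hl, g, hg, hgk, hgf⟩ := h₁ f (m2 f hf hfi) f' (m2 f' hf' hfi') hne (by
        simpa [Prod.Lex.toLex_le_toLex] using hle)
      refine ⟨l, hl, g, m4 g hg, ?_, hgf⟩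
      have : t < g i := hg.1.2
      simp only [hfi, this, if_true]
      simpa [Prod.Lex.toLex_lt_toLex] using hgk
    · simp [hfi, hfi', Prod.Lex.toLex_le_toLex] at hle
  · by_cases hfi' : t < f' i
    · obtain ⟨d, hd, hdi, hdf, w, hw⟩ := hup f (m1 f hf (not_lt.1 hfi))
      obtain ⟨g, hg, hgd⟩ := exists_minElts_le (U := {c ∈ U | t < c i}) ⟨hd, hdi⟩
      refine ⟨i, (not_lt.1 hfi).trans_lt hfi', g, m4 g hg, ?_, hdf.mono_left hgd⟩
      have : t < g i := hg.1.2
      simp [hfi, this, Prod.Lex.toLex_lt_toLex]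
    · simp only [hfi, hfi', if_false] at hle
      obtain ⟨l, hl, g, hg, hgk, hgf⟩ := h₂ f (m1 f hf (not_lt.1 hfi)) f'
        (m1 f' hf' (not_lt.1 hfi')) hne (by simpa [Prod.Lex.toLex_le_toLex] using hle)
      refine ⟨l, hl, g, m3 g hg, ?_, hgf⟩
      simp only [hfi, not_lt.2 (hmin₂ g hg), if_false]
      simpa [Prod.Lex.toLex_lt_toLex] using hgk

end LinQuot

/-! ### Gluing linear quotients over a base -/

section Fibered

variable {V I : Type*} {W : I → Type*}

/-- Exponents on `V ⊔ ⨆ i, W i` whose restriction to `V` is at least some `a ∈ A` and whose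
restriction to each `W i` lies in `F i a`. -/
def fibered (A : Set (V → ℕ)) (F : ∀ i, (V → ℕ) → Set (W i → ℕ)) :
    Set ((V ⊕ (Σ i, W i)) → ℕ) :=
  {t | ∃ a ∈ A, (∀ v, a v ≤ t (.inl v)) ∧ ∀ i, (fun w => t (.inr ⟨i, w⟩)) ∈ F i a}

/-- The exponent vector glued from its restrictions. -/
def glue (a : V → ℕ) (s : ∀ i, W i → ℕ) : (V ⊕ (Σ i, W i)) → ℕ :=
  Sum.elim a fun p => s p.1 p.2

theorem eq_glue (t : (V ⊕ (Σ i, W i)) → ℕ) :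
    t = glue (fun v => t (.inl v)) fun i w => t (.inr ⟨i, w⟩) := by
  ext (v | ⟨i, w⟩) <;> rfl

theorem exists_bump_le [DecidableEq V] {A : Set (V → ℕ)}
    (h1 : ∀ a ∈ A, ∀ b ∈ A, ∀ v, a v < b v → a + Pi.single v 1 ∈ A) {a b : V → ℕ} (ha : a ∈ A)
    (hb : b ∈ A) (hab : a ≤ b) (hne : a ≠ b) :
    ∃ v, a + Pi.single v 1 ∈ A ∧ a + Pi.single v 1 ≤ b := by
  have : ∃ v, a v < b v := by
    by_contra hcon
    push Not at hcon
    exact hne (le_antisymm hab hcon)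
  obtain ⟨v, hv⟩ := this
  refine ⟨v, h1 a ha b hb v hv, fun u => ?_⟩
  by_cases hu : u = v
  · subst hu; simpa using hv
  · simpa [hu] using hab u

/-- The point is that a glued vector with minimal fibre parts cannot lie above one with a smaller
base `b`. One step from `b` towards `a` would, by `h3`, strictly lower some fibre part, and by `h2`
that lower part is still allowed over `a`. -/
theorem mem_minElts_fibered [DecidableEq V] {A : Set (V → ℕ)} {F : ∀ i, (V → ℕ) → Set (W i → ℕ)}
    (h1 : ∀ a ∈ A, ∀ b ∈ A, ∀ v, a v < b v → a + Pi.single v 1 ∈ A)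
    (h2 : ∀ a ∈ A, ∀ b ∈ A, a ≤ b → ∀ i, F i a ⊆ F i b)
    (h3 : ∀ a ∈ A, ∀ v, a + Pi.single v 1 ∈ A →
      ∃ i, ∀ s ∈ F i a, ∃ s' ∈ F i (a + Pi.single v 1), s' < s)
    (a : V → ℕ) (s : ∀ i, W i → ℕ) :
    glue a s ∈ minElts (fibered A F) ↔ a ∈ A ∧ ∀ i, s i ∈ minElts (F i a) := by
  classical
  constructor
  · intro hf
    obtain ⟨b, hb, hba, hs⟩ := hf.1
    have hba' : ∀ v, b v ≤ a v := hba
    have hs' : ∀ i, s i ∈ F i b := hs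
    have hab : b = a := by
      have hle := hf.2 (y := glue b s) ⟨b, hb, fun v => le_rfl, hs⟩ (by
        rintro (v | p)
        · exact hba v
        · exact le_rfl)
      exact funext fun v => le_antisymm (hba' v) (hle (.inl v))
    subst hab
    refine ⟨hb, fun i => ⟨hs' i, fun r hr hrs w => ?_⟩⟩
    have hle := hf.2 (y := glue b (Function.update s i r)) ⟨b, hb, fun v => le_rfl, fun l => by
        by_cases hl : l = i
        · subst hl
          simpa [glue] using hr
        · simpa [glue, hl] using hs' l⟩ (by
        rintro (v | ⟨l, w'⟩)
        · exact le_rfl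
        · by_cases hl : l = i
          · subst hl
            simpa [glue] using hrs w'
          · simp [glue, hl])
    simpa [glue] using hle (.inr ⟨i, w⟩)
  · rintro ⟨ha, hs⟩
    refine ⟨⟨a, ha, fun v => le_rfl, fun i => (hs i).1⟩, ?_⟩
    rintro t ⟨b, hb, hbt, ht⟩ hts
    have hba : b ≤ a := fun v => (hbt v).trans (hts (.inl v))
    have hab : b = a := by
      by_contra hne
      obtain ⟨v, hv, hva⟩ := exists_bump_le h1 hb ha hba hne
      obtain ⟨i, hi⟩ := h3 b hb v hv
      obtain ⟨s', hs', hlt⟩ := hi _ (ht i)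
      have hlt' : s' < s i := hlt.trans_le fun w => hts (.inr ⟨i, w⟩)
      exact absurd ((hs i).2 (h2 _ hv _ ha hva i hs') hlt'.le) (not_le_of_gt hlt')
    subst hab
    rintro (v | ⟨i, w⟩)
    · exact hbt v
    · exact (hs i).2 (ht i) (fun w => hts (.inr ⟨i, w⟩)) w

/-- Larger total base exponent comes first, and ties are ordered by the sum of the fibre keys. Over
the same base, the linear quotients of one fibre supply the step. Over different bases, the base is
raised at a vertex where the earlier generator is larger. -/
theorem linQuot_fibered [Finite V] [Finite I] [∀ i, Finite (W i)] [DecidableEq V] {A : Set (V → ℕ)} {F : ∀ i, (V → ℕ) → Set (W i → ℕ)}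
    (h1 : ∀ a ∈ A, ∀ b ∈ A, ∀ v, a v < b v → a + Pi.single v 1 ∈ A)
    (h2 : ∀ a ∈ A, ∀ b ∈ A, a ≤ b → ∀ i, F i a ⊆ F i b)
    (h3 : ∀ a ∈ A, ∀ v, a + Pi.single v 1 ∈ A →
      ∃ i, ∀ s ∈ F i a, ∃ s' ∈ F i (a + Pi.single v 1), s' < s)
    (h4 : ∀ a ∈ A, ∀ i, LinQuot (F i a)) : LinQuot (fibered A F) := by
  classical
  have := Fintype.ofFinite V
  have := Fintype.ofFinite I
  have hmin := mem_minElts_fibered h1 h2 h3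
  have h4' : ∀ (a : V → ℕ) (i : I), ∃ key : (W i → ℕ) → ℕ, a ∈ A →
      ∀ f ∈ minElts (F i a), ∀ f' ∈ minElts (F i a), f' ≠ f → key f' ≤ key f →
        ∃ w, f w < f' w ∧ ∃ g ∈ minElts (F i a), key g < key f ∧ LeUp w g f := by
    intro a i
    by_cases ha : a ∈ A
    · obtain ⟨key, hk⟩ := h4 a ha i
      exact ⟨key, fun _ => hk⟩
    · exact ⟨fun _ => 0, fun h => absurd h ha⟩
  choose key hkey using h4'
  refine LinQuotOn.of_key (α := ℕᵒᵈ ×ₗ ℕ) (finite_minElts _)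
    (fun t => toLex (OrderDual.toDual (∑ v, t (.inl v)),
      ∑ i, key (fun v => t (.inl v)) i fun w => t (.inr ⟨i, w⟩))) fun f hf f' hf' hne hle => ?_
  obtain ⟨a, s, rfl⟩ : ∃ a s, f = glue (W := W) a s := ⟨_, _, eq_glue f⟩
  obtain ⟨a', s', rfl⟩ : ∃ a s, f' = glue (W := W) a s := ⟨_, _, eq_glue f'⟩
  obtain ⟨ha, hs⟩ := (hmin a s).1 hf
  obtain ⟨ha', hs'⟩ := (hmin a' s').1 hf'
  change toLex (OrderDual.toDual (∑ v, a' v), ∑ i, key a' i (s' i)) ≤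
    toLex (OrderDual.toDual (∑ v, a v), ∑ i, key a i (s i)) at hle
  rw [Prod.Lex.toLex_le_toLex] at hle
  by_cases haa : a' = a
  · subst haa
    have hle' : ∑ i, key a' i (s' i) ≤ ∑ i, key a' i (s i) := by simpa using hle
    have : ∃ i, s' i ≠ s i ∧ key a' i (s' i) ≤ key a' i (s i) := by
      by_contra hcon
      push Not at hcon
      have hex : ∃ i, s' i ≠ s i := by
        by_contra hcon'
        push Not at hcon'
        exact hne (by rw [funext hcon'])
      obtain ⟨i, hi⟩ := hex
      refine absurd hle' (not_le.2 (Finset.sum_lt_sum (fun l _ => ?_)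
        ⟨i, Finset.mem_univ i, hcon i hi⟩))
      by_cases hl : s' l = s l
      · rw [hl]
      · exact (hcon l hl).le
    obtain ⟨i, hi, hik⟩ := this
    obtain ⟨w, hw, g, hg, hgk, hg1, hg2⟩ := hkey a' i ha (s i) (hs i) (s' i) (hs' i) hi hik
    refine ⟨.inr ⟨i, w⟩, hw, glue a' (Function.update s i g), (hmin _ _).2 ⟨ha, fun l => ?_⟩,
      ?_, ?_, ?_⟩
    · by_cases hl : l = i
      · subst hl
        simpa using hg
      · simpa [hl] using hs l
    · change toLex (OrderDual.toDual (∑ v, a' v), ∑ i', key a' i' (Function.update s i g i')) <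
        toLex (OrderDual.toDual (∑ v, a' v), ∑ i, key a' i (s i))
      rw [Prod.Lex.toLex_lt_toLex]
      refine Or.inr ⟨rfl, Finset.sum_lt_sum (fun l _ => ?_) ⟨i, Finset.mem_univ i, by simpa⟩⟩
      by_cases hl : l = i
      · subst hl
        simpa using hgk.le
      · simp [hl]
    · simpa [glue] using hg1
    · rintro (v | ⟨l, w'⟩) hj
      · exact le_rfl
      · by_cases hl : l = i
        · subst hl
          have : w' ≠ w := fun h => hj (by rw [h])
          simpa [glue] using hg2 w' this
        · simp [glue, hl]
  · have hsum : ∑ v, a v ≤ ∑ v, a' v := by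
      rcases hle with h | h
      · exact (OrderDual.toDual_lt_toDual.1 h).le
      · exact le_of_eq (OrderDual.toDual_inj.1 h.1).symm
    have : ∃ v, a v < a' v := by
      by_contra hcon
      push Not at hcon
      refine haa (funext fun v => ?_)
      have heq := le_antisymm hsum (Finset.sum_le_sum fun v _ => hcon v)
      exact (Finset.sum_eq_sum_iff_of_le fun v _ => hcon v).1 heq.symm v (Finset.mem_univ v)
    obtain ⟨v, hv⟩ := this
    have hav := h1 a ha a' ha' v hv
    have hle_av : a ≤ a + Pi.single v 1 := fun u => Nat.le_add_right _ _
    -- Fibres grow with the base, so minimal elements over the raised base can be found below the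
    -- old fibre parts. Only the exponent at `v` goes up.
    choose g hg hgs using fun i => exists_minElts_le (h2 a ha _ hav hle_av i (hs i).1)
    refine ⟨.inl v, hv, glue (a + Pi.single v 1) g, (hmin _ _).2 ⟨hav, hg⟩, ?_, ?_, ?_⟩
    · change toLex (OrderDual.toDual (∑ u, (a + Pi.single v 1 : V → ℕ) u), _) <
        toLex (OrderDual.toDual (∑ v, a v), _)
      rw [Prod.Lex.toLex_lt_toLex]
      refine Or.inl (OrderDual.toDual_lt_toDual.2 ?_)
      exact Finset.sum_lt_sum (fun u _ => hle_av u) ⟨v, Finset.mem_univ v, by simp⟩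
    · simp [glue]
    · rintro (u | ⟨i, w⟩) hj
      · have : u ≠ v := fun h => hj (by rw [h])
        simp [glue, this]
      · exact hgs i w

end Fibered

end CoverPowers

namespace CoverPowers

open MvPolynomial

/-! ### Linear resolutions from linear quotients -/

section Resolution

variable {σ K : Type*} [Field K]

/-- The colon ideals `(g_l : l < j) : g_j` are generated by variables `x_i`, and each relation
`x_i g_j ∈ (g_l : l < j)` has linear coefficients. -/
def LinSyz {ι M : Type*} [Fintype ι] [LinearOrder ι] [AddCommGroup M] [Module (MvPolynomial σ K) M]
    (g : ι → M) : Prop :=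
  ∀ j, ∃ s : Set σ,
    (∀ i ∈ s, ∃ c : ι → MvPolynomial σ K, (∀ l, (c l).IsHomogeneous 1) ∧ (∀ l, j ≤ l → c l = 0) ∧
      (X i : MvPolynomial σ K) • g j = ∑ l, c l • g l) ∧
    ∀ p : MvPolynomial σ K, p • g j ∈ Submodule.span (MvPolynomial σ K) (g '' {l | l < j}) →
      p ∈ Ideal.span (X '' s)

theorem LinSyz.comp_orderIso {ι κ M : Type*} [Fintype ι] [LinearOrder ι] [Fintype κ]
    [LinearOrder κ] [AddCommGroup M] [Module (MvPolynomial σ K) M] {g : ι → M}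
    (hg : LinSyz (K := K) (σ := σ) g) (e : κ ≃o ι) : LinSyz (K := K) (σ := σ) (g ∘ e) := by
  intro j
  obtain ⟨s, h1, h2⟩ := hg (e j)
  refine ⟨s, fun i hi => ?_, fun p hp => h2 p ?_⟩
  · obtain ⟨c, hc, hc0, hcs⟩ := h1 i hi
    refine ⟨c ∘ e, fun l => hc _, fun l hl => hc0 _ (e.monotone hl), ?_⟩
    rw [Function.comp_apply, hcs]
    exact (Equiv.sum_comp e.toEquiv fun l => c l • g l).symm
  · refine Submodule.span_mono ?_ hp
    rintro _ ⟨l, hl, rfl⟩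
    exact ⟨e l, e.lt_iff_lt.2 hl, rfl⟩

theorem homogeneousComponent_mul_of_isHomogeneous_one (a v : MvPolynomial σ K)
    (hv : v.IsHomogeneous 1) :
    homogeneousComponent 2 (a * v) = homogeneousComponent 1 a * v := by
  conv_lhs => rw [← sum_homogeneousComponent a]
  rw [Finset.sum_mul, map_sum]
  have hterm : ∀ i, homogeneousComponent 2 (homogeneousComponent i a * v) =
      if i = 1 then homogeneousComponent i a * v else 0 := by
    intro i
    have h := (homogeneousComponent_isHomogeneous i a).mul hv
    rw [homogeneousComponent_of_mem h]
    exact if_congr (by omega) rfl rfl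
  simp only [hterm, Finset.sum_ite_eq', Finset.mem_range]
  split_ifs with h
  · rfl
  · rw [homogeneousComponent_eq_zero _ _ (by omega), zero_mul]

theorem mem_span_X_of_mul_X_mem {s : Set σ} {i : σ} (hi : i ∉ s) {q : MvPolynomial σ K}
    (h : q * X i ∈ Ideal.span (X '' s : Set (MvPolynomial σ K))) :
    q ∈ Ideal.span (X '' s : Set (MvPolynomial σ K)) := by
  classical
  rw [mem_ideal_span_X_image] at h ⊢
  intro m hm
  obtain ⟨l, hl, hne⟩ := h (m + Finsupp.single i 1) (by
    rw [mem_support_iff] at hm ⊢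
    rwa [coeff_mul_X])
  refine ⟨l, hl, ?_⟩
  have : l ≠ i := fun h => hi (h ▸ hl)
  simpa [Finsupp.single_apply, this.symm] using hne

section Syzygies

variable {M : Type*} [AddCommGroup M] [Module (MvPolynomial σ K) M] {b : ℕ}

/-- The syzygy given by `x_i g_j = ∑ c_l g_l`. -/
noncomputable def syzVec (c : Fin b → σ → Fin b → MvPolynomial σ K) (j : Fin b) (i : σ) :
    Fin b → MvPolynomial σ K :=
  fun l => (if l = j then X i else 0) - c j i l

theorem sum_syzVec_smul {g : Fin b → M} {c : Fin b → σ → Fin b → MvPolynomial σ K} {j : Fin b}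
    {i : σ} (h : (X i : MvPolynomial σ K) • g j = ∑ l, c j i l • g l) :
    ∑ l, syzVec c j i l • g l = 0 := by
  simp [syzVec, sub_smul, Finset.sum_sub_distrib, ite_smul, h]

/-- Reduction by leading terms: the last possibly non-zero coefficient of a syzygy lies in the colon
ideal at its index, so it can be cancelled by a combination of the syzygies attached to the
generators of that colon ideal. -/
theorem mem_span_syzVec {g : Fin b → M} {s : Fin b → Set σ}
    {c : Fin b → σ → Fin b → MvPolynomial σ K} (h0 : ∀ j, ∀ i ∈ s j, ∀ l, j ≤ l → c j i l = 0)
    (hrel : ∀ j, ∀ i ∈ s j, (X i : MvPolynomial σ K) • g j = ∑ l, c j i l • g l)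
    (hcol : ∀ j, ∀ p : MvPolynomial σ K,
      p • g j ∈ Submodule.span (MvPolynomial σ K) (g '' {l | l < j}) → p ∈ Ideal.span (X '' s j))
    (n : ℕ) (a : Fin b → MvPolynomial σ K) (ha0 : ∀ l : Fin b, n ≤ l → a l = 0)
    (ha : ∑ l, a l • g l = 0) :
    a ∈ Submodule.span (MvPolynomial σ K) {v | ∃ j : Fin b, (j : ℕ) < n ∧ ∃ i ∈ s j,
      v = syzVec c j i} := by
  induction n generalizing a with
  | zero =>
    have : a = 0 := funext fun l => ha0 l (Nat.zero_le _)
    rw [this]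
    exact Submodule.zero_mem _
  | succ n ih =>
    have hmono : Submodule.span (MvPolynomial σ K) {v | ∃ j : Fin b, (j : ℕ) < n ∧ ∃ i ∈ s j,
        v = syzVec c j i} ≤ Submodule.span (MvPolynomial σ K)
          {v | ∃ j : Fin b, (j : ℕ) < n + 1 ∧ ∃ i ∈ s j, v = syzVec c j i} :=
      Submodule.span_mono fun v ⟨j, hj, hv⟩ => ⟨j, hj.trans (Nat.lt_succ_self n), hv⟩
    by_cases hn : n < b
    · set j : Fin b := ⟨n, hn⟩ with hj
      have hmem : a j ∈ Ideal.span (X '' s j : Set (MvPolynomial σ K)) := by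
        refine hcol j _ ?_
        have : a j • g j = -∑ l ∈ Finset.univ.erase j, a l • g l := by
          rw [eq_neg_iff_add_eq_zero, Finset.add_sum_erase _ (fun l => a l • g l) (Finset.mem_univ j), ha]
        rw [this]
        refine Submodule.neg_mem _ (Submodule.sum_mem _ fun l hl => ?_)
        by_cases hlj : l < j
        · exact Submodule.smul_mem _ _ (Submodule.subset_span ⟨l, hlj, rfl⟩)
        · have hne : l ≠ j := (Finset.mem_erase.1 hl).1
          rw [ha0 l (by
            have : j < l := lt_of_le_of_ne (not_lt.1 hlj) hne.symm
            exact this), zero_smul]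
          exact Submodule.zero_mem _
      -- Each element of the colon ideal is the leading coefficient, at `j`, of a combination of the
      -- basic syzygies with nothing beyond `j`.
      have key : ∀ r ∈ Ideal.span (X '' s j : Set (MvPolynomial σ K)),
          ∃ v ∈ Submodule.span (MvPolynomial σ K) {v | ∃ j : Fin b, (j : ℕ) < n + 1 ∧ ∃ i ∈ s j,
            v = syzVec c j i}, v j = r ∧ (∀ l, j < l → v l = 0) ∧ ∑ l, v l • g l = 0 := by
        intro r hr
        induction hr using Submodule.span_induction with
        | mem r hr =>
          obtain ⟨i, hi, rfl⟩ := hr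
          refine ⟨syzVec c j i, Submodule.subset_span ⟨j, Nat.lt_succ_self n, i, hi, rfl⟩, ?_, ?_,
            sum_syzVec_smul (hrel j i hi)⟩
          · simp [syzVec, h0 j i hi j le_rfl]
          · intro l hl
            simp [syzVec, h0 j i hi l hl.le, hl.ne']
        | zero => exact ⟨0, Submodule.zero_mem _, rfl, fun _ _ => rfl, by simp⟩
        | add x y _ _ hx hy =>
          obtain ⟨v, hv, hvj, hv0, hvs⟩ := hx
          obtain ⟨w, hw, hwj, hw0, hws⟩ := hy
          refine ⟨v + w, Submodule.add_mem _ hv hw, by simp [hvj, hwj],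
            fun l hl => by simp [hv0 l hl, hw0 l hl], ?_⟩
          simp [add_smul, Finset.sum_add_distrib, hvs, hws]
        | smul q x _ hx =>
          obtain ⟨v, hv, hvj, hv0, hvs⟩ := hx
          refine ⟨q • v, Submodule.smul_mem _ _ hv, by simp [hvj],
            fun l hl => by simp [hv0 l hl], ?_⟩
          simp only [Pi.smul_apply, smul_assoc]
          rw [← Finset.smul_sum, hvs, smul_zero]
      obtain ⟨v, hv, hvj, hv0, hvs⟩ := key _ hmem
      have hsub : a - v ∈ Submodule.span (MvPolynomial σ K) {v | ∃ j : Fin b, (j : ℕ) < n ∧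
          ∃ i ∈ s j, v = syzVec c j i} := by
        refine ih (a - v) (fun l hl => ?_) ?_
        · rcases eq_or_lt_of_le hl with h | h
          · have : l = j := Fin.ext h.symm
            simp [this, hvj]
          · simp [ha0 l h, hv0 l h]
        · simp [sub_smul, Finset.sum_sub_distrib, ha, hvs]
      have := Submodule.add_mem _ (hmono hsub) hv
      rwa [sub_add_cancel] at this
    · refine hmono (ih a (fun l hl => ?_) ha)
      exact absurd (hl.trans_lt l.2) hn

end Syzygies

/-- A Schreyer-type argument. The syzygies are indexed by pairs `(j, i)` with `x_i` in the `j`-th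
colon ideal and ordered lexicographically. The colon ideal at `(j, i)` is then generated by the
`x_{i'}` with `i' < i` in the same set `s j`, so the linear structure persists. -/
theorem LinSyz.exists_syzygies [Finite σ] {M : Type*} [AddCommGroup M]
    [Module (MvPolynomial σ K) M] {b : ℕ} {g : Fin b → M} (hg : LinSyz (K := K) (σ := σ) g) :
    ∃ (b' : ℕ) (D : Matrix (Fin b) (Fin b') (MvPolynomial σ K)),
      (∀ a c, (D a c).IsHomogeneous 1) ∧
      Function.Exact D.mulVecLin (Fintype.linearCombination (MvPolynomial σ K) g) ∧
      LinSyz (K := K) (σ := σ) D.col := by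
  classical
  obtain ⟨n, ⟨eσ⟩⟩ := Finite.exists_equiv_fin σ
  let _ : LinearOrder σ := LinearOrder.lift' eσ eσ.injective
  choose s hs hcol using hg
  have hs' : ∀ j i, ∃ c : Fin b → MvPolynomial σ K, (∀ l, (c l).IsHomogeneous 1) ∧
      (i ∈ s j → (∀ l, j ≤ l → c l = 0) ∧
        (X i : MvPolynomial σ K) • g j = ∑ l, c l • g l) := by
    intro j i
    by_cases hi : i ∈ s j
    · obtain ⟨c, h1, h2, h3⟩ := hs j i hi
      exact ⟨c, h1, fun _ => ⟨h2, h3⟩⟩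
    · exact ⟨0, fun l => isHomogeneous_zero _ _ _, fun h => absurd h hi⟩
  choose c hc hc' using hs'
  have h0 : ∀ j, ∀ i ∈ s j, ∀ l, j ≤ l → c j i l = 0 := fun j i hi => (hc' j i hi).1
  have hrel : ∀ j, ∀ i ∈ s j, (X i : MvPolynomial σ K) • g j = ∑ l, c j i l • g l :=
    fun j i hi => (hc' j i hi).2
  have hvhom : ∀ j i l, (syzVec c j i l).IsHomogeneous 1 := by
    intro j i l
    refine IsHomogeneous.sub ?_ (hc j i l)
    split_ifs
    · exact isHomogeneous_X _ _
    · exact isHomogeneous_zero _ _ _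
  let κ := {p : Fin b ×ₗ σ // (ofLex p).2 ∈ s (ofLex p).1}
  have : Finite κ := Subtype.finite (α := Fin b × σ)
  let _ : Fintype κ := Fintype.ofFinite κ
  let v : κ → Fin b → MvPolynomial σ K := fun p => syzVec c (ofLex p.1).1 (ofLex p.1).2
  have hspan : ∀ n : ℕ, {v' | ∃ j : Fin b, (j : ℕ) < n ∧ ∃ i ∈ s j, v' = syzVec c j i} =
      v '' {p : κ | ((ofLex p.1).1 : ℕ) < n} := by
    intro n
    ext w
    constructor
    · rintro ⟨j, hj, i, hi, rfl⟩
      exact ⟨⟨toLex (j, i), hi⟩, hj, rfl⟩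
    · rintro ⟨p, hp, rfl⟩
      exact ⟨_, hp, _, p.2, rfl⟩
  have hker := mem_span_syzVec h0 hrel hcol
  simp only [hspan] at hker
  have hv : LinSyz (K := K) (σ := σ) v := by
    rintro ⟨p, hp⟩
    obtain ⟨⟨j, i⟩, rfl⟩ := toLex.surjective p
    change i ∈ s j at hp
    refine ⟨{l | l < i ∧ l ∈ s j}, ?_, fun q hq => ?_⟩
    · rintro i' ⟨hlt, hi'⟩
      -- The combination `w` has leading terms `x_{i'} x_i - x_i x_{i'} = 0` at `j`, so it is a
      -- combination of syzygies with smaller first index.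
      let p' : κ := ⟨toLex (j, i'), hi'⟩
      let w : Fin b → MvPolynomial σ K :=
        (X i' : MvPolynomial σ K) • syzVec c j i - (X i : MvPolynomial σ K) • syzVec c j i'
      have hw : w ∈ Submodule.span (MvPolynomial σ K)
          (v '' {p : κ | ((ofLex p.1).1 : ℕ) < j}) := by
        refine hker j w (fun l hl => ?_) ?_
        · have hl' : j ≤ l := hl
          simp only [w, syzVec, Pi.sub_apply, Pi.smul_apply, h0 j i hp l hl', h0 j i' hi' l hl',
            smul_eq_mul, sub_zero]
          split_ifs <;> ring
        · simp only [w, Pi.sub_apply, Pi.smul_apply, sub_smul, smul_assoc, Finset.sum_sub_distrib]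
          rw [← Finset.smul_sum, ← Finset.smul_sum, sum_syzVec_smul (hrel j i hp),
            sum_syzVec_smul (hrel j i' hi'), smul_zero, smul_zero, sub_zero]
      obtain ⟨a, ha0, haw⟩ : ∃ a : κ → MvPolynomial σ K,
          (∀ q : κ, j ≤ (ofLex q.1).1 → a q = 0) ∧ ∑ q, a q • v q = w := by
        rw [Finsupp.mem_span_image_iff_linearCombination] at hw
        obtain ⟨a, ha, haw⟩ := hw
        refine ⟨a, fun q hq => ?_, ?_⟩
        · by_contra hne
          have : ((ofLex q.1).1 : ℕ) < j := ha (Finsupp.mem_support_iff.2 hne)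
          exact absurd this (not_lt.2 hq)
        · rw [← haw, Finsupp.linearCombination_apply, Finsupp.sum_fintype _ _ (by simp)]
      have hwhom : ∀ l, (w l).IsHomogeneous 2 := fun l => by
        have h1 := (isHomogeneous_X K i').mul (hvhom j i l)
        have h2 := (isHomogeneous_X K i).mul (hvhom j i' l)
        exact h1.sub h2
      -- The entries of `w` are quadratic and those of `v q` linear, so the coefficients may be
      -- replaced by their linear parts.
      have haw' : ∑ q, homogeneousComponent 1 (a q) • v q = w := by
        ext1 l
        have h1 := congrArg (homogeneousComponent 2) (congrFun haw l)
        rw [homogeneousComponent_of_mem (hwhom l), if_pos rfl] at h1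
        rw [← h1, Finset.sum_apply, Finset.sum_apply, map_sum]
        refine Finset.sum_congr rfl fun q _ => ?_
        simp only [Pi.smul_apply, smul_eq_mul]
        exact (homogeneousComponent_mul_of_isHomogeneous_one _ _ (hvhom _ _ _)).symm
      refine ⟨fun q => homogeneousComponent 1 (a q) + if q = p' then X i else 0, fun q => ?_,
        fun q hq => ?_, ?_⟩
      · refine (homogeneousComponent_isHomogeneous _ _).add ?_
        split_ifs
        · exact isHomogeneous_X _ _
        · exact isHomogeneous_zero _ _ _
      · have hq' : toLex (j, i) ≤ q.1 := hq
        have hq1 : j ≤ (ofLex q.1).1 := by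
          rcases Prod.Lex.le_iff.1 hq' with h | h
          · exact h.le
          · exact h.1.le
        have hqp : q ≠ p' := by
          rintro rfl
          rcases Prod.Lex.le_iff.1 hq' with h | h
          · exact lt_irrefl _ h
          · exact absurd hlt (not_lt.2 h.2)
        simp [ha0 q hq1, hqp]
      · simp only [add_smul, Finset.sum_add_distrib, haw']
        rw [Finset.sum_eq_single p' (fun q _ hq => by simp [hq]) (by simp), if_pos rfl]
        change (X i' : MvPolynomial σ K) • syzVec c j i = w + (X i : MvPolynomial σ K) • syzVec c j i'
        simp [w]
    -- The `j`-th coordinate kills the syzygies with smaller first index and sends the one at `(j,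
    -- i')` to `x_{i'}`. What remains is a colon ideal of variables by another variable.
    · have hproj := Submodule.mem_map_of_mem (f := LinearMap.proj (R := MvPolynomial σ K) j) hq
      rw [Submodule.map_span] at hproj
      have hX : syzVec c j i j = X i := by simp [syzVec, h0 j i hp j le_rfl]
      have : q * X i ∈ Ideal.span (X '' {l | l < i ∧ l ∈ s j} : Set (MvPolynomial σ K)) := by
        have h1 : (LinearMap.proj (R := MvPolynomial σ K) (φ := fun _ => MvPolynomial σ K) j)
            (q • v ⟨toLex (j, i), hp⟩) = q * X i := by
          simp [v, hX]
        rw [h1] at hproj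
        refine Submodule.span_le.2 ?_ hproj
        rintro _ ⟨_, ⟨⟨p'', hp''⟩, hlt, rfl⟩, rfl⟩
        obtain ⟨⟨j', i'⟩, rfl⟩ := toLex.surjective p''
        change i' ∈ s j' at hp''
        have hlt' : toLex (j', i') < toLex (j, i) := hlt
        change syzVec c j' i' j ∈ Ideal.span _
        rcases Prod.Lex.toLex_lt_toLex.1 hlt' with h | ⟨h, h'⟩
        · have : syzVec c j' i' j = 0 := by
            simp only at h
            simp [syzVec, h0 j' i' hp'' j h.le, h.ne']
          rw [this]
          exact Submodule.zero_mem _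
        · simp only at h h'
          subst h
          have : syzVec c j' i' j' = X i' := by simp [syzVec, h0 j' i' hp'' j' le_rfl]
          rw [this]
          exact Ideal.subset_span ⟨i', ⟨h', hp''⟩, rfl⟩
      exact mem_span_X_of_mul_X_mem (by simp) this
  let e : Fin (Fintype.card κ) ≃o κ := Fintype.orderIsoFinOfCardEq κ rfl
  refine ⟨Fintype.card κ, Matrix.of fun l q => v (e q) l, fun l q => hvhom _ _ _, fun y => ?_,
    hv.comp_orderIso e⟩
  have hmul : ∀ x : Fin (Fintype.card κ) → MvPolynomial σ K,
      (Matrix.of fun l q => v (e q) l).mulVecLin x = ∑ q, x q • v (e q) := by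
    intro x
    ext1 l
    simp [Matrix.mulVec, dotProduct, Finset.sum_apply, mul_comm]
  constructor
  · intro hy
    rw [Fintype.linearCombination_apply] at hy
    have hmem := hker b y (fun l hl => absurd l.2 (not_lt.2 hl)) hy
    have hmem' : y ∈ Submodule.span (MvPolynomial σ K) (Set.range (v ∘ e)) := by
      refine Submodule.span_mono ?_ hmem
      rintro _ ⟨p, -, rfl⟩
      exact ⟨e.symm p, by simp⟩
    obtain ⟨x, hx⟩ := (Submodule.mem_span_range_iff_exists_fun _).1 hmem'
    exact ⟨x, by rw [hmul, ← hx]; rfl⟩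
  · rintro ⟨x, rfl⟩
    rw [hmul, map_sum]
    refine Finset.sum_eq_zero fun q _ => ?_
    rw [map_smul, Fintype.linearCombination_apply]
    have : ∑ l, v (e q) l • g l = 0 := sum_syzVec_smul (hrel _ _ (e q).2)
    rw [this, smul_zero]

/-- `T` packages a linear matrix together with the fact that its columns again satisfy `LinSyz`.
This invariant lets `LinSyz.exists_syzygies` be iterated forever; no termination is needed. -/
theorem HasLinearResolution.of_linSyz [Finite σ] {d b : ℕ} {g : Fin b → MvPolynomial σ K}
    (hg : LinSyz (K := K) (σ := σ) g) (hd : ∀ a, (g a).IsHomogeneous d) :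
    HasLinearResolution d (Ideal.span (Set.range g)) := by
  obtain ⟨b', D, hD, hex, hsyz⟩ := hg.exists_syzygies
  let T := Σ (b b' : ℕ), {D : Matrix (Fin b) (Fin b') (MvPolynomial σ K) //
    (∀ a c, (D a c).IsHomogeneous 1) ∧ LinSyz (K := K) (σ := σ) D.col}
  have hnext : ∀ t : T, ∃ (b'' : ℕ) (E : Matrix (Fin t.2.1) (Fin b'') (MvPolynomial σ K)),
      ((∀ a c, (E a c).IsHomogeneous 1) ∧ LinSyz (K := K) (σ := σ) E.col) ∧
      Function.Exact E.mulVecLin t.2.2.1.mulVecLin := by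
    rintro ⟨b, b', D, hD, hsyz⟩
    obtain ⟨b'', E, hE, hex, hE'⟩ := hsyz.exists_syzygies
    refine ⟨b'', E, ⟨hE, hE'⟩, ?_⟩
    have : ⇑D.mulVecLin = ⇑(Fintype.linearCombination (MvPolynomial σ K) D.col) := by
      funext x
      ext1 l
      simp [Matrix.mulVec, dotProduct, Fintype.linearCombination_apply, mul_comm]
    rw [this]
    exact hex
  choose nb nE hnE hnex using hnext
  let next : T → T := fun t => ⟨t.2.1, nb t, nE t, hnE t⟩
  let t0 : T := ⟨b, b', D, hD, hsyz⟩
  let seq : ℕ → T := fun i => Nat.rec t0 (fun _ t => next t) i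
  exact ⟨fun i => (seq i).1, g, fun i => (seq i).2.2.1, hd, fun i => (seq i).2.2.2.1, rfl, hex,
    fun i => hnex (seq i)⟩

end Resolution

end CoverPowers

namespace CoverPowers

open MvPolynomial

/-! ### Monomial ideals and exponent vectors -/

section Monomial

theorem exists_sorted_list {σ : Type*} {M : Set (σ → ℕ)} (hM : M.Finite) (key : (σ → ℕ) → ℕ) :
    ∃ l : List (σ → ℕ), l.Nodup ∧ {f | f ∈ l} = M ∧
      (∀ j (hj : j < l.length), ∀ f ∈ l.take j, f ≠ l[j] ∧ key f ≤ key l[j]) ∧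
      ∀ j (hj : j < l.length), ∀ f ∈ M, key f < key l[j] → f ∈ l.take j := by
  let r : (σ → ℕ) → (σ → ℕ) → Prop := fun a b => key a ≤ key b
  have : DecidableRel r := fun a b => inferInstanceAs (Decidable (key a ≤ key b))
  have : Std.Total r := ⟨fun a b => le_total (key a) (key b)⟩
  have : IsTrans _ r := ⟨fun a b c => le_trans⟩
  let l := hM.toFinset.toList.insertionSort r
  have hmem : ∀ f, f ∈ l ↔ f ∈ M := by simp [l]
  have hnd : l.Nodup := (List.perm_insertionSort r _).nodup_iff.2 (Finset.nodup_toList _)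
  have hsort : l.Pairwise r := List.pairwise_insertionSort r _
  refine ⟨l, hnd, Set.ext hmem, fun j hj f hf => ?_, fun j hj f hf hlt => ?_⟩
  · obtain ⟨i, hi, rfl⟩ := List.mem_iff_getElem.1 hf
    have hi' : i < j := by
      rw [List.length_take] at hi
      omega
    rw [List.getElem_take]
    exact ⟨fun h => hi'.ne ((hnd.getElem_inj_iff).1 h), List.pairwise_iff_getElem.1 hsort _ _ _ _ hi'⟩
  · obtain ⟨i, hi, rfl⟩ := List.mem_iff_getElem.1 ((hmem f).2 hf)
    have hij : i < j := by
      by_contra hcon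
      rcases eq_or_lt_of_le (not_lt.1 hcon) with h | h
      · subst h
        exact lt_irrefl _ hlt
      · exact absurd (List.pairwise_iff_getElem.1 hsort _ _ hj hi h) (not_le.2 hlt)
    exact List.mem_take_iff_getElem.2 ⟨i, by omega, rfl⟩

variable {σ : Type*} [Finite σ] (K : Type*) [Field K]

/-- The monomial with exponent vector `f`. -/
noncomputable def mon (f : σ → ℕ) : MvPolynomial σ K :=
  monomial (Finsupp.equivFunOnFinite.symm f) 1

theorem mon_injective : Function.Injective (mon K : (σ → ℕ) → MvPolynomial σ K) := fun _ _ h =>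
  Finsupp.equivFunOnFinite.symm.injective (monomial_left_injective one_ne_zero h)

variable {K}

theorem mem_span_mon {p : MvPolynomial σ K} {M : Set (σ → ℕ)} :
    p ∈ Ideal.span (mon K '' M) ↔ ∀ m ∈ p.support, ∃ g ∈ M, g ≤ ⇑m := by
  have : mon K '' M = (fun s => monomial s (1 : K)) '' (Finsupp.equivFunOnFinite.symm '' M) := by
    rw [Set.image_image]
    rfl
  rw [this, mem_ideal_span_monomial_image]
  refine forall₂_congr fun m _ => ⟨?_, ?_⟩
  · rintro ⟨_, ⟨g, hg, rfl⟩, h⟩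
    exact ⟨g, hg, fun i => h i⟩
  · rintro ⟨g, hg, h⟩
    exact ⟨_, ⟨g, hg, rfl⟩, fun i => h i⟩

theorem monomial_mem_span_mon {m : σ →₀ ℕ} {M : Set (σ → ℕ)} :
    monomial m (1 : K) ∈ Ideal.span (mon K '' M) ↔ ∃ g ∈ M, g ≤ ⇑m := by
  classical
  rw [mem_span_mon, support_monomial, if_neg one_ne_zero]
  simp

/-- The bridge between the two notions of linear quotients: `h1` puts the variables of `s` into the
colon ideal of `f`, and `h2` shows that nothing else is needed. -/
theorem mul_mon_mem_span_iff {M : Set (σ → ℕ)} {f : σ → ℕ} {s : Set σ}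
    (h1 : ∀ i ∈ s, ∃ g ∈ M, LeUp i g f) (h2 : ∀ g ∈ M, ∃ i ∈ s, f i < g i)
    (p : MvPolynomial σ K) :
    p * mon K f ∈ Ideal.span (mon K '' M) ↔ p ∈ Ideal.span (X '' s) := by
  classical
  constructor
  · rw [mem_span_mon, mem_ideal_span_X_image]
    intro h m hm
    obtain ⟨g, hg, hle⟩ := h (m + Finsupp.equivFunOnFinite.symm f) (by
      rw [mem_support_iff] at hm ⊢
      rwa [mon, coeff_mul_monomial, mul_one])
    obtain ⟨i, hi, hlt⟩ := h2 g hg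
    refine ⟨i, hi, fun h0 => ?_⟩
    have := hle i
    rw [Finsupp.add_apply, h0, zero_add] at this
    exact absurd hlt (not_lt.2 this)
  · intro hp
    induction hp using Submodule.span_induction with
    | mem x hx =>
      obtain ⟨i, hi, rfl⟩ := hx
      obtain ⟨g, hg, hle⟩ := h1 i hi
      rw [X, mon, monomial_mul, one_mul, monomial_mem_span_mon]
      refine ⟨g, hg, fun j => ?_⟩
      by_cases hj : j = i
      · subst hj
        simpa [add_comm] using hle.1
      · simpa [Finsupp.single_apply, Ne.symm hj] using hle.2 j hj
    | zero => simp
    | add x y _ _ hx hy => rw [add_mul]; exact Ideal.add_mem _ hx hy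
    | smul a x _ hx => rw [smul_eq_mul, mul_assoc]; exact Ideal.mul_mem_left _ _ hx

theorem span_mon_minElts {U : Set (σ → ℕ)} :
    Ideal.span (mon K '' minElts U) = Ideal.span (mon K '' U) := by
  ext p
  rw [mem_span_mon, mem_span_mon]
  refine forall₂_congr fun m _ => ⟨?_, ?_⟩
  · rintro ⟨g, hg, h⟩
    exact ⟨g, hg.1, h⟩
  · rintro ⟨g, hg, h⟩
    obtain ⟨g', hg', hle⟩ := exists_minElts_le hg
    exact ⟨g', hg', hle.trans h⟩

theorem minimalMonomials_span_mon {U : Set (σ → ℕ)} (hU : IsUpperSet U) :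
    minimalMonomials (Ideal.span (mon K '' U)) = mon K '' minElts U := by
  have hmem : ∀ m : σ →₀ ℕ, monomial m (1 : K) ∈ Ideal.span (mon K '' U) ↔ ⇑m ∈ U := fun m => by
    rw [monomial_mem_span_mon]
    exact ⟨fun ⟨g, hg, h⟩ => hU h hg, fun h => ⟨_, h, le_rfl⟩⟩
  ext p
  simp only [minimalMonomials, hmem]
  constructor
  · rintro ⟨s, hs, rfl⟩
    refine ⟨⇑s, ⟨hs.1, fun g hg hle => ?_⟩, ?_⟩
    · exact hs.2 (y := Finsupp.equivFunOnFinite.symm g) hg fun i => hle i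
    · simp [mon]
  · rintro ⟨f, hf, rfl⟩
    exact ⟨Finsupp.equivFunOnFinite.symm f, ⟨hf.1, fun t ht hle => hf.2 ht hle⟩, rfl⟩

theorem hasLinearQuotientsOnMinGens_of_linQuot {U : Set (σ → ℕ)} (hU : IsUpperSet U)
    (h : LinQuot U) : HasLinearQuotientsOnMinGens (Ideal.span (mon K '' U)) := by
  obtain ⟨key, hkey⟩ := h
  obtain ⟨l, hnd, hl, h1, h2⟩ := exists_sorted_list (finite_minElts U) key
  have himg : ∀ l : List (σ → ℕ), {f | f ∈ l.map (mon K)} = mon K '' {f | f ∈ l} := fun l => by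
    ext p
    simp
  have hlM : ∀ f ∈ l, f ∈ minElts U := fun f hf => by
    rw [← hl]
    exact hf
  refine ⟨l.map (mon K), hnd.map (mon_injective K), ?_, ?_, fun j hj => ?_⟩
  · rw [himg, hl, minimalMonomials_span_mon hU]
  · rw [himg, hl, span_mon_minElts]
  · rw [List.length_map] at hj
    set s : Set σ := {i | ∃ g ∈ minElts U, key g < key l[j] ∧ LeUp i g l[j]} with hs
    refine ⟨X '' s, ?_, ?_⟩
    · rintro _ ⟨i, -, rfl⟩
      exact isHomogeneous_X _ _
    · rw [← List.map_take, himg]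
      ext p
      rw [List.getElem_map, Submodule.mem_colon_singleton, smul_eq_mul]
      refine mul_mon_mem_span_iff ?_ ?_ p
      · rintro i ⟨g, hg, hgk, hle⟩
        exact ⟨g, h2 j hj g hg hgk, hle⟩
      · intro g hg
        obtain ⟨hne, hle⟩ := h1 j hj g hg
        obtain ⟨i, hi, g', hg'⟩ := hkey l[j] (hlM _ (List.getElem_mem hj)) g
          (hlM g (List.mem_of_mem_take hg)) hne hle
        exact ⟨i, ⟨g', hg'⟩, hi⟩

theorem isHomogeneous_mon [Fintype σ] {f : σ → ℕ} {d : ℕ} (hf : ∑ i, f i = d) :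
    (mon K f).IsHomogeneous d := by
  refine isHomogeneous_monomial _ ?_
  rw [Finsupp.degree_eq_sum]
  exact hf

/-- An ideal generated by monomials of degree `d` with linear quotients has a linear resolution. -/
theorem hasLinearResolution_of_linQuotOn [Fintype σ] {M : Set (σ → ℕ)} (hM : M.Finite) {d : ℕ}
    (hd : ∀ f ∈ M, ∑ i, f i = d) (h : LinQuotOn M) :
    HasLinearResolution d (Ideal.span (mon K '' M)) := by
  classical
  obtain ⟨key, hkey⟩ := h
  obtain ⟨l, hnd, hl, h1, h2⟩ := exists_sorted_list hM key
  have hlM : ∀ f ∈ l, f ∈ M := fun f hf => by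
    rw [← hl]
    exact hf
  let g : Fin l.length → MvPolynomial σ K := fun j => mon K l[j]
  have hrange : Set.range g = mon K '' M := by
    rw [← hl]
    ext p
    constructor
    · rintro ⟨j, rfl⟩
      exact ⟨_, List.getElem_mem j.2, rfl⟩
    · rintro ⟨f, hf, rfl⟩
      obtain ⟨i, hi, rfl⟩ := List.mem_iff_getElem.1 hf
      exact ⟨⟨i, hi⟩, rfl⟩
  have htake : ∀ j : Fin l.length, g '' {i | i < j} = mon K '' {f | f ∈ l.take j} := by
    intro j
    ext p
    constructor
    · rintro ⟨i, hi, rfl⟩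
      have hi' : (i : ℕ) < j := hi
      exact ⟨_, List.mem_take_iff_getElem.2 ⟨i, lt_min hi' i.2, rfl⟩, rfl⟩
    · rintro ⟨f, hf, rfl⟩
      obtain ⟨i, hi, rfl⟩ := List.mem_take_iff_getElem.1 hf
      exact ⟨⟨i, by omega⟩, show i < (j : ℕ) by omega, rfl⟩
  rw [← hrange]
  refine HasLinearResolution.of_linSyz (fun j => ?_)
    fun j => isHomogeneous_mon (hd _ (hlM _ (List.getElem_mem j.2)))
  set s : Set σ := {i | ∃ g ∈ M, key g < key l[j] ∧ LeUp i g l[j]} with hs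
  refine ⟨s, ?_, fun p hp => ?_⟩
  · rintro i ⟨f, hf, hfk, hle⟩
    obtain ⟨m, hm, rfl⟩ := List.mem_take_iff_getElem.1 (h2 j j.2 f hf hfk)
    have hmj : m < (j : ℕ) := by omega
    have hml : m < l.length := by omega
    set t : σ →₀ ℕ := Finsupp.single i 1 + Finsupp.equivFunOnFinite.symm l[j] with ht
    set u : σ →₀ ℕ := Finsupp.equivFunOnFinite.symm l[m] with hu
    have hut : u ≤ t := fun x => by
      by_cases hx : x = i
      · subst hx
        simpa [ht, hu, add_comm] using hle.1
      · simpa [ht, hu, Finsupp.single_apply, Ne.symm hx] using hle.2 x hx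
    -- The relation is `x_i f_j = (x_i f_j / g) g`. As all generators have degree `d`, the cofactor
    -- is a single variable.
    refine ⟨Pi.single ⟨m, hml⟩ (monomial (t - u) 1), fun x => ?_, fun x hx => ?_, ?_⟩
    · by_cases hx : x = ⟨m, hml⟩
      · subst hx
        rw [Pi.single_eq_same]
        refine isHomogeneous_monomial _ ?_
        have hadd : (t - u).degree + u.degree = t.degree := by
          rw [← map_add, tsub_add_cancel_of_le hut]
        have hu' : u.degree = d := by
          rw [Finsupp.degree_eq_sum]
          exact hd _ hf
        have ht' : t.degree = 1 + d := by
          rw [ht, map_add, Finsupp.degree_single, Finsupp.degree_eq_sum]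
          exact congrArg _ (hd _ (hlM _ (List.getElem_mem j.2)))
        omega
      · rw [Pi.single_eq_of_ne hx]
        exact isHomogeneous_zero _ _ _
    · refine Pi.single_eq_of_ne (fun h => ?_) _
      subst h
      exact absurd hmj (not_lt.2 hx)
    · rw [Finset.sum_eq_single ⟨m, hml⟩ (fun x _ hx => by rw [Pi.single_eq_of_ne hx, zero_smul])
        (by simp), Pi.single_eq_same]
      change monomial _ 1 * monomial _ 1 = monomial _ 1 * monomial u 1
      rw [monomial_mul, monomial_mul, tsub_add_cancel_of_le hut]
  · rw [htake] at hp
    refine (mul_mon_mem_span_iff ?_ ?_ p).1 hp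
    · rintro i ⟨g, hg, hgk, hle⟩
      exact ⟨g, h2 j j.2 g hg hgk, hle⟩
    · intro g hg
      obtain ⟨hne, hle⟩ := h1 j j.2 g hg
      obtain ⟨i, hi, g', hg'⟩ := hkey l[j] (hlM _ (List.getElem_mem j.2)) g
        (hlM g (List.mem_of_mem_take hg)) hne hle
      exact ⟨i, ⟨g', hg'⟩, hi⟩

end Monomial

/-! ### Degree components of ideals with linear quotients -/

section Components

variable {σ : Type*}

/-- The exponent vector `w + e_i - e_l`. -/
def swapUp [DecidableEq σ] (w : σ → ℕ) (i l : σ) : σ → ℕ :=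
  fun x => if x = i then w x + 1 else if x = l then w x - 1 else w x

theorem sum_swapUp [Fintype σ] [DecidableEq σ] {w : σ → ℕ} {i l : σ} (hil : i ≠ l)
    (hl : 0 < w l) : ∑ x, swapUp w i l x = ∑ x, w x := by
  have h : ∀ x, swapUp w i l x + (if x = l then 1 else 0) = w x + if x = i then 1 else 0 := by
    intro x
    unfold swapUp
    split_ifs with h1 h2 h2
    · exact absurd (h1.symm.trans h2) hil
    · rfl
    · subst h2
      omega
    · rfl
  have h' := Finset.sum_congr (rfl : (Finset.univ : Finset σ) = _) fun x _ => h x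
  simp only [Finset.sum_add_distrib, Finset.sum_ite_eq', Finset.mem_univ, if_true] at h'
  exact Nat.add_right_cancel h'

theorem leUp_swapUp [DecidableEq σ] (w : σ → ℕ) (i l : σ) : LeUp i (swapUp w i l) w := by
  refine ⟨by simp [swapUp], fun x hx => ?_⟩
  simp only [swapUp, if_neg hx]
  split_ifs <;> omega

/-- A monomial `w` of degree `d` is filed under a generator `p w` dividing it with smallest key. The
order is by this key, then by decreasing lexicographic order. Every required step is an exchange `w
+ e_i - e_l`. -/
theorem LinQuot.component [Fintype σ] {U : Set (σ → ℕ)} (hU : IsUpperSet U) (h : LinQuot U)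
    (d : ℕ) : LinQuotOn {w ∈ U | ∑ i, w i = d} := by
  classical
  let eσ := Fintype.equivFin σ
  let _ : LinearOrder σ := LinearOrder.lift' eσ eσ.injective
  obtain ⟨key, hkey⟩ := h
  have hp : ∀ w : σ → ℕ, ∃ f, w ∈ U → f ∈ minElts U ∧ f ≤ w ∧
      ∀ g ∈ minElts U, g ≤ w → key f ≤ key g := by
    intro w
    by_cases hw : w ∈ U
    · have hne : {f | f ∈ minElts U ∧ f ≤ w}.Nonempty := exists_minElts_le hw
      let f := Function.argminOn key _ hne
      have hf := Function.argminOn_mem key _ hne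
      exact ⟨f, fun _ => ⟨hf.1, hf.2, fun g hg hgw => Function.argminOn_le key _
        (show g ∈ {f | f ∈ minElts U ∧ f ≤ w} from ⟨hg, hgw⟩)⟩⟩
    · exact ⟨0, fun h => absurd h hw⟩
  choose p hp using hp
  have hfin : {w ∈ U | ∑ i, w i = d}.Finite := by
    refine (Set.finite_Iic (fun _ : σ => d)).subset fun w hw i => ?_
    rw [← hw.2]
    exact Finset.single_le_sum (fun _ _ => Nat.zero_le _) (Finset.mem_univ i)
  refine LinQuotOn.of_key (α := ℕ ×ₗ (Lex (σ → ℕ))ᵒᵈ) hfin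
    (fun w => toLex (key (p w), OrderDual.toDual (toLex w))) ?_
  rintro w ⟨hw, hwd⟩ w' ⟨hw', hwd'⟩ hne hle
  obtain ⟨hf, hfw, hfmin⟩ := hp w hw
  obtain ⟨hf', hfw', -⟩ := hp w' hw'
  have hfw : ∀ x, p w x ≤ w x := hfw
  have hfw' : ∀ x, p w' x ≤ w' x := hfw'
  by_cases hpp : p w' = p w
  · have hlt : toLex w < toLex w' := by
      rcases Prod.Lex.toLex_le_toLex.1 hle with h | h
      · simp only [hpp] at h
        exact absurd h (lt_irrefl _)
      · exact lt_of_le_of_ne (OrderDual.toDual_le_toDual.1 h.2) fun h => hne (toLex.injective h).symm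
    obtain ⟨i, hi, hlt⟩ := hlt
    have hlt : w i < w' i := hlt
    have hi : ∀ x < i, w x = w' x := hi
    have : ∃ l, w' l < w l := by
      by_contra hcon
      push Not at hcon
      have : ∑ x, w x < ∑ x, w' x :=
        Finset.sum_lt_sum (fun x _ => hcon x) ⟨i, Finset.mem_univ i, hlt⟩
      omega
    obtain ⟨l, hl⟩ := this
    have hil : i < l := by
      by_contra hcon
      rcases eq_or_lt_of_le (not_lt.1 hcon) with h | h
      · subst h
        omega
      · have := hi l h
        omega
    have hl0 : 0 < w l := by omega
    -- Lowering `w` at `l` is harmless, since the common generator also divides `w'` and `w' l < w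
    -- l`.
    have hpu : p w ≤ swapUp w i l := by
      intro x
      have h1 := hfw x
      have h2 := hfw' x
      rw [hpp] at h2
      change p w x ≤ swapUp w i l x
      unfold swapUp
      split_ifs with h3 h4
      · omega
      · subst h4
        omega
      · exact h1
    have hu : swapUp w i l ∈ U := hU hpu hf.1
    refine ⟨i, hlt, _, ⟨hu, (sum_swapUp hil.ne hl0).trans hwd⟩, ?_, leUp_swapUp w i l⟩
    rw [Prod.Lex.toLex_lt_toLex]
    rcases eq_or_lt_of_le ((hp _ hu).2.2 _ hf hpu) with h | h
    · refine Or.inr ⟨h, OrderDual.toDual_lt_toDual.2 ⟨i, fun x hx => ?_, ?_⟩⟩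
      · have : x ≠ l := (hx.trans hil).ne
        simp [swapUp, this, hx.ne]
      · simp [swapUp]
    · exact Or.inl h
  · have hk : key (p w') ≤ key (p w) := by
      rcases Prod.Lex.toLex_le_toLex.1 hle with h | h
      · exact h.le
      · exact h.1.le
    obtain ⟨i, hi, g, hg, hgk, hgf⟩ := hkey _ hf _ hf' hpp hk
    -- As `g` precedes `p w`, it cannot divide `w`. But `g` divides `x_i` times `p w`, so the
    -- obstruction is at `i` alone: `w` and `p w` agree there and `g` exceeds them.
    have hnot : ¬ g ≤ w := fun h => absurd (hfmin g hg h) (not_le.2 hgk)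
    have hwi : w i = p w i := by
      by_contra hcon
      refine hnot fun x => ?_
      have h1 := hfw x
      by_cases hx : x = i
      · subst hx
        have := hgf.1
        change g x ≤ w x
        omega
      · exact (hgf.2 x hx).trans h1
    have hgi : w i < g i := by
      by_contra hcon
      refine hnot fun x => ?_
      by_cases hx : x = i
      · subst hx
        exact not_lt.1 hcon
      · exact (hgf.2 x hx).trans (hfw x)
    -- Distinct minimal generators are incomparable, which yields a place `l` where `w` can be
    -- lowered while remaining above `g`.
    have : ∃ l, g l < p w l := by
      by_contra hcon
      push Not at hcon
      exact absurd (minElts_eq_of_le hg hf.1 hcon) fun h => by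
        rw [h] at hgk
        exact lt_irrefl _ hgk
    obtain ⟨l, hl⟩ := this
    have hil : i ≠ l := by
      rintro rfl
      omega
    have hwl := hfw l
    have hl0 : 0 < w l := by omega
    have hgu : g ≤ swapUp w i l := by
      intro x
      have h1 := hfw x
      change g x ≤ swapUp w i l x
      unfold swapUp
      split_ifs with h3 h4
      · subst h3
        have := hgf.1
        omega
      · subst h4
        omega
      · exact (hgf.2 x h3).trans h1
    have hu : swapUp w i l ∈ U := hU hgu hg.1
    refine ⟨i, ?_, _, ⟨hu, (sum_swapUp hil hl0).trans hwd⟩, ?_, leUp_swapUp w i l⟩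
    · rw [hwi]
      exact hi.trans_le (hfw' i)
    · exact Prod.Lex.toLex_lt_toLex.2 (Or.inl (((hp _ hu).2.2 _ hg hgu).trans_lt hgk))

theorem isComponentwiseLinear_of_linQuot [Finite σ] {K : Type*} [Field K] {U : Set (σ → ℕ)}
    (hU : IsUpperSet U) (h : LinQuot U) : IsComponentwiseLinear (Ideal.span (mon K '' U)) := by
  classical
  have := Fintype.ofFinite σ
  intro d
  have hspan : Ideal.span {f | f ∈ Ideal.span (mon K '' U) ∧ f.IsHomogeneous d} =
      Ideal.span (mon K '' {w ∈ U | ∑ i, w i = d}) := by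
    refine le_antisymm (Ideal.span_le.2 ?_) (Ideal.span_mono ?_)
    · rintro f ⟨hf, hd⟩
      rw [SetLike.mem_coe, mem_span_mon]
      rw [mem_span_mon] at hf
      intro m hm
      obtain ⟨g, hg, hgm⟩ := hf m hm
      refine ⟨⇑m, ⟨hU hgm hg, ?_⟩, le_rfl⟩
      have := hd (mem_support_iff.1 hm)
      rwa [← Finsupp.degree_eq_sum, Finsupp.degree_eq_weight_one]
    · rintro _ ⟨w, ⟨hw, hd⟩, rfl⟩
      exact ⟨Ideal.subset_span ⟨w, hw, rfl⟩, isHomogeneous_mon hd⟩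
  rw [hspan]
  refine hasLinearResolution_of_linQuotOn ?_ (fun f hf => hf.2) (h.component hU d)
  refine (Set.finite_Iic (fun _ : σ => d)).subset fun w hw i => ?_
  rw [← hw.2]
  exact Finset.single_le_sum (fun _ _ => Nat.zero_le _) (Finset.mem_univ i)

end Components

end CoverPowers

namespace CoverPowers

/-! ### Sums of vertex covers -/

section CoverSums

variable {σ : Type*}

/-- The exponent vectors above a sum of `k` indicator vectors of vertex covers: the exponents of
the monomials in the `k`-th power of the cover ideal. -/
def coverSums (k : ℕ) (G : SimpleGraph σ) : Set (σ → ℕ) :=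
  {t | ∃ C : Fin k → Set σ, (∀ j, G.IsVertexCover (C j)) ∧
    ∀ v, ∑ j, (C j).indicator (1 : σ → ℕ) v ≤ t v}

theorem isUpperSet_coverSums (k : ℕ) (G : SimpleGraph σ) : IsUpperSet (coverSums k G) :=
  fun _ _ hst ⟨C, hC, h⟩ => ⟨C, hC, fun v => (h v).trans (hst v)⟩

theorem mem_coverSums_of_index {ι : Type*} [Fintype ι] {k : ℕ} (hk : Fintype.card ι = k)
    {G : SimpleGraph σ} {C : ι → Set σ} (hC : ∀ j, G.IsVertexCover (C j)) {t : σ → ℕ}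
    (ht : ∀ v, ∑ j, (C j).indicator (1 : σ → ℕ) v ≤ t v) : t ∈ coverSums k G := by
  let e := (Fintype.equivFinOfCardEq hk).symm
  refine ⟨C ∘ e, fun j => hC _, fun v => ?_⟩
  exact (Equiv.sum_comp e fun j => (C j).indicator (1 : σ → ℕ) v).trans_le (ht v)

theorem mem_coverSums_zero (G : SimpleGraph σ) (t : σ → ℕ) : t ∈ coverSums 0 G :=
  ⟨Fin.elim0, fun j => j.elim0, fun v => by simp⟩

theorem mem_coverSums_succ {k : ℕ} {G : SimpleGraph σ} {t : σ → ℕ} :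
    t ∈ coverSums (k + 1) G ↔ ∃ C : Set σ, G.IsVertexCover C ∧ ∃ s ∈ coverSums k G,
      ∀ v, s v + C.indicator (1 : σ → ℕ) v ≤ t v := by
  constructor
  · rintro ⟨C, hC, ht⟩
    refine ⟨C 0, hC 0, fun v => ∑ j : Fin k, (C j.succ).indicator (1 : σ → ℕ) v,
      ⟨fun j => C j.succ, fun j => hC _, fun v => le_rfl⟩, fun v => ?_⟩
    have := ht v
    rw [Fin.sum_univ_succ, add_comm] at this
    exact this
  · rintro ⟨C, hC, s, ⟨D, hD, hs⟩, ht⟩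
    refine ⟨Fin.cons C D, Fin.cases hC hD, fun v => ?_⟩
    have h1 := hs v
    have h2 := ht v
    rw [Fin.sum_univ_succ]
    simp only [Fin.cons_zero, Fin.cons_succ]
    omega

theorem sum_indicator_le {ι : Type*} [Fintype ι] (C : ι → Set σ) (v : σ) :
    ∑ j, (C j).indicator (1 : σ → ℕ) v ≤ Fintype.card ι := by
  refine (Finset.sum_le_sum (g := fun _ => 1) fun j _ => ?_).trans (by simp)
  exact Set.indicator_apply_le' (fun _ => le_rfl) fun _ => Nat.zero_le _

theorem le_of_mem_minElts_coverSums {k : ℕ} {G : SimpleGraph σ} {t : σ → ℕ}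
    (ht : t ∈ minElts (coverSums k G)) (v : σ) : t v ≤ k := by
  obtain ⟨C, hC, h⟩ := ht.1
  have := minElts_eq_of_le ht (g := fun v => ∑ j, (C j).indicator (1 : σ → ℕ) v)
    ⟨C, hC, fun v => le_rfl⟩ h
  rw [← this]
  simpa using sum_indicator_le C v

theorem le_add_of_mem_coverSums {k : ℕ} {G : SimpleGraph σ} {t : σ → ℕ} (ht : t ∈ coverSums k G)
    {u v : σ} (huv : G.Adj u v) : k ≤ t u + t v := by
  obtain ⟨C, hC, h⟩ := ht
  calc k = ∑ _j : Fin k, 1 := by simp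
    _ ≤ ∑ j, ((C j).indicator (1 : σ → ℕ) u + (C j).indicator (1 : σ → ℕ) v) := by
      refine Finset.sum_le_sum fun j _ => ?_
      rcases hC j huv with h | h
      · simp [h]
      · simp [h]
    _ ≤ t u + t v := by
      rw [Finset.sum_add_distrib]
      exact Nat.add_le_add (h u) (h v)

/-- Threshold covers: the `j`-th cover takes a vertex of `X` when `j` is among the first `t u`
indices, and a vertex off `X` when `j` is among the last `t u`. The edge inequality makes the two
ranges cover all `k` indices. -/
theorem mem_coverSums_of_bipartite {k : ℕ} {G : SimpleGraph σ} {X : Set σ}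
    (hX : ∀ u v, G.Adj u v → (u ∈ X ↔ v ∉ X)) {t : σ → ℕ}
    (ht : ∀ u v, G.Adj u v → k ≤ t u + t v) : t ∈ coverSums k G := by
  classical
  refine ⟨fun j => {u | (u ∈ X ∧ (j : ℕ) < t u) ∨ (u ∉ X ∧ k ≤ j + t u)}, ?_, fun v => ?_⟩
  · intro j u v huv
    have h1 := ht u v huv
    have h2 := hX u v huv
    by_cases hu : u ∈ X
    · have hv := h2.1 hu
      by_cases hj : (j : ℕ) < t u
      · exact Or.inl (Or.inl ⟨hu, hj⟩)
      · exact Or.inr (Or.inr ⟨hv, by omega⟩)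
    · have hv : v ∈ X := by
        by_contra h
        exact hu (h2.2 h)
      by_cases hj : (j : ℕ) < t v
      · exact Or.inr (Or.inl ⟨hv, hj⟩)
      · exact Or.inl (Or.inr ⟨hu, by omega⟩)
  · simp only [Set.indicator_apply, Pi.one_apply]
    rw [← Finset.card_filter]
    refine le_of_le_of_eq ?_ (Finset.card_range (t v))
    by_cases hv : v ∈ X
    · refine Finset.card_le_card_of_injOn (fun j => (j : ℕ)) (fun j hj => ?_)
        (fun i _ j _ h => Fin.ext h)
      simpa [hv] using hj
    · refine Finset.card_le_card_of_injOn (fun j => k - 1 - (j : ℕ)) (fun j hj => ?_)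
        (fun i _ j _ h => Fin.ext ?_)
      · have : k ≤ j + t v := by simpa [hv] using hj
        have := j.2
        simp only [Finset.coe_range, Set.mem_Iio]
        omega
      · have := i.2
        have := j.2
        simp only at h
        omega

theorem mem_coverSums_bipartite_iff {k : ℕ} {G : SimpleGraph σ} {X : Set σ}
    (hX : ∀ u v, G.Adj u v → (u ∈ X ↔ v ∉ X)) {t : σ → ℕ} :
    t ∈ coverSums k G ↔ ∀ u v, G.Adj u v → k ≤ t u + t v :=
  ⟨fun ht _ _ huv => le_add_of_mem_coverSums ht huv, mem_coverSums_of_bipartite hX⟩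

theorem mem_coverSums_iso {τ : Type*} {G : SimpleGraph σ} {H : SimpleGraph τ} (e : G ≃g H)
    {k : ℕ} {t : σ → ℕ} : t ∈ coverSums k G ↔ t ∘ e.symm ∈ coverSums k H := by
  constructor
  · rintro ⟨C, hC, ht⟩
    refine ⟨fun j => {w | e.symm w ∈ C j}, fun j u v huv => hC j (e.symm.map_rel_iff.2 huv),
      fun v => ?_⟩
    exact ht (e.symm v)
  · rintro ⟨C, hC, ht⟩
    refine ⟨fun j => {w | e w ∈ C j}, fun j u v huv => hC j (e.map_rel_iff.2 huv), fun v => ?_⟩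
    have := ht (e v)
    rw [Function.comp_apply] at this
    exact this.trans_eq (congrArg t (e.symm_apply_apply v))

theorem LinQuot.coverSums_of_iso {τ : Type*} {G : SimpleGraph σ} {H : SimpleGraph τ} (e : G ≃g H)
    {k : ℕ} (h : LinQuot (coverSums k H)) : LinQuot (coverSums k G) := by
  convert h.comp_equiv e.toEquiv using 1
  exact Set.ext fun t => mem_coverSums_iso e

section Ideal

open MvPolynomial

variable [Finite σ] (K : Type*) [Field K]

theorem mon_add (f g : σ → ℕ) : mon K (f + g) = mon K f * mon K g := by
  have : Finsupp.equivFunOnFinite.symm (f + g) =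
      Finsupp.equivFunOnFinite.symm f + Finsupp.equivFunOnFinite.symm g := by
    ext
    rfl
  rw [mon, mon, mon, monomial_mul, one_mul, this]

theorem prod_X_eq_mon (C : Finset σ) :
    ∏ v ∈ C, (X v : MvPolynomial σ K) = mon K ((C : Set σ).indicator 1) := by
  classical
  have : Finsupp.equivFunOnFinite.symm ((C : Set σ).indicator (1 : σ → ℕ)) =
      ∑ v ∈ C, Finsupp.single v 1 := by
    ext w
    simp [Finsupp.finsetSum_apply, Finsupp.single_apply, Set.indicator_apply]
  rw [mon, this, monomial_sum_one]
  rfl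

theorem coverIdeal_eq_span_mon (G : SimpleGraph σ) :
    coverIdeal K G = Ideal.span (mon K '' coverSums 1 G) := by
  classical
  have := Fintype.ofFinite σ
  refine le_antisymm (Ideal.span_le.2 ?_) (Ideal.span_le.2 ?_)
  · rintro _ ⟨C, hC, rfl⟩
    rw [prod_X_eq_mon]
    exact Ideal.subset_span ⟨_, ⟨fun _ => C, fun _ => hC.1, fun v => by simp⟩, rfl⟩
  · rintro _ ⟨t, ⟨C, hC, ht⟩, rfl⟩
    obtain ⟨D, hD, hDmin⟩ := exists_minimal_le_of_wellFoundedLT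
      (fun D : Finset σ => G.IsVertexCover (D : Set σ)) (C 0).toFinset (by simpa using hC 0)
    have hgen : mon K ((D : Set σ).indicator 1) ∈ coverIdeal K G := by
      rw [← prod_X_eq_mon]
      exact Ideal.subset_span ⟨D, hDmin, rfl⟩
    have hle : (D : Set σ).indicator 1 ≤ t := by
      intro v
      refine le_trans ?_ (ht v)
      simp only [Fin.sum_univ_one]
      refine Set.indicator_le_indicator_of_subset ?_ (fun _ => Nat.zero_le _) v
      intro x hx
      simpa using hD hx
    have : mon K t = mon K (t - (D : Set σ).indicator 1) * mon K ((D : Set σ).indicator 1) := by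
      rw [← mon_add, tsub_add_cancel_of_le hle]
    rw [SetLike.mem_coe, this]
    exact Ideal.mul_mem_left _ _ hgen

theorem coverIdeal_pow_eq_span_mon (G : SimpleGraph σ) (k : ℕ) :
    coverIdeal K G ^ k = Ideal.span (mon K '' coverSums k G) := by
  induction k with
  | zero =>
    rw [pow_zero, eq_comm, Ideal.one_eq_top, Ideal.eq_top_iff_one]
    refine Ideal.subset_span ⟨0, mem_coverSums_zero _ _, ?_⟩
    have : (Finsupp.equivFunOnFinite.symm (0 : σ → ℕ)) = 0 := by ext; rfl
    rw [mon, this]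
    rfl
  | succ k ih =>
    rw [pow_succ, ih, coverIdeal_eq_span_mon, Ideal.span_mul_span']
    refine le_antisymm (Ideal.span_mono ?_) (Ideal.span_le.2 ?_)
    · rintro _ ⟨_, ⟨s, hs, rfl⟩, _, ⟨u, ⟨C, hC, hu⟩, rfl⟩, rfl⟩
      refine ⟨s + u, mem_coverSums_succ.2 ⟨C 0, hC 0, s, hs, fun v => ?_⟩, mon_add K _ _⟩
      have := hu v
      simp only [Fin.sum_univ_one] at this
      exact Nat.add_le_add_left this _
    · rintro _ ⟨t, ht, rfl⟩
      obtain ⟨C, hC, s, hs, hst⟩ := mem_coverSums_succ.1 ht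
      have hst' : t = s + (t - s) := by
        ext v
        have := hst v
        simp only [Pi.add_apply, Pi.sub_apply]
        omega
      rw [hst', mon_add]
      refine Ideal.subset_span (Set.mul_mem_mul ⟨s, hs, rfl⟩ ⟨t - s, ⟨fun _ => C, fun _ => hC,
        fun v => ?_⟩, rfl⟩)
      have := hst v
      simp only [Fin.sum_univ_one, Pi.sub_apply]
      omega

end Ideal

end CoverSums

end CoverPowers

namespace CoverPowers

/-! ### Powers of the cover ideal of `G(H_v : v ∈ V)` -/

section Attach

theorem sum_indicator_eq_card_filter {ι σ : Type*} [Fintype ι] (C : ι → Set σ) (v : σ)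
    [DecidablePred fun j => v ∈ C j] :
    ∑ j, (C j).indicator (1 : σ → ℕ) v = (Finset.univ.filter fun j => v ∈ C j).card := by
  classical
  rw [Finset.card_filter]
  exact Finset.sum_congr rfl fun j _ => by simp [Set.indicator_apply]

theorem sum_indicator_split {k : ℕ} {σ : Type*} (C : Fin k → Set σ) (w : σ) (J : Finset (Fin k))
    (hJ : ∀ j, j ∉ J → w ∈ C j) :
    ∑ j, (C j).indicator (1 : σ → ℕ) w =
      ∑ j : J, (C j).indicator (1 : σ → ℕ) w + (k - J.card) := by
  classical
  rw [← Finset.sum_add_sum_compl J, Finset.sum_coe_sort J fun j => (C j).indicator (1 : σ → ℕ) w]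
  congr 1
  rw [Finset.sum_congr rfl (g := fun _ => 1) fun j hj => by
    simp [hJ j (Finset.mem_compl.1 hj)]]
  simp [Finset.card_compl]

variable {V : Type*} {W : V → Type*}

/-- The exponents above `m + (k - n)`, where `m` is the exponent of a monomial in the `n`-th power
of the cover ideal. -/
def shiftedCoverSums (k n : ℕ) {τ : Type*} (H : SimpleGraph τ) : Set (τ → ℕ) :=
  {s | ∃ m ∈ coverSums n H, ∀ w, m w + (k - n) ≤ s w}

/-- The number `a v` counts the covers containing `v`. These restrict to covers of `H v`, and the
other `k - a v` must contain all of `W v`, which accounts for the shift. -/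
theorem mem_coverSums_attach {k : ℕ} {G : SimpleGraph V} {H : ∀ v, SimpleGraph (W v)}
    {t : (V ⊕ (Σ v, W v)) → ℕ} :
    t ∈ coverSums k (attach G H) ↔ ∃ a, (a ∈ coverSums k G ∧ ∀ v, a v ≤ k) ∧
      (∀ v, a v ≤ t (.inl v)) ∧
      ∀ v, (fun w => t (.inr ⟨v, w⟩)) ∈ shiftedCoverSums k (a v) (H v) := by
  classical
  constructor
  · rintro ⟨C, hC, ht⟩
    let J : V → Finset (Fin k) := fun v => Finset.univ.filter fun j => Sum.inl v ∈ C j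
    have hJ : ∀ v, ∑ j, (C j).indicator (1 : (V ⊕ (Σ v, W v)) → ℕ) (Sum.inl v) = (J v).card := fun v =>
      sum_indicator_eq_card_filter C _
    refine ⟨fun v => (J v).card, ⟨⟨fun j => {v | Sum.inl v ∈ C j}, fun j u v huv =>
      hC j (AttachAdj.base huv), fun v => (hJ v).le⟩, fun v => ?_⟩, fun v => ?_, fun v => ?_⟩
    · simpa using Finset.card_le_univ (J v)
    · exact (hJ v).symm.trans_le (ht _)
    · refine ⟨fun w => ∑ j : J v, (C j).indicator (1 : (V ⊕ (Σ v, W v)) → ℕ) (Sum.inr ⟨v, w⟩),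
        mem_coverSums_of_index (C := fun j : J v => {w : W v | Sum.inr ⟨v, w⟩ ∈ C j})
          (Fintype.card_coe _) (fun j a b hab => ?_) fun w => le_rfl,
        fun w => ?_⟩
      · have : (attach G H).Adj (.inr ⟨v, a⟩) (.inr ⟨v, b⟩) := AttachAdj.fiber hab
        exact hC j this
      rw [← sum_indicator_split]
      · exact ht _
      · intro j hj
        have hj' : Sum.inl v ∉ C j := fun h => hj (Finset.mem_filter.2 ⟨Finset.mem_univ _, h⟩)
        exact (hC j (AttachAdj.up v w)).resolve_left hj'
  · rintro ⟨a, ⟨⟨B, hB, hBa⟩, hak⟩, hat, ht⟩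
    -- A superset of a cover is a cover, so `v` may be added to further members of the family until
    -- it lies in exactly `a v` of them; this is where `a v ≤ k` is needed.
    have hex : ∀ v, ∃ J : Finset (Fin k), (Finset.univ.filter fun j => v ∈ B j) ⊆ J ∧
        J.card = a v := fun v => by
      refine Finset.exists_superset_card_eq ?_ (by simpa using hak v)
      rw [← sum_indicator_eq_card_filter]
      exact hBa v
    choose J hBJ hJ using hex
    choose m hm hmt using ht
    choose D hD hDm using hm
    let e : ∀ v, J v ≃ Fin (a v) := fun v => Fintype.equivFinOfCardEq (by simp [hJ])
    let C : Fin k → Set (V ⊕ (Σ v, W v)) := fun j => Sum.elim (fun v => j ∈ J v)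
      fun p => ∀ h : j ∈ J p.1, p.2 ∈ D p.1 (e p.1 ⟨j, h⟩)
    have hCl : ∀ j v, Sum.inl v ∈ C j ↔ j ∈ J v := fun j v => Iff.rfl
    have hCr : ∀ j v w, Sum.inr ⟨v, w⟩ ∈ C j ↔ ∀ h : j ∈ J v, w ∈ D v (e v ⟨j, h⟩) :=
      fun j v w => Iff.rfl
    refine ⟨C, fun j x y hxy => ?_, ?_⟩
    · rcases hxy with h | h | ⟨v, w⟩ | ⟨v, w⟩
      · rw [hCl, hCl]
        exact (hB j h).imp (fun h => hBJ _ (by simpa using h)) fun h => hBJ _ (by simpa using h)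
      · rename_i v b c
        rw [hCr, hCr]
        by_cases hj : j ∈ J v
        · exact (hD v (e v ⟨j, hj⟩) h).imp (fun h _ => h) fun h _ => h
        · exact Or.inl fun h => absurd h hj
      · rw [hCl, hCr]
        by_cases hj : j ∈ J v
        · exact Or.inl hj
        · exact Or.inr fun h => absurd h hj
      · rw [hCl, hCr]
        by_cases hj : j ∈ J v
        · exact Or.inr hj
        · exact Or.inl fun h => absurd h hj
    · rintro (v | ⟨v, w⟩)
      · rw [sum_indicator_eq_card_filter]
        simp only [hCl, Finset.filter_univ_mem]
        exact (hJ v).trans_le (hat v)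
      · rw [sum_indicator_split C _ (J v) fun j hj => (hCr j v w).2 fun h => absurd h hj, hJ v]
        refine le_trans (Nat.add_le_add_right ?_ _) (hmt v w)
        refine le_trans (le_of_eq ?_) (hDm v w)
        rw [← Equiv.sum_comp (e v)]
        refine Finset.sum_congr rfl fun j _ => ?_
        have : Sum.inr ⟨v, w⟩ ∈ C j ↔ w ∈ D v (e v j) :=
          (hCr j v w).trans ⟨fun h => h j.2, fun h _ => h⟩
        simp [Set.indicator_apply, this]

theorem coverSums_attach_eq_fibered {k : ℕ} {G : SimpleGraph V} {H : ∀ v, SimpleGraph (W v)} :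
    coverSums k (attach G H) = fibered {a | a ∈ coverSums k G ∧ ∀ v, a v ≤ k}
      fun v a => shiftedCoverSums k (a v) (H v) :=
  Set.ext fun _ => mem_coverSums_attach

variable {τ : Type*} {H : SimpleGraph τ}

theorem LinQuot.shiftedCoverSums {n : ℕ} (h : LinQuot (coverSums n H)) (k : ℕ) :
    LinQuot (shiftedCoverSums k n H) :=
  h.add_const (k - n)

/-- One unit of the constant shift is the indicator of the whole vertex set, which is itself a
cover. -/
theorem shiftedCoverSums_mono {k n n' : ℕ} (hn : n ≤ n') (hn' : n' ≤ k) :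
    shiftedCoverSums k n H ⊆ shiftedCoverSums k n' H := by
  induction n', hn using Nat.le_induction with
  | base => exact subset_rfl
  | succ l hl ih =>
    rintro s hs
    obtain ⟨m, hm, hms⟩ := ih (by omega) hs
    refine ⟨fun w => m w + 1, mem_coverSums_succ.2 ⟨Set.univ, fun _ _ _ => Or.inl trivial, m, hm,
      fun w => by simp⟩, fun w => ?_⟩
    have := hms w
    change m w + 1 + (k - (l + 1)) ≤ s w
    omega

/-- The complement of a single vertex is a cover. Using it in place of one unit of the shift saves
one at `w₀`, and gives the strict drop required by `linQuot_fibered`. -/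
theorem exists_lt_mem_shiftedCoverSums {k n : ℕ} (hn : n < k) (w₀ : τ) {s : τ → ℕ}
    (hs : s ∈ shiftedCoverSums k n H) : ∃ s' ∈ shiftedCoverSums k (n + 1) H, s' < s := by
  classical
  obtain ⟨m, hm, hms⟩ := hs
  have h0 := hms w₀
  refine ⟨fun w => s w - if w = w₀ then 1 else 0, ⟨fun w => m w + ({w₀}ᶜ : Set τ).indicator 1 w,
    mem_coverSums_succ.2 ⟨{w₀}ᶜ, fun u v huv => ?_, m, hm, fun w => le_rfl⟩, fun w => ?_⟩, ?_⟩
  · by_cases hu : u = w₀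
    · exact Or.inr fun hv => huv.ne (hu.trans hv.symm)
    · exact Or.inl hu
  · have := hms w
    by_cases hw : w = w₀
    · subst hw
      simp
      omega
    · simp [hw]
      omega
  · refine lt_of_le_of_ne (fun w => Nat.sub_le _ _) fun h => ?_
    have := congrFun h w₀
    simp at this
    omega

theorem add_single_mem_coverSums [DecidableEq V] {k : ℕ} {G : SimpleGraph V} {a b : V → ℕ}
    (ha : a ∈ coverSums k G ∧ ∀ v, a v ≤ k) (hb : b ∈ coverSums k G ∧ ∀ v, b v ≤ k) {v : V}
    (hv : a v < b v) :
    a + Pi.single v 1 ∈ coverSums k G ∧ ∀ u, (a + Pi.single v 1 : V → ℕ) u ≤ k := by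
  refine ⟨isUpperSet_coverSums k G (fun u => Nat.le_add_right _ _) ha.1, fun u => ?_⟩
  by_cases hu : u = v
  · subst hu
    simpa using hv.trans_le (hb.2 u)
  · simpa [hu] using ha.2 u

theorem linQuot_coverSums_attach [Finite V] [∀ v, Finite (W v)] [∀ v, Nonempty (W v)]
    (G : SimpleGraph V) (H : ∀ v, SimpleGraph (W v)) (h : ∀ v n, LinQuot (coverSums n (H v)))
    (k : ℕ) : LinQuot (coverSums k (attach G H)) := by
  classical
  rw [coverSums_attach_eq_fibered]
  refine linQuot_fibered (fun a ha b hb v hv => add_single_mem_coverSums ha hb hv)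
    (fun a _ b hb hab v => shiftedCoverSums_mono (hab v) (hb.2 v)) (fun a _ v hav => ?_)
    fun a _ v => (h v _).shiftedCoverSums k
  have hlt : a v < k := by simpa using hav.2 v
  obtain ⟨w₀⟩ := ‹∀ v, Nonempty (W v)› v
  refine ⟨v, fun s hs => ?_⟩
  simpa using exists_lt_mem_shiftedCoverSums hlt w₀ hs

end Attach

end CoverPowers

namespace CoverPowers

/-! ### Graphs partitioned into cliques with a free vertex -/

section Cliques

variable {σ : Type*}

theorem exists_eq_sum_of_mem_minElts {k : ℕ} {H : SimpleGraph σ} {f : σ → ℕ}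
    (hf : f ∈ minElts (coverSums k H)) : ∃ C : Fin k → Set σ, (∀ j, H.IsVertexCover (C j)) ∧
      ∀ v, f v = ∑ j, (C j).indicator (1 : σ → ℕ) v := by
  obtain ⟨C, hC, h⟩ := hf.1
  refine ⟨C, hC, fun v => ?_⟩
  exact (congrFun (minElts_eq_of_le hf (g := fun v => ∑ j, (C j).indicator (1 : σ → ℕ) v)
    ⟨C, hC, fun v => le_rfl⟩ h) v).symm

theorem mem_of_sum_indicator_le {k : ℕ} {C C' : Fin k → Set σ} (hsub : ∀ j, C' j ⊆ C j)
    {f : σ → ℕ} (hf : ∀ v, f v = ∑ j, (C j).indicator (1 : σ → ℕ) v)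
    (hle : ∀ v, f v ≤ ∑ j, (C' j).indicator (1 : σ → ℕ) v) (j : Fin k) : C' j = C j := by
  refine (hsub j).antisymm fun v hv => ?_
  by_contra hv'
  have := hle v
  rw [hf v] at this
  refine absurd this (not_le.2 (Finset.sum_lt_sum (fun i _ => ?_) ⟨j, Finset.mem_univ j, ?_⟩))
  · exact Set.indicator_le_indicator_of_subset (hsub i) (fun _ => Nat.zero_le _) v
  · simp [hv, hv']

variable [Fintype σ] {H : SimpleGraph σ} {ρ : σ → σ}

/-- Each of the `k` covers omits exactly one vertex of each clique: at most one since it is a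
clique, and at least one since otherwise the free vertex could be dropped, against minimality. So
all generators have the same degree on every clique. -/
theorem sum_class_add [DecidableEq σ] (hρ : ∀ v, ρ (ρ v) = ρ v)
    (hcl : ∀ u v, ρ u = ρ v → u ≠ v → H.Adj u v) (hfree : ∀ v w, H.Adj (ρ v) w → ρ w = ρ v)
    {k : ℕ} {f : σ → ℕ} (hf : f ∈ minElts (coverSums k H)) (v : σ) :
    ∑ u with ρ u = ρ v, f u + k = k * (Finset.univ.filter fun u => ρ u = ρ v).card := by
  classical
  obtain ⟨C, hC, hfC⟩ := exists_eq_sum_of_mem_minElts hf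
  have hmiss : ∀ j, ∃ u, ρ u = ρ v ∧ u ∉ C j := by
    intro j
    by_contra hcon
    push Not at hcon
    have hsub : ∀ i, Function.update C j (C j \ {ρ v}) i ⊆ C i := fun i => by
      by_cases hi : i = j
      · subst hi
        simp
      · simp [hi]
    have hcov : ∀ i, H.IsVertexCover (Function.update C j (C j \ {ρ v}) i) := fun i => by
      by_cases hi : i = j
      · subst hi
        simp only [Function.update_self]
        intro x y hxy
        by_cases hx : x = ρ v
        · subst hx
          exact Or.inr ⟨hcon y (hfree v y hxy), hxy.ne'⟩
        by_cases hy : y = ρ v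
        · subst hy
          exact Or.inl ⟨hcon x (hfree v x hxy.symm), hx⟩
        exact (hC i hxy).imp (fun h => ⟨h, hx⟩) fun h => ⟨h, hy⟩
      · simpa [hi] using hC i
    have heq := mem_of_sum_indicator_le hsub hfC (fun u => hf.2
      (y := fun u => ∑ i, (Function.update C j (C j \ {ρ v}) i).indicator (1 : σ → ℕ) u)
      ⟨_, hcov, fun u => le_rfl⟩ (fun u => by
        rw [hfC u]
        exact Finset.sum_le_sum fun i _ => Set.indicator_le_indicator_of_subset (hsub i)
          (fun _ => Nat.zero_le _) u) u) j
    have hmem : ρ v ∈ C j := hcon _ (hρ v)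
    rw [← heq] at hmem
    simp at hmem
  have hj : ∀ j, ∑ u with ρ u = ρ v, (C j).indicator (1 : σ → ℕ) u + 1 =
      (Finset.univ.filter fun u => ρ u = ρ v).card := by
    intro j
    obtain ⟨u, hu, huC⟩ := hmiss j
    have hu' : u ∈ Finset.univ.filter fun u => ρ u = ρ v := by simp [hu]
    rw [← Finset.add_sum_erase _ _ hu', Set.indicator_of_notMem huC, zero_add,
      Finset.sum_congr rfl (g := fun _ => 1) fun x hx => ?_]
    · rw [Finset.sum_const, smul_eq_mul, mul_one, Finset.card_erase_add_one hu']
    · rw [Finset.mem_erase, Finset.mem_filter] at hx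
      have hadj := hcl x u (hx.2.2.trans hu.symm) hx.1
      simp [(hC j hadj).resolve_right huC]
  simp only [hfC]
  rw [Finset.sum_comm]
  calc ∑ j, ∑ u with ρ u = ρ v, (C j).indicator (1 : σ → ℕ) u + k
      = ∑ j, (∑ u with ρ u = ρ v, (C j).indicator (1 : σ → ℕ) u + 1) := by
        rw [Finset.sum_add_distrib]
        simp
    _ = _ := by
        rw [Finset.sum_congr rfl fun j _ => hj j]
        simp

/-- If the vertices are partitioned into cliques, the fibres of `ρ`, and `ρ v` has no neighbours
outside its clique, then the powers of the cover ideal have linear quotients. -/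
theorem linQuot_coverSums_of_cliques (hρ : ∀ v, ρ (ρ v) = ρ v)
    (hcl : ∀ u v, ρ u = ρ v → u ≠ v → H.Adj u v) (hfree : ∀ v w, H.Adj (ρ v) w → ρ w = ρ v)
    (k : ℕ) : LinQuot (coverSums k H) := by
  classical
  -- Generators with less weight on the free vertices come first.
  refine ⟨fun f => ∑ v with ρ v = v, f v, fun f hf f' hf' hne hle => ?_⟩
  simp only at hle
  have hcs : ∀ v, ∑ u with ρ u = ρ v, f u = ∑ u with ρ u = ρ v, f' u := fun v => by
    have h1 := sum_class_add hρ hcl hfree hf v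
    have h2 := sum_class_add hρ hcl hfree hf' v
    omega
  -- Otherwise equal clique sums force `f ≤ f'` on free vertices. The keys turn this into equality
  -- there, so `f' ≤ f` everywhere, and the clique sums then give `f' = f`.
  have hex : ∃ v, ρ v ≠ v ∧ f v < f' v := by
    by_contra hcon
    push Not at hcon
    have hfr : ∀ w, ρ w = w → f w ≤ f' w := by
      intro w hw
      have hw' : w ∈ Finset.univ.filter fun u => ρ u = ρ w := by simp
      have h := hcs w
      rw [← Finset.add_sum_erase _ _ hw', ← Finset.add_sum_erase _ _ hw'] at h
      have : ∑ u ∈ (Finset.univ.filter fun u => ρ u = ρ w).erase w, f' u ≤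
          ∑ u ∈ (Finset.univ.filter fun u => ρ u = ρ w).erase w, f u := by
        refine Finset.sum_le_sum fun u hu => hcon u fun h' => ?_
        rw [Finset.mem_erase, Finset.mem_filter, hw, h'] at hu
        exact hu.1 hu.2.2
      omega
    have hfr' : ∀ w, ρ w = w → f w = f' w := by
      have h := le_antisymm (Finset.sum_le_sum fun w hw => hfr w (Finset.mem_filter.1 hw).2) hle
      intro w hw
      exact (Finset.sum_eq_sum_iff_of_le
        fun w hw => hfr w (Finset.mem_filter.1 hw).2).1 h w (by simp [hw])
    have hall : ∀ u, f' u ≤ f u := fun u => by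
      by_cases hu : ρ u = u
      · exact (hfr' u hu).ge
      · exact hcon u hu
    refine hne (funext fun u => ?_)
    exact (Finset.sum_eq_sum_iff_of_le fun x _ => hall x).1 (hcs u).symm u (by simp)
  obtain ⟨v, hv, hlt⟩ := hex
  obtain ⟨C, hC, hfC⟩ := exists_eq_sum_of_mem_minElts hf
  have hj : ∃ j, v ∉ C j := by
    by_contra hcon
    push Not at hcon
    have h1 : f v = k := by
      rw [hfC v]
      simp [hcon]
    have := le_of_mem_minElts_coverSums hf' v
    omega
  obtain ⟨j, hj⟩ := hj
  -- A cover omitting `v` contains the rest of its clique, so the free vertex can be exchanged for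
  -- `v`: all neighbours of `ρ v` are in the clique and remain covered.
  let C' := Function.update C j (insert v (C j \ {ρ v}))
  have hC'j : C' j = insert v (C j \ {ρ v}) := Function.update_self _ _ _
  have hC'i : ∀ i, i ≠ j → C' i = C i := fun i hi => Function.update_of_ne hi _ _
  have hw : ρ v ∈ C j := (hC j (hcl (ρ v) v (hρ v) hv)).resolve_right hj
  have hkey : ∀ y, H.Adj (ρ v) y → y ∈ C' j := by
    intro y hy
    rw [hC'j]
    by_cases hyv : y = v
    · exact Or.inl hyv
    · exact Or.inr ⟨(hC j (hcl y v (hfree v y hy) hyv)).resolve_right hj, hy.ne'⟩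
  have hcov : ∀ i, H.IsVertexCover (C' i) := by
    intro i
    by_cases hi : i = j
    · subst hi
      intro x y hxy
      by_cases hx : x = ρ v
      · subst hx
        exact Or.inr (hkey y hxy)
      by_cases hy : y = ρ v
      · subst hy
        exact Or.inl (hkey x hxy.symm)
      rw [hC'j]
      exact (hC i hxy).imp (fun h => Or.inr ⟨h, hx⟩) fun h => Or.inr ⟨h, hy⟩
    · rw [hC'i i hi]
      exact hC i
  obtain ⟨g, hg, hgle⟩ := exists_minElts_le
    (U := coverSums k H) (f := fun u => ∑ i, (C' i).indicator (1 : σ → ℕ) u)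
    ⟨C', hcov, fun u => le_rfl⟩
  have hother : ∀ u, u ≠ v → ∀ i, (C' i).indicator (1 : σ → ℕ) u ≤
      (C i).indicator (1 : σ → ℕ) u := by
    intro u hu i
    by_cases hi : i = j
    · subst hi
      rw [hC'j]
      by_cases huC : u ∈ C i
      · rw [Set.indicator_of_mem huC]
        exact Set.indicator_apply_le' (fun _ => le_rfl) fun _ => Nat.zero_le _
      · simp [hu, huC]
    · rw [hC'i i hi]
  have hsum : ∀ u, u ≠ v → ∑ i, (C' i).indicator (1 : σ → ℕ) u ≤ f u := fun u hu => by
    rw [hfC u]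
    exact Finset.sum_le_sum fun i _ => hother u hu i
  refine ⟨v, hlt, g, hg, ?_, (hgle v).trans ?_, fun u hu => (hgle u).trans (hsum u hu)⟩
  · refine Finset.sum_lt_sum (fun u hu => (hgle u).trans (hsum u ?_))
      ⟨ρ v, by simp [hρ], (hgle (ρ v)).trans_lt ?_⟩
    · rintro rfl
      exact hv (Finset.mem_filter.1 hu).2
    · rw [hfC]
      refine Finset.sum_lt_sum (fun i _ => hother _ hv i) ⟨j, Finset.mem_univ j, ?_⟩
      rw [hC'j]
      simp [hw, hv]
  · change ∑ i, (C' i).indicator (1 : σ → ℕ) v ≤ f v + 1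
    rw [hfC v, ← Finset.add_sum_erase _ _ (Finset.mem_univ j),
      ← Finset.add_sum_erase _ (fun i => (C i).indicator (1 : σ → ℕ) v) (Finset.mem_univ j)]
    rw [Finset.sum_congr rfl (g := fun i => (C i).indicator (1 : σ → ℕ) v) fun i hi => by
      rw [hC'i i (Finset.mem_erase.1 hi).1]]
    rw [hC'j]
    simp only [Set.mem_insert_iff, true_or, Set.indicator_of_mem, Pi.one_apply]
    omega

end Cliques

/-! ### Chordal graphs -/

section Chordal

variable {σ : Type*} {H : SimpleGraph σ}

/-- A chord would provide a shortcut. In the induction it suffices to examine chords at the first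
vertex. -/
theorem mem_edges_of_shortest {a b : σ} (p : H.Walk a b)
    (hp : ∀ q : H.Walk a b, p.length ≤ q.length) {x y : σ} (hx : x ∈ p.support)
    (hy : y ∈ p.support) (hxy : H.Adj x y) : s(x, y) ∈ p.edges := by
  classical
  induction p with
  | nil =>
    simp only [SimpleGraph.Walk.support_nil, List.mem_singleton] at hx hy
    exact absurd (hx.trans hy.symm) hxy.ne
  | @cons u v w h q ih =>
    have hhead : ∀ z, z ∈ q.support → H.Adj u z → z = v := by
      intro z hz huz
      have h1 := hp (.cons huz (q.dropUntil z hz))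
      have h2 := congrArg SimpleGraph.Walk.length (q.take_spec hz)
      simp only [SimpleGraph.Walk.length_cons, SimpleGraph.Walk.length_append] at h1 h2
      exact (SimpleGraph.Walk.eq_of_length_eq_zero (p := q.takeUntil z hz) (by omega)).symm
    rw [SimpleGraph.Walk.support_cons, List.mem_cons] at hx hy
    rw [SimpleGraph.Walk.edges_cons, List.mem_cons]
    rcases hx with rfl | hx
    · rcases hy with rfl | hy
      · exact absurd rfl hxy.ne
      · exact Or.inl (by rw [hhead y hy hxy])
    · rcases hy with rfl | hy
      · exact Or.inl (by rw [hhead x hx hxy.symm, Sym2.eq_swap])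
      · refine Or.inr (ih (fun r => ?_) hx hy)
        simpa using hp (.cons h r)

/-- The subgraph of `H` whose edges have both ends in `S`. -/
def within (H : SimpleGraph σ) (S : Set σ) : SimpleGraph σ where
  Adj x y := H.Adj x y ∧ x ∈ S ∧ y ∈ S
  symm := ⟨fun _ _ h => ⟨h.1.symm, h.2.2, h.2.1⟩⟩
  loopless := ⟨fun _ h => h.1.ne rfl⟩

theorem within_le (H : SimpleGraph σ) (S : Set σ) : within H S ≤ H := fun _ _ h => h.1

theorem within_mono (H : SimpleGraph σ) {S T : Set σ} (h : S ⊆ T) : within H S ≤ within H T :=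
  fun _ _ hxy => ⟨hxy.1, h hxy.2.1, h hxy.2.2⟩

theorem mem_of_mem_support_within {S : Set σ} {a b z : σ} (p : (within H S).Walk a b) (ha : a ∈ S)
    (hz : z ∈ p.support) : z ∈ S := by
  induction p with
  | nil =>
    simp only [SimpleGraph.Walk.support_nil, List.mem_singleton] at hz
    exact hz ▸ ha
  | cons h q ih =>
    rw [SimpleGraph.Walk.support_cons, List.mem_cons] at hz
    rcases hz with rfl | hz
    · exact ha
    · exact ih h.2.2 hz

/-- If `a` and `b` were not adjacent, a shortest connection through `A`, closed up by `u`, would be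
a cycle of length at least four. It has no chord, as `u` sees nothing of `A` and the connection is
induced. -/
theorem IsChordal.adj_of_reachable (hH : IsChordal H) {u a b : σ} {A : Set σ} (hua : H.Adj u a)
    (hub : H.Adj u b) (hne : a ≠ b) (hA : ∀ x ∈ A, x ≠ u ∧ ¬ H.Adj u x)
    (hr : (within H (insert a (insert b A))).Reachable a b) : H.Adj a b := by
  by_contra hab
  obtain ⟨p, hpath, hlen⟩ := hr.exists_path_of_dist
  have hS : ∀ z ∈ p.support, z = a ∨ z = b ∨ z ∈ A := fun z hz => by
    have := mem_of_mem_support_within p (Set.mem_insert a _) hz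
    exact this
  have hu : u ∉ p.support := fun h => by
    rcases hS u h with h | h | h
    · exact hua.ne h
    · exact hub.ne h
    · exact (hA u h).1 rfl
  set p' : H.Walk a b := p.mapLe (within_le H _) with hp'
  have hsupp : p'.support = p.support := by simp [hp']
  have hedges : p'.edges = p.edges := by simp [hp']
  have hcyc : (SimpleGraph.Walk.cons hua (p'.concat hub.symm)).IsCycle := by
    rw [SimpleGraph.Walk.cons_isCycle_iff, SimpleGraph.Walk.concat_isPath_iff, hsupp,
      SimpleGraph.Walk.edges_concat, hedges]
    refine ⟨⟨hpath.mapLe _, hu⟩, ?_⟩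
    rw [List.concat_eq_append, List.mem_append, not_or]
    refine ⟨fun h => hu (SimpleGraph.Walk.fst_mem_support_of_mem_edges p h), ?_⟩
    simp only [List.mem_singleton, Sym2.eq_iff]
    rintro (⟨h, -⟩ | ⟨-, h⟩)
    · exact hub.ne h
    · exact hne h
  have hl2 : 2 ≤ p.length := by
    have h0 : p.length ≠ 0 := fun h => hne (SimpleGraph.Walk.eq_of_length_eq_zero h)
    have h1 : p.length ≠ 1 := fun h => hab (SimpleGraph.Walk.adj_of_length_eq_one h).1
    omega
  obtain ⟨x, hx, y, hy, hxy, hnot⟩ := hH u _ hcyc (by simp [hp']; omega)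
  rw [SimpleGraph.Walk.edges_cons, SimpleGraph.Walk.edges_concat, hedges] at hnot
  simp only [List.concat_eq_append, List.mem_cons, List.mem_append, List.not_mem_nil, or_false,
    not_or] at hnot
  have hmem : ∀ z ∈ (SimpleGraph.Walk.cons hua (p'.concat hub.symm)).support,
      z = u ∨ z ∈ p.support := by
    intro z hz
    rw [SimpleGraph.Walk.support_cons, SimpleGraph.Walk.support_concat, hsupp] at hz
    simp only [List.mem_cons, List.mem_append, List.not_mem_nil, or_false] at hz
    tauto
  have hadj : ∀ z ∈ p.support, H.Adj u z → z = a ∨ z = b := fun z hz huz => by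
    rcases hS z hz with h | h | h
    · exact Or.inl h
    · exact Or.inr h
    · exact absurd huz (hA z h).2
  rcases hmem x hx with rfl | hx'
  · rcases hmem y hy with rfl | hy'
    · exact hxy.ne rfl
    · rcases hadj y hy' hxy with rfl | rfl
      · exact hnot.1 rfl
      · exact hnot.2.2 Sym2.eq_swap
  · rcases hmem y hy with rfl | hy'
    · rcases hadj x hx' hxy.symm with rfl | rfl
      · exact hnot.1 Sym2.eq_swap
      · exact hnot.2.2 rfl
    · refine hnot.2.1 (mem_edges_of_shortest p (fun q => ?_) hx' hy' ⟨hxy, hS x hx', hS y hy'⟩)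
      rw [hlen]
      exact SimpleGraph.dist_le q

/-- The neighbours of `v` in `T` form a clique. -/
def IsSimplicialIn (H : SimpleGraph σ) (T : Finset σ) (v : σ) : Prop :=
  ∀ a ∈ T, ∀ b ∈ T, H.Adj v a → H.Adj v b → a ≠ b → H.Adj a b

/-- The strengthening of Dirac's theorem that makes the induction work. Let `C` be the component of
`w` among the non-neighbours of `u`, and `S` the neighbours of `u` attached to `C`. Then `S` is a
clique, `C ∪ S` omits `u`, and a simplicial vertex of `C ∪ S` lying in `C` is simplicial in `T`. -/
theorem IsChordal.exists_simplicial_not_adj (hH : IsChordal H) (T : Finset σ) :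
    ∀ u ∈ T, (∃ w ∈ T, w ≠ u ∧ ¬ H.Adj u w) →
      ∃ x ∈ T, x ≠ u ∧ ¬ H.Adj u x ∧ IsSimplicialIn H T x := by
  classical
  induction T using Finset.strongInduction with
  | H T ih =>
  rintro u hu ⟨w, hwT, hwu, hw⟩
  let A : Set σ := {x | x ∈ T ∧ x ≠ u ∧ ¬ H.Adj u x}
  let C : Finset σ := T.filter fun x => x ∈ A ∧ (within H A).Reachable w x
  let S : Finset σ := T.filter fun s => H.Adj u s ∧ ∃ x ∈ C, H.Adj s x
  have hC : ∀ x, x ∈ C ↔ x ∈ A ∧ (within H A).Reachable w x := fun x => by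
    simp only [C, Finset.mem_filter, and_iff_right_iff_imp]
    exact fun h => h.1.1
  have hS : ∀ s, s ∈ S ↔ s ∈ T ∧ H.Adj u s ∧ ∃ x ∈ C, H.Adj s x := fun s => by
    simp only [S, Finset.mem_filter]
  have hwC : w ∈ C := (hC w).2 ⟨⟨hwT, hwu, hw⟩, SimpleGraph.Reachable.refl _⟩
  have hnbr : ∀ x ∈ C, ∀ y ∈ T, H.Adj x y → y ∈ C ∪ S := by
    intro x hx y hy hxy
    obtain ⟨hxA, hxr⟩ := (hC x).1 hx
    rw [Finset.mem_union]
    by_cases huy : H.Adj u y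
    · exact Or.inr ((hS y).2 ⟨hy, huy, x, hx, hxy.symm⟩)
    · have hyA : y ∈ A := ⟨hy, fun h => hxA.2.2 (h ▸ hxy.symm), huy⟩
      exact Or.inl ((hC y).2 ⟨hyA, hxr.trans (SimpleGraph.Adj.reachable ⟨hxy, hxA, hyA⟩)⟩)
  have hSclique : ∀ a ∈ S, ∀ b ∈ S, a ≠ b → H.Adj a b := by
    intro a ha b hb hne
    obtain ⟨haT, hua, x, hx, hax⟩ := (hS a).1 ha
    obtain ⟨hbT, hub, y, hy, hby⟩ := (hS b).1 hb
    obtain ⟨hxA, hxr⟩ := (hC x).1 hx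
    obtain ⟨hyA, hyr⟩ := (hC y).1 hy
    refine hH.adj_of_reachable (A := A) hua hub hne (fun x hx => hx.2) ?_
    have hsub : A ⊆ insert a (insert b A) := fun z hz => Or.inr (Or.inr hz)
    have hxy := (hxr.symm.trans hyr).mono (within_mono H hsub)
    have h1 : (within H (insert a (insert b A))).Adj a x := ⟨hax, Or.inl rfl, hsub hxA⟩
    have h2 : (within H (insert a (insert b A))).Adj y b :=
      ⟨hby.symm, hsub hyA, Or.inr (Or.inl rfl)⟩
    exact (h1.reachable.trans hxy).trans h2.reachable
  have hsub : C ∪ S ⊂ T := by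
    refine ⟨fun x hx => ?_, fun h => ?_⟩
    · rcases Finset.mem_union.1 hx with h | h
      · exact ((hC x).1 h).1.1
      · exact ((hS x).1 h).1
    · rcases Finset.mem_union.1 (h hu) with h | h
      · exact ((hC u).1 h).1.2.1 rfl
      · exact ((hS u).1 h).2.1.ne rfl
  have hlift : ∀ x ∈ C, IsSimplicialIn H (C ∪ S) x →
      ∃ x ∈ T, x ≠ u ∧ ¬ H.Adj u x ∧ IsSimplicialIn H T x := by
    intro x hx hsimp
    obtain ⟨hxA, -⟩ := (hC x).1 hx
    exact ⟨x, hxA.1, hxA.2.1, hxA.2.2, fun a ha b hb hxa hxb hne =>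
      hsimp a (hnbr x hx a ha hxa) b (hnbr x hx b hb hxb) hxa hxb hne⟩
  -- In a complete `C ∪ S` the vertex `w` serves. Otherwise the inductive hypothesis is applied at a
  -- vertex whose non-neighbours all avoid `S`: any non-universal vertex if all of `S` is universal,
  -- else a non-universal element of the clique `S`.
  by_cases hcl : ∀ p ∈ C ∪ S, ∀ q ∈ C ∪ S, p ≠ q → H.Adj p q
  · exact hlift w hwC fun a ha b hb _ _ hne => hcl a ha b hb hne
  by_cases huniv : ∀ s ∈ S, ∀ y ∈ C ∪ S, y ≠ s → H.Adj s y
  · push Not at hcl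
    obtain ⟨p, hp, q, hq, hne, hpq⟩ := hcl
    obtain ⟨x, hx, hxp, hxp', hsimp⟩ := ih _ hsub p hp ⟨q, hq, hne.symm, hpq⟩
    refine hlift x ((Finset.mem_union.1 hx).resolve_right fun hxS => ?_) hsimp
    exact hxp' (huniv x hxS p hp hxp.symm).symm
  · push Not at huniv
    obtain ⟨s, hs, y, hy, hys, hsy⟩ := huniv
    obtain ⟨x, hx, hxs, hxs', hsimp⟩ := ih _ hsub s (Finset.mem_union_right _ hs) ⟨y, hy, hys, hsy⟩
    refine hlift x ((Finset.mem_union.1 hx).resolve_right fun hxS => ?_) hsimp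
    exact hxs' (hSclique s hs x hxS hxs.symm)

/-- Dirac's theorem: every non-empty induced subgraph of a chordal graph has a simplicial
vertex. -/
theorem IsChordal.exists_simplicial (hH : IsChordal H) {T : Finset σ} (hT : T.Nonempty) :
    ∃ x ∈ T, IsSimplicialIn H T x := by
  obtain ⟨u, hu⟩ := hT
  by_cases h : ∃ u ∈ T, ∃ w ∈ T, w ≠ u ∧ ¬ H.Adj u w
  · obtain ⟨u, hu, hw⟩ := h
    obtain ⟨x, hx, -, -, hs⟩ := hH.exists_simplicial_not_adj T u hu hw
    exact ⟨x, hx, hs⟩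
  · push Not at h
    exact ⟨u, hu, fun a ha b hb _ _ hne => h a ha b hb hne.symm⟩

/-- Greedy choice: remove the closed neighbourhood of a simplicial vertex, which is a clique
represented by that vertex, and continue. Later representatives are not adjacent to earlier ones. -/
theorem IsChordal.exists_clique_partition (hH : IsChordal H) (T : Finset σ) :
    ∃ κ : σ → σ, (∀ v ∈ T, κ v ∈ T ∧ κ (κ v) = κ v) ∧
      (∀ u ∈ T, ∀ v ∈ T, κ u = κ v → u ≠ v → H.Adj u v) ∧
      ∀ u ∈ T, ∀ v ∈ T, ¬ H.Adj (κ u) (κ v) := by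
  classical
  induction T using Finset.strongInduction with
  | H T ih =>
  rcases T.eq_empty_or_nonempty with rfl | hT
  · exact ⟨id, by simp, by simp, by simp⟩
  obtain ⟨x, hx, hs⟩ := hH.exists_simplicial hT
  let T' := T.filter fun y => y ≠ x ∧ ¬ H.Adj x y
  obtain ⟨κ, h1, h2, h3⟩ := ih T' ⟨Finset.filter_subset _ _, fun h => by
    have := h hx
    simp [T'] at this⟩
  have hT' : ∀ y, y ∈ T' ↔ y ∈ T ∧ y ≠ x ∧ ¬ H.Adj x y := fun y => by simp [T']
  let κ' : σ → σ := fun y => if y ∈ T' then κ y else x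
  have hκ1 : ∀ y, y ∈ T' → κ' y = κ y := fun y hy => if_pos hy
  have hκ2 : ∀ y, y ∉ T' → κ' y = x := fun y hy => if_neg hy
  have hxT' : x ∉ T' := fun h => ((hT' x).1 h).2.1 rfl
  have hcl : ∀ y ∈ T, y ∉ T' → y = x ∨ H.Adj x y := fun y hy hy' => by
    by_contra hcon
    push Not at hcon
    exact hy' ((hT' y).2 ⟨hy, hcon⟩)
  refine ⟨κ', fun v hv => ?_, fun u hu v hv huv hne => ?_, fun u hu v hv => ?_⟩
  · by_cases hv' : v ∈ T'
    · obtain ⟨ha, hb⟩ := h1 v hv'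
      rw [hκ1 v hv', hκ1 _ ha]
      exact ⟨((hT' _).1 ha).1, hb⟩
    · rw [hκ2 v hv', hκ2 x hxT']
      exact ⟨hx, rfl⟩
  · by_cases hu' : u ∈ T'
    · by_cases hv' : v ∈ T'
      · rw [hκ1 u hu', hκ1 v hv'] at huv
        exact h2 u hu' v hv' huv hne
      · rw [hκ1 u hu', hκ2 v hv'] at huv
        exact absurd (huv ▸ (h1 u hu').1) hxT'
    · by_cases hv' : v ∈ T'
      · rw [hκ2 u hu', hκ1 v hv'] at huv
        exact absurd (huv ▸ (h1 v hv').1) hxT'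
      · rcases hcl u hu hu' with rfl | hxu
        · exact (hcl v hv hv').resolve_left hne.symm
        · rcases hcl v hv hv' with rfl | hxv
          · exact hxu.symm
          · exact hs u hu v hv hxu hxv hne
  · by_cases hu' : u ∈ T'
    · by_cases hv' : v ∈ T'
      · rw [hκ1 u hu', hκ1 v hv']
        exact h3 u hu' v hv'
      · rw [hκ1 u hu', hκ2 v hv']
        exact fun h => ((hT' _).1 (h1 u hu').1).2.2 h.symm
    · by_cases hv' : v ∈ T'
      · rw [hκ2 u hu', hκ1 v hv']
        exact fun h => ((hT' _).1 (h1 v hv').1).2.2 h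
      · rw [hκ2 u hu', hκ2 v hv']
        exact H.irrefl

/-- In a chordal graph, the vertices of a clique `F` having neighbours outside `F` are dominated
by an independent set outside `F`. -/
theorem IsChordal.exists_dominating (hH : IsChordal H) (T : Finset σ) (F : Set σ)
    (hF : ∀ a ∈ F, ∀ b ∈ F, a ≠ b → H.Adj a b) :
    ∃ B : Set σ, (∀ y ∈ B, y ∈ T ∧ y ∉ F) ∧ (∀ y ∈ B, ∀ z ∈ B, ¬ H.Adj y z) ∧
      ∀ x ∈ F, x ∈ T → (∃ y ∈ T, y ∉ F ∧ H.Adj x y) → ∃ y ∈ B, H.Adj x y := by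
  classical
  induction T using Finset.strongInduction with
  | H T ih =>
  rcases T.eq_empty_or_nonempty with rfl | hT
  · exact ⟨∅, by simp, by simp, by simp⟩
  obtain ⟨v, hv, hs⟩ := hH.exists_simplicial hT
  obtain ⟨B, hB1, hB2, hB3⟩ := ih (T.erase v) (Finset.erase_ssubset hv)
  have hB1' : ∀ y ∈ B, y ∈ T ∧ y ∉ F := fun y hy =>
    ⟨Finset.mem_of_mem_erase (hB1 y hy).1, (hB1 y hy).2⟩
  by_cases hvF : v ∈ F
  -- If the simplicial vertex `v` is in `F` and sees some `y` outside, then `y` alone dominates `F ∩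
  -- T`. If `v` is outside and sees another outside vertex `u`, its neighbours in `F` see `u` too
  -- and `v` may be dropped. If it sees only vertices of `F`, it can join `B`.
  · by_cases hout : ∃ y ∈ T, y ∉ F ∧ H.Adj v y
    · obtain ⟨y, hyT, hyF, hvy⟩ := hout
      refine ⟨{y}, by simp [hyT, hyF], by simp, fun x hx hxT _ => ⟨y, rfl, ?_⟩⟩
      by_cases hxv : x = v
      · exact hxv ▸ hvy
      · exact hs x hxT y hyT (hF v hvF x hx (Ne.symm hxv)) hvy fun h => hyF (h ▸ hx)
    · refine ⟨B, hB1', hB2, fun x hx hxT hex => ?_⟩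
      obtain ⟨y, hyT, hyF, hxy⟩ := hex
      have hxv : x ≠ v := fun h => hout ⟨y, hyT, hyF, h ▸ hxy⟩
      exact hB3 x hx (Finset.mem_erase.2 ⟨hxv, hxT⟩)
        ⟨y, Finset.mem_erase.2 ⟨fun h => hyF (h ▸ hvF), hyT⟩, hyF, hxy⟩
  · by_cases hout : ∃ u ∈ T, u ∉ F ∧ H.Adj v u
    · obtain ⟨u, huT, huF, hvu⟩ := hout
      refine ⟨B, hB1', hB2, fun x hx hxT hex => ?_⟩
      obtain ⟨y, hyT, hyF, hxy⟩ := hex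
      refine hB3 x hx (Finset.mem_erase.2 ⟨fun h => hvF (h ▸ hx), hxT⟩) ?_
      by_cases hyv : y = v
      · subst hyv
        exact ⟨u, Finset.mem_erase.2 ⟨hvu.ne', huT⟩, huF,
          hs x hxT u huT hxy.symm hvu fun h => huF (h ▸ hx)⟩
      · exact ⟨y, Finset.mem_erase.2 ⟨hyv, hyT⟩, hyF, hxy⟩
    · push Not at hout
      refine ⟨insert v B, ?_, ?_, fun x hx hxT hex => ?_⟩
      · rintro y (rfl | hy)
        · exact ⟨hv, hvF⟩
        · exact hB1' y hy
      · have hvB : ∀ z ∈ B, ¬ H.Adj v z := fun z hz => hout z (hB1' z hz).1 (hB1' z hz).2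
        rintro y (rfl | hy) z (rfl | hz)
        · exact H.irrefl
        · exact hvB z hz
        · exact fun h => hvB y hy h.symm
        · exact hB2 y hy z hz
      · obtain ⟨y, hyT, hyF, hxy⟩ := hex
        by_cases hyv : y = v
        · exact ⟨v, Or.inl rfl, hyv ▸ hxy⟩
        · obtain ⟨z, hz, hxz⟩ := hB3 x hx (Finset.mem_erase.2 ⟨fun h => hvF (h ▸ hx), hxT⟩)
            ⟨y, Finset.mem_erase.2 ⟨hyv, hyT⟩, hyF, hxy⟩
          exact ⟨z, Or.inr hz, hxz⟩

/-- Unmixedness forces a free vertex in every clique of the partition. The representatives `R` form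
the complement of a minimal cover, so the complement of each minimal cover must meet every clique.
-/
theorem linQuot_coverSums_of_chordal [Finite σ] (hu : IsUnmixed H) (hH : IsChordal H) (k : ℕ) :
    LinQuot (coverSums k H) := by
  classical
  have := Fintype.ofFinite σ
  obtain ⟨κ, h1, h2, h3⟩ := hH.exists_clique_partition Finset.univ
  simp only [Finset.mem_univ, true_and, forall_const] at h1 h2 h3
  let R : Finset σ := Finset.univ.filter fun v => κ v = v
  have hR : IsMinVertexCover H Rᶜ := by
    refine ⟨fun x y hxy => ?_, fun E hE hER z hz => ?_⟩
    · by_contra hcon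
      simp only [R, Finset.coe_compl, Set.mem_compl_iff, Finset.mem_coe, Finset.mem_filter,
        Finset.mem_univ, true_and, not_or, not_not] at hcon
      refine h3 x y ?_
      rwa [hcon.1, hcon.2]
    · have hz' : κ z ≠ z := by simpa [R] using hz
      refine (hE (h2 z (κ z) (h1 z).symm hz'.symm)).resolve_right fun h => ?_
      have := hER h
      simp [R, h1] at this
  have hfree : ∀ v, ∃ x, κ x = κ v ∧ ∀ y, H.Adj x y → κ y = κ v := by
    intro v
    by_contra hcon
    push Not at hcon
    -- Without a free vertex, an independent set `B` outside the clique dominates it. A minimal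
    -- cover avoiding `B` then contains the whole clique, and its complement is too small.
    obtain ⟨B, hB1, hB2, hB3⟩ := hH.exists_dominating Finset.univ {x | κ x = κ v}
      fun a ha b hb hne => h2 a b (Eq.trans ha (Eq.symm hb)) hne
    obtain ⟨D, hDB, hD⟩ := exists_minimal_le_of_wellFoundedLT
      (fun D : Finset σ => H.IsVertexCover (D : Set σ)) (Finset.univ.filter fun x => x ∉ B) (by
        intro x y hxy
        by_contra hcon
        simp only [Finset.coe_filter, Finset.mem_univ, true_and, Set.mem_ofPred_eq, not_or,
          not_not] at hcon
        exact hB2 x hcon.1 y hcon.2 hxy)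
    have hDF : ∀ x, κ x = κ v → x ∈ D := by
      intro x hx
      obtain ⟨y, hxy, hy⟩ := hcon x hx
      obtain ⟨z, hz, hxz⟩ := hB3 x hx (Finset.mem_univ x) ⟨y, Finset.mem_univ y, hy, hxy⟩
      refine (hD.1 hxz).resolve_right fun h => ?_
      have := hDB h
      simp only [Finset.mem_filter] at this
      exact this.2 hz
    have hcard : Dᶜ.card = R.card := by
      have h := hu D Rᶜ hD hR
      rw [Finset.card_compl] at h ⊢
      have := R.card_le_univ
      omega
    have hlt : Dᶜ.card ≤ (R.erase (κ v)).card := by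
      refine Finset.card_le_card_of_injOn κ (fun x hx => ?_) fun x hx y hy hxy => ?_
      · have hx' : x ∉ D := by simpa using hx
        simp only [Finset.coe_erase, Set.mem_sdiff, Set.mem_singleton_iff, Finset.mem_coe, R,
          Finset.mem_filter, Finset.mem_univ, true_and]
        exact ⟨h1 x, fun h => hx' (hDF x h)⟩
      · by_contra hne
        have hx' : x ∉ D := by simpa using hx
        have hy' : y ∉ D := by simpa using hy
        exact (hD.1 (h2 x y hxy hne)).elim hx' hy'
    have hmem : κ v ∈ R := by simp [R, h1]
    have := Finset.card_erase_lt_of_mem hmem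
    omega
  choose ρ hρ1 hρ2 using hfree
  have hκρ : ∀ v, κ (ρ (κ v)) = κ v := fun v => (hρ1 _).trans (h1 v)
  -- The free vertices were chosen separately for each `v`; evaluating at the representative makes
  -- the choice constant on cliques.
  refine linQuot_coverSums_of_cliques (ρ := fun v => ρ (κ v)) (fun v => ?_) (fun u v huv hne => ?_)
    (fun v w hvw => ?_) k
  · simp only [hκρ]
  · refine h2 u v ?_ hne
    rw [← hκρ u, ← hκρ v]
    exact congrArg κ huv
  · have := hρ2 _ w hvw
    rw [h1] at this
    simp only [this]

end Chordal

end CoverPowers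

namespace CoverPowers

/-! ### Paths -/

section Path

/-- The exponents `c ≥ l` on a path with `c_i + c_{i+1} ≥ k` for all `i ≥ s`. -/
def pathSums (r k s : ℕ) (l : Fin r → ℕ) : Set (Fin r → ℕ) :=
  {c | (∀ i, l i ≤ c i) ∧ ∀ i j : Fin r, s ≤ i → (i : ℕ) + 1 = j → k ≤ c i + c j}

/-- The lower bounds `l` make the induction close up. Raising the exponent at the vertex `s + 1`
only changes `l`; fixing it at its minimum turns its two edge constraints into lower bounds, leaving
a shorter path. -/
theorem linQuot_pathSums (r k n : ℕ) :
    ∀ (s : ℕ) (l : Fin r → ℕ), r ≤ s + n → LinQuot (pathSums r k s l) := by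
  induction n with
  | zero =>
    intro s l hs
    have : pathSums r k s l = {c | l ≤ c} := by
      ext c
      refine ⟨fun h => h.1, fun h => ⟨h, fun i j hi hij => ?_⟩⟩
      have := i.2
      omega
    rw [this]
    exact linQuot_Ici l
  | succ n ih =>
    intro s l hs
    by_cases hsr : s + 1 < r
    · let a : Fin r := ⟨s, by omega⟩
      let i : Fin r := ⟨s + 1, hsr⟩
      have hia : i ≠ a := fun h => by simpa [i, a] using congrArg Fin.val h
      -- Each split raises `l i` by one. Once `k ≤ l a + l i`, the edge from `s` to `s + 1` imposes
      -- nothing and `s` advances.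
      induction hd : k - l i using Nat.strong_induction_on generalizing l with
      | _ d ihd =>
      by_cases hk : k ≤ l a + l i
      · have : pathSums r k s l = pathSums r k (s + 1) l := by
          ext c
          refine ⟨fun h => ⟨h.1, fun p q hp => h.2 p q (by omega)⟩, fun h => ⟨h.1, ?_⟩⟩
          intro p q hp hpq
          rcases eq_or_lt_of_le hp with h' | h'
          · have hpa : p = a := Fin.ext h'.symm
            have hqi : q = i := Fin.ext (by simp only [i]; omega)
            rw [hpa, hqi]
            exact hk.trans (Nat.add_le_add (h.1 a) (h.1 i))
          · exact h.2 p q h' hpq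
        rw [this]
        exact ih (s + 1) l (by omega)
      · let l' : Fin r → ℕ := fun j =>
          if (j : ℕ) = s ∨ (j : ℕ) = s + 2 then max (l j) (k - l i) else l j
        have hl' : ∀ j, l j ≤ l' j := fun j => by
          simp only [l']
          split_ifs
          · exact le_max_left _ _
          · exact le_rfl
        have hl'' : ∀ j : Fin r, ((j : ℕ) = s ∨ (j : ℕ) = s + 2) → k - l i ≤ l' j := fun j hj => by
          simp only [l', if_pos hj]
          exact le_max_right _ _
        have hl'i : l' i = l i := if_neg (by simp [i])
        refine LinQuot.split (U₂ := pathSums r k (s + 2) l') i (l i) ?_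
          (ih (s + 2) l' (by omega)) ?_ ?_ ?_ ?_
        · have : {c ∈ pathSums r k s l | l i < c i} =
              pathSums r k s (Function.update l i (l i + 1)) := by
            ext c
            constructor
            · rintro ⟨⟨h1, h2⟩, h3⟩
              refine ⟨fun j => ?_, h2⟩
              by_cases hj : j = i
              · subst hj
                simpa using h3
              · simpa [hj] using h1 j
            · rintro ⟨h1, h2⟩
              have hi := h1 i
              rw [Function.update_self] at hi
              refine ⟨⟨fun j => ?_, h2⟩, hi⟩
              by_cases hj : j = i
              · subst hj
                omega
              · simpa [hj] using h1 j
          rw [this]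
          exact ihd (k - (l i + 1)) (by omega) _ (by rw [Function.update_self])
        · rintro c ⟨h1, h2⟩
          refine ⟨fun j => (hl' j).trans (h1 j), fun p q hp hpq => ?_⟩
          by_cases hps : (p : ℕ) = s
          · have hq : q = i := Fin.ext (by simp only [i]; omega)
            have h3 := hl'' p (Or.inl hps)
            have h4 := h1 p
            have h5 := h1 i
            rw [hl'i] at h5
            rw [hq]
            omega
          · by_cases hps' : (p : ℕ) = s + 1
            · have hpi : p = i := Fin.ext hps'
              have h3 := hl'' q (Or.inr (by omega))
              have h4 := h1 q
              have h5 := h1 i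
              rw [hl'i] at h5
              rw [hpi]
              omega
            · exact h2 p q (by omega) hpq
        · rintro c ⟨h1, h2⟩ hci
          refine ⟨fun j => ?_, fun p q hp => h2 p q (by omega)⟩
          by_cases hj : (j : ℕ) = s ∨ (j : ℕ) = s + 2
          · have : k ≤ c i + c j := by
              rcases hj with h | h
              · rw [add_comm]
                exact h2 j i h.ge (by simp only [i]; omega)
              · exact h2 i j (by simp [i]) (by simp only [i]; omega)
            simp only [l', if_pos hj]
            exact max_le (h1 j) (by omega)
          · simp only [l', if_neg hj]
            exact h1 j
        · intro c hc
          have hmem : Function.update c i (l i) ∈ pathSums r k (s + 2) l' := by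
            refine ⟨fun j => ?_, fun p q hp hpq => ?_⟩
            · by_cases hj : j = i
              · subst hj
                simp [hl'i]
              · simpa [hj] using hc.1.1 j
            · have hpi : p ≠ i := fun h => by
                have := congrArg Fin.val h
                simp only [i] at this
                omega
              have hqi : q ≠ i := fun h => by
                have := congrArg Fin.val h
                simp only [i] at this
                omega
              simpa [hpi, hqi] using hc.1.2 p q hp hpq
          have hle : Function.update c i (l i) ≤ c := by
            intro j
            by_cases hj : j = i
            · subst hj
              have := hc.1.1 i
              rw [hl'i] at this
              simpa using this
            · simp [hj]
          have := congrFun (minElts_eq_of_le hc hmem hle) i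
          rw [Function.update_self] at this
          exact this.ge
        · rintro c hc
          obtain ⟨h1, h2⟩ := hc.1
          have hci := h1 i
          rw [hl'i] at hci
          have hca := h1 a
          have hla := hl'' a (Or.inl rfl)
          have hsi : swapUp c i a i = c i + 1 := by simp [swapUp]
          have hsa : swapUp c i a a = c a - 1 := by simp [swapUp, hia.symm]
          have hso : ∀ j, j ≠ i → j ≠ a → swapUp c i a j = c j := fun j h h' => by
            simp [swapUp, h, h']
          -- Weight moves from `a` to `i`. There is room at `a` because `c a ≥ k - l i > l a`, and
          -- the edge between them keeps its sum.
          refine ⟨swapUp c i a, ⟨fun j => ?_, fun p q hp hpq => ?_⟩, ?_, leUp_swapUp _ _ _, a, ?_⟩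
          · by_cases hji : j = i
            · subst hji
              omega
            · by_cases hja : j = a
              · subst hja
                omega
              · rw [hso j hji hja]
                exact (hl' j).trans (h1 j)
          · by_cases hps : (p : ℕ) = s
            · have hpa : p = a := Fin.ext hps
              have hq : q = i := Fin.ext (by simp only [i]; omega)
              rw [hpa, hq]
              omega
            · have hqi : q ≠ i := fun h => by
                have := congrArg Fin.val h
                simp only [i] at this
                omega
              have hqa : q ≠ a := fun h => by
                have := congrArg Fin.val h
                simp only [a] at this
                omega
              have hpa : p ≠ a := fun h => hps (congrArg Fin.val h)
              rw [hso q hqi hqa]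
              by_cases hpi : p = i
              · have hpv : (p : ℕ) = s + 1 := congrArg Fin.val hpi
                have h3 := hl'' q (Or.inr (by omega))
                have h4 := h1 q
                rw [hpi]
                omega
              · have hpv : (p : ℕ) ≠ s + 1 := fun h => hpi (Fin.ext h)
                rw [hso p hpi hpa]
                exact h2 p q (by omega) hpq
          · omega
          · omega
    · have : pathSums r k s l = {c | l ≤ c} := by
        ext c
        refine ⟨fun h => h.1, fun h => ⟨h, fun i j hi hij => ?_⟩⟩
        have := j.2
        omega
      rw [this]
      exact linQuot_Ici l

theorem linQuot_coverSums_pathGraph (r k : ℕ) :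
    LinQuot (coverSums k (SimpleGraph.pathGraph r)) := by
  have : coverSums k (SimpleGraph.pathGraph r) = pathSums r k 0 0 := by
    ext c
    have hX : ∀ u v : Fin r, (SimpleGraph.pathGraph r).Adj u v →
        (u ∈ {i : Fin r | Even (i : ℕ)} ↔ v ∉ {i : Fin r | Even (i : ℕ)}) := fun u v huv => by
      simp only [Set.mem_ofPred_eq, Nat.not_even_iff_odd]
      rcases SimpleGraph.pathGraph_adj.1 huv with h' | h'
      · rw [← h', Nat.odd_add_one, Nat.not_odd_iff_even]
      · rw [← h', Nat.even_add_one, Nat.not_even_iff_odd]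
    refine (mem_coverSums_bipartite_iff hX).trans ⟨?_, ?_⟩
    · refine fun h => ⟨fun i => Nat.zero_le _, fun i j _ hij => h i j ?_⟩
      exact SimpleGraph.pathGraph_adj.2 (Or.inl hij)
    · intro h u v huv
      rcases SimpleGraph.pathGraph_adj.1 huv with h' | h'
      · exact h.2 u v (Nat.zero_le _) h'
      · rw [add_comm]
        exact h.2 v u (Nat.zero_le _) h'
  rw [this]
  exact linQuot_pathSums r k r 0 0 (by omega)

theorem linQuot_coverSums_of_path {σ : Type*} {H : SimpleGraph σ} (hH : IsPathGraph H) (k : ℕ) :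
    LinQuot (coverSums k H) := by
  obtain ⟨r, ⟨e⟩⟩ := hH
  exact (linQuot_coverSums_pathGraph r k).coverSums_of_iso e

end Path

end CoverPowers

namespace CoverPowers

/-! ### Cohen–Macaulay bipartite graphs -/

section CohenMacaulay

/-- A Cohen–Macaulay local ring of dimension at least two has connected punctured spectrum. -/
theorem IsCohenMacaulayLocal.false_of_mul_eq_zero {R : Type*} [CommRing R] [IsLocalRing R]
    (hR : IsCohenMacaulayLocal R) (hdim : 2 ≤ ringKrullDim R) {I J : Ideal R}
    (hm : IsLocalRing.maximalIdeal R ≤ I ⊔ J) (hIJ : ∀ x ∈ I, ∀ y ∈ J, x * y = 0)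
    {x₀ y₀ : R} (hx₀ : x₀ ∈ I) (hy₀ : y₀ ∈ J) (hx : x₀ ≠ 0) (hy : y₀ ≠ 0) : False := by
  obtain ⟨rs, hrs, hreg, hlen⟩ := hR
  rw [← hlen] at hdim
  have hlen2 : 2 ≤ rs.length := by exact_mod_cast hdim
  match rs, hrs, hreg, hlen2 with
  | r₁ :: r₂ :: rs, hrs, hreg, _ =>
    rw [RingTheory.Sequence.isRegular_cons_iff, RingTheory.Sequence.isRegular_cons_iff] at hreg
    obtain ⟨h₁, h₂, -⟩ := hreg
    obtain ⟨a, ha, b, hb, hab⟩ := Submodule.mem_sup.1 (hm (hrs r₁ (by simp)))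
    obtain ⟨a', ha', b', hb', hab'⟩ := Submodule.mem_sup.1 (hm (hrs r₂ (by simp)))
    -- Both sides equal `a * a'`, as the cross terms vanish. Regularity of `r₂` modulo `r₁` then
    -- puts `a` in the ideal of `r₁`.
    have hrel : r₂ * a = r₁ * a' := by
      rw [← hab, ← hab', add_mul, add_mul, mul_comm b' a, mul_comm b a', hIJ a ha b' hb',
        hIJ a' ha' b hb, mul_comm]
    have hmem : Submodule.Quotient.mk a = (0 : QuotSMulTop r₁ R) := by
      refine h₂ ?_
      change Submodule.Quotient.mk (r₂ • a) = r₂ • (0 : QuotSMulTop r₁ R)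
      rw [smul_zero]
      rw [Submodule.Quotient.mk_eq_zero, smul_eq_mul, hrel]
      exact Submodule.smul_mem_pointwise_smul _ _ _ trivial
    rw [Submodule.Quotient.mk_eq_zero, Submodule.mem_smul_pointwise_iff_exists] at hmem
    obtain ⟨c, -, hc⟩ := hmem
    rw [smul_eq_mul] at hc
    have hkey : a * (1 - c) = b * c := by
      have : a + b = r₁ := hab
      linear_combination (-1 : R) * hc - c * this
    have hzero : ∀ z, r₁ * z = 0 → z = 0 := fun z hz =>
      h₁ (by simpa using hz)
    -- From `a * (1 - c) = b * c`, one of `a`, `b` is a multiple of the other. Then `r₁ = a + b`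
    -- kills `y₀` or `x₀`, although it is a non-zero-divisor.
    rcases IsLocalRing.isUnit_or_isUnit_one_sub_self c with hu | hu
    · obtain ⟨d, hd⟩ := hu.exists_right_inv
      have hb' : b = d * (a * (1 - c)) := by linear_combination (-b) * hd - d * hkey
      refine hy (hzero y₀ ?_)
      have h0 := hIJ a ha y₀ hy₀
      rw [← hab, hb']
      linear_combination (1 + d * (1 - c)) * h0
    · obtain ⟨d, hd⟩ := hu.exists_right_inv
      have ha' : a = d * (b * c) := by linear_combination (-a) * hd + d * hkey
      refine hx (hzero x₀ ?_)
      have h0 := hIJ x₀ hx₀ b hb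
      rw [← hab, ha']
      linear_combination (1 + d * c) * h0

variable {σ K : Type*} [Field K] {H : SimpleGraph σ}

open MvPolynomial

open Classical in
/-- Setting to zero the variables outside `T`. -/
noncomputable def restrictVars (K : Type*) [Field K] (T : Set σ) :
    MvPolynomial σ K →ₐ[K] MvPolynomial σ K :=
  aeval fun v => if v ∈ T then X v else 0

theorem restrictVars_X_of_mem {T : Set σ} {v : σ} (hv : v ∈ T) :
    restrictVars K T (X v) = X v := by
  simp [restrictVars, hv]

theorem restrictVars_X_of_notMem {T : Set σ} {v : σ} (hv : v ∉ T) :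
    restrictVars K T (X v) = 0 := by
  simp [restrictVars, hv]

theorem restrictVars_eq_zero {T : Set σ} (hT : ∀ u ∈ T, ∀ v ∈ T, ¬ H.Adj u v)
    {f : MvPolynomial σ K} (hf : f ∈ edgeIdeal K H) : restrictVars K T f = 0 := by
  have : edgeIdeal K H ≤ RingHom.ker (restrictVars K T) := by
    refine Ideal.span_le.2 ?_
    rintro _ ⟨a, b, hab, rfl⟩
    rw [SetLike.mem_coe, RingHom.mem_ker, map_mul]
    by_cases ha : a ∈ T
    · have hb : b ∉ T := fun hb => hT a ha b hb hab
      rw [restrictVars_X_of_notMem hb, mul_zero]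
    · rw [restrictVars_X_of_notMem ha, zero_mul]
  exact this hf

theorem sub_restrictVars_mem (T : Set σ) (f : MvPolynomial σ K) :
    f - restrictVars K T f ∈ Ideal.span (X '' Tᶜ : Set (MvPolynomial σ K)) := by
  rw [← Ideal.Quotient.eq]
  let π := Ideal.Quotient.mkₐ K (Ideal.span (X '' Tᶜ : Set (MvPolynomial σ K)))
  have : π = π.comp (restrictVars K T) := by
    ext v
    by_cases hv : v ∈ T
    · simp [restrictVars_X_of_mem hv]
    · rw [AlgHom.comp_apply, restrictVars_X_of_notMem hv, map_zero]
      exact Ideal.Quotient.eq_zero_iff_mem.2 (Ideal.subset_span ⟨v, hv, rfl⟩)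
  exact DFunLike.congr_fun this f

/-- The prime ideal of the quotient by the edge ideal given by an independent set. -/
noncomputable def indepPrime (T : Set σ) (hT : ∀ u ∈ T, ∀ v ∈ T, ¬ H.Adj u v) :
    Ideal (MvPolynomial σ K ⧸ edgeIdeal K H) :=
  RingHom.ker (Ideal.Quotient.lift (edgeIdeal K H) (restrictVars K T).toRingHom
    fun _ hf => restrictVars_eq_zero hT hf)

theorem isPrime_indepPrime (T : Set σ) (hT : ∀ u ∈ T, ∀ v ∈ T, ¬ H.Adj u v) :
    (indepPrime (K := K) T hT).IsPrime :=
  RingHom.ker_isPrime _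

theorem mk_mem_indepPrime {T : Set σ} {hT : ∀ u ∈ T, ∀ v ∈ T, ¬ H.Adj u v}
    {f : MvPolynomial σ K} :
    Ideal.Quotient.mk (edgeIdeal K H) f ∈ indepPrime T hT ↔ restrictVars K T f = 0 :=
  Iff.rfl

theorem mk_X_mem_indepPrime {T : Set σ} {hT : ∀ u ∈ T, ∀ v ∈ T, ¬ H.Adj u v} {v : σ} :
    Ideal.Quotient.mk (edgeIdeal K H) (X v) ∈ indepPrime T hT ↔ v ∉ T := by
  rw [mk_mem_indepPrime]
  refine ⟨fun h hv => ?_, restrictVars_X_of_notMem⟩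
  rw [restrictVars_X_of_mem hv] at h
  exact X_ne_zero v h

theorem indepPrime_le {T T' : Set σ} {hT : ∀ u ∈ T, ∀ v ∈ T, ¬ H.Adj u v}
    {hT' : ∀ u ∈ T', ∀ v ∈ T', ¬ H.Adj u v} (h : T ⊆ T') :
    indepPrime (K := K) T' hT' ≤ indepPrime T hT := by
  intro p hp
  obtain ⟨f, rfl⟩ := Ideal.Quotient.mk_surjective p
  rw [mk_mem_indepPrime] at hp ⊢
  have : (restrictVars K T).comp (restrictVars K T') = restrictVars K T := by
    ext v
    by_cases hv : v ∈ T'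
    · simp [restrictVars_X_of_mem hv]
    · simp [restrictVars_X_of_notMem hv, restrictVars_X_of_notMem (fun h' => hv (h h'))]
  rw [← this, AlgHom.comp_apply, hp, map_zero]

theorem indepPrime_lt {T T' : Set σ} {hT : ∀ u ∈ T, ∀ v ∈ T, ¬ H.Adj u v}
    {hT' : ∀ u ∈ T', ∀ v ∈ T', ¬ H.Adj u v} (h : T ⊆ T') {v : σ} (hv : v ∈ T') (hvT : v ∉ T) :
    indepPrime (K := K) T' hT' < indepPrime T hT := by
  refine lt_of_le_not_ge (indepPrime_le h) fun hle => ?_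
  exact mk_X_mem_indepPrime.1 (hle (mk_X_mem_indepPrime.2 hvT)) hv

/-- Links of the independence complex of a Cohen–Macaulay graph are connected: if the vertices
outside the closed neighbourhood of an independent set `F` are the join of `A` and `B`, then `A`
has no two non-adjacent vertices. -/
theorem IsCohenMacaulayGraph.false_of_join (hH : IsCohenMacaulayGraph K H) {F A B : Set σ}
    (hF : ∀ u ∈ F, ∀ v ∈ F, ¬ H.Adj u v)
    (hcov : ∀ v, v ∈ F ∨ (∃ u ∈ F, H.Adj u v) ∨ v ∈ A ∨ v ∈ B)
    (hAB : ∀ a ∈ A, ∀ b ∈ B, H.Adj a b) {a₁ a₂ b : σ} (ha₁ : a₁ ∈ A) (hb : b ∈ B)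
    (hne : a₁ ≠ a₂) (ha₁₂ : ¬ H.Adj a₁ a₂)
    (h₁ : a₁ ∉ F ∧ ∀ u ∈ F, ¬ H.Adj a₁ u) (h₂ : a₂ ∉ F ∧ ∀ u ∈ F, ¬ H.Adj a₂ u)
    (h₃ : b ∉ F ∧ ∀ u ∈ F, ¬ H.Adj b u) : False := by
  have hins : ∀ {T : Set σ} {x : σ}, (∀ u ∈ T, ∀ v ∈ T, ¬ H.Adj u v) →
      (∀ u ∈ T, ¬ H.Adj x u) → ∀ u ∈ insert x T, ∀ v ∈ insert x T, ¬ H.Adj u v := by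
    rintro T x hT hx u (rfl | hu) v (rfl | hv)
    · exact H.irrefl
    · exact hx v hv
    · exact fun h => hx u hu h.symm
    · exact hT u hu v hv
  have hF1 := hins hF h₁.2
  have hFb := hins hF h₃.2
  have hF2 : ∀ u ∈ insert a₂ (insert a₁ F), ∀ v ∈ insert a₂ (insert a₁ F), ¬ H.Adj u v :=
    hins hF1 (by
      rintro u (rfl | hu)
      · exact fun h => ha₁₂ h.symm
      · exact h₂.2 u hu)
  let P := indepPrime (K := K) F hF
  have hPp : P.IsPrime := isPrime_indepPrime F hF
  have hP1 := isPrime_indepPrime (K := K) _ hF1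
  have hP2 := isPrime_indepPrime (K := K) _ hF2
  let L := Localization.AtPrime P
  let x : σ → L := fun v => algebraMap _ L (Ideal.Quotient.mk (edgeIdeal K H) (X v))
  have hmul : ∀ u v, H.Adj u v → x u * x v = 0 := by
    intro u v huv
    have hmem : (X u * X v : MvPolynomial σ K) ∈ edgeIdeal K H :=
      Ideal.subset_span ⟨u, v, huv, rfl⟩
    rw [← map_mul, ← map_mul, Ideal.Quotient.eq_zero_iff_mem.2 hmem, map_zero]
  -- The prime of `F ∪ {v}` lies inside `P` and does not contain the variable of `v`.
  have hne0 : ∀ v, v ∉ F → (∀ u ∈ F, ¬ H.Adj v u) → x v ≠ 0 := by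
    intro v hv hvF h0
    obtain ⟨s, hs⟩ := (IsLocalization.map_eq_zero_iff P.primeCompl L _).1 h0
    have hFv := hins hF hvF
    have hp := isPrime_indepPrime (K := K) _ hFv
    have hmem : (s : MvPolynomial σ K ⧸ edgeIdeal K H) * Ideal.Quotient.mk _ (X v) ∈
        indepPrime _ hFv := by
      rw [hs]
      exact Ideal.zero_mem _
    rcases hp.mem_or_mem hmem with h | h
    · exact s.2 (indepPrime_le (Set.subset_insert _ _) h)
    · exact mk_X_mem_indepPrime.1 h (Set.mem_insert _ _)
  -- The non-adjacent pair `a₁`, `a₂` gives a chain of primes below `P`, by adjoining first one and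
  -- then the other to `F`.
  have hdim : 2 ≤ ringKrullDim L := by
    rw [IsLocalization.AtPrime.ringKrullDim_eq_height P L]
    have hlt1 : indepPrime (K := K) _ hF1 < P :=
      indepPrime_lt (Set.subset_insert _ _) (Set.mem_insert a₁ _) h₁.1
    have hlt2 : indepPrime (K := K) _ hF2 < indepPrime (K := K) _ hF1 :=
      indepPrime_lt (Set.subset_insert _ _) (Set.mem_insert a₂ _) (by
        rintro (h | h)
        · exact hne h.symm
        · exact h₂.1 h)
    have e1 := Ideal.height_add_one_le_of_lt_of_isPrime hlt1
    have e2 := Ideal.height_add_one_le_of_lt_of_isPrime hlt2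
    have : (2 : ℕ∞) ≤ P.height :=
      calc (2 : ℕ∞) = 1 + 1 := one_add_one_eq_two.symm
        _ ≤ (indepPrime (K := K) _ hF1).height + 1 := add_le_add_left (le_add_self.trans e2) 1
        _ ≤ P.height := e1
    exact WithBot.coe_le_coe.2 this
  refine IsCohenMacaulayLocal.false_of_mul_eq_zero (hH P) hdim (I := Ideal.span (x '' A))
    (J := Ideal.span (x '' B)) ?_ ?_ (Ideal.subset_span ⟨a₁, ha₁, rfl⟩)
    (Ideal.subset_span ⟨b, hb, rfl⟩) (hne0 a₁ h₁.1 h₁.2) (hne0 b h₃.1 h₃.2)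
  -- After localization the variables in `F` are units, so those of their neighbours vanish; the
  -- variables of `A` and `B` generate the maximal ideal.
  · rw [← Localization.AtPrime.map_eq_maximalIdeal, Ideal.map_le_iff_le_comap]
    intro p hp
    obtain ⟨f, rfl⟩ := Ideal.Quotient.mk_surjective p
    have hf0 : restrictVars K F f = 0 := mk_mem_indepPrime.1 hp
    have hf := sub_restrictVars_mem F f
    rw [hf0, sub_zero] at hf
    have hle : Ideal.span (X '' Fᶜ : Set (MvPolynomial σ K)) ≤
        Ideal.comap ((algebraMap _ L).comp (Ideal.Quotient.mk (edgeIdeal K H)))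
          (Ideal.span (x '' A) ⊔ Ideal.span (x '' B)) := by
      refine Ideal.span_le.2 ?_
      rintro _ ⟨v, hv, rfl⟩
      change x v ∈ Ideal.span (x '' A) ⊔ Ideal.span (x '' B)
      rcases hcov v with h | ⟨u, hu, huv⟩ | h | h
      · exact absurd h hv
      · have hunit : IsUnit (x u) := IsLocalization.map_units L
          (⟨_, fun h => mk_X_mem_indepPrime.1 h hu⟩ : P.primeCompl)
        have : x v = 0 := (hunit.mul_right_eq_zero).1 (hmul u v huv)
        rw [this]
        exact Ideal.zero_mem _
      · exact Ideal.mem_sup_left (Ideal.subset_span ⟨v, h, rfl⟩)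
      · exact Ideal.mem_sup_right (Ideal.subset_span ⟨v, h, rfl⟩)
    exact hle hf
  · intro y hy z hz
    have hle : Ideal.span (x '' A) * Ideal.span (x '' B) ≤ ⊥ := by
      rw [Ideal.span_mul_span', Ideal.span_le]
      rintro _ ⟨_, ⟨a, ha, rfl⟩, _, ⟨b, hb, rfl⟩, rfl⟩
      exact hmul a b (hAB a ha b hb)
    exact hle (Ideal.mul_mem_mul hy hz)

end CohenMacaulay

end CoverPowers

namespace CoverPowers

/-! ### Exchange along edges in Cohen–Macaulay bipartite graphs -/

section Bipartite

variable {σ : Type*} {H : SimpleGraph σ}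

theorem exists_tight_edge {k : ℕ} {X : Set σ} (hX : ∀ u v, H.Adj u v → (u ∈ X ↔ v ∉ X))
    {c : σ → ℕ} (hc : c ∈ minElts (coverSums k H)) {v : σ} (hv : 0 < c v) :
    ∃ u, H.Adj v u ∧ c v + c u = k := by
  classical
  by_contra hcon
  push Not at hcon
  have hcU := (mem_coverSums_bipartite_iff hX).1 hc.1
  have hlt : ∀ u, H.Adj v u → k < c v + c u := fun u hu =>
    lt_of_le_of_ne (hcU v u hu) (hcon u hu).symm
  have hmem : Function.update c v (c v - 1) ∈ coverSums k H := by
    refine mem_coverSums_of_bipartite hX fun x y hxy => ?_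
    by_cases hx : x = v
    · subst hx
      have := hlt y hxy
      rw [Function.update_self, Function.update_of_ne hxy.ne']
      omega
    by_cases hy : y = v
    · subst hy
      have := hlt x hxy.symm
      rw [Function.update_self, Function.update_of_ne hx]
      omega
    rw [Function.update_of_ne hx, Function.update_of_ne hy]
    exact hcU x y hxy
  have hle : Function.update c v (c v - 1) ≤ c := by
    intro x
    by_cases hx : x = v
    · subst hx
      simp
    · simp [hx]
  have := congrFun (minElts_eq_of_le hc hmem hle) v
  rw [Function.update_self] at this
  omega

/-- By tightness, a positive exponent off `X` is determined by that of some neighbour in `X`. -/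
theorem eq_of_eq_on_side {k : ℕ} {X : Set σ} (hX : ∀ u v, H.Adj u v → (u ∈ X ↔ v ∉ X))
    {c c' : σ → ℕ} (hc : c ∈ minElts (coverSums k H)) (hc' : c' ∈ minElts (coverSums k H))
    (h : ∀ x ∈ X, c x = c' x) : c = c' := by
  have key : ∀ {c c' : σ → ℕ}, c ∈ minElts (coverSums k H) → c' ∈ minElts (coverSums k H) →
      (∀ x ∈ X, c x = c' x) → c ≤ c' := by
    intro c c' hc hc' h y
    by_cases hy : y ∈ X
    · exact (h y hy).le
    rcases Nat.eq_zero_or_pos (c y) with h0 | h0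
    · rw [h0]
      exact Nat.zero_le _
    · obtain ⟨u, hyu, hk⟩ := exists_tight_edge hX hc h0
      have hu : u ∈ X := by
        by_contra hu
        exact hy ((hX y u hyu).2 hu)
      have h1 := h u hu
      have h2 := le_add_of_mem_coverSums hc'.1 hyu
      change c y ≤ c' y
      omega
  exact le_antisymm (key hc hc' h) (key hc' hc fun x hx => (h x hx).symm)

/-- If `c'` has a larger exponent than `c` at some vertex in `X`, then there is such a vertex `x`
and an edge `{x, y}` such that all other neighbours of `y` have exponents large enough to trade
`y` for `x` in `c`. -/
theorem exists_exchange {K : Type*} [Field K] [Finite σ] (hH : IsCohenMacaulayGraph K H) {k : ℕ}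
    {X : Set σ} (hX : ∀ u v, H.Adj u v → (u ∈ X ↔ v ∉ X)) {c c' : σ → ℕ}
    (hc : c ∈ minElts (coverSums k H)) (hc' : c' ∈ minElts (coverSums k H))
    (hex : ∃ x ∈ X, c x < c' x) :
    ∃ x ∈ X, ∃ y, c x < c' x ∧ H.Adj x y ∧ 0 < c y ∧ ∀ x', x' ≠ x → H.Adj x' y → k < c x' + c y := by
  classical
  obtain ⟨x₀, hx₀X, hx₀⟩ := hex
  have hcU : ∀ u v, H.Adj u v → k ≤ c u + c v := fun u v => le_add_of_mem_coverSums hc.1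
  have hcU' : ∀ u v, H.Adj u v → k ≤ c' u + c' v := fun u v => le_add_of_mem_coverSums hc'.1
  have hopp : ∀ u v, H.Adj u v → u ∉ X → v ∈ X := fun u v huv hu => by
    by_contra hv
    exact hu ((hX u v huv).2 hv)
  have hx₀k := le_of_mem_minElts_coverSums hc' x₀
  -- Work at the threshold `j`: `D` consists of the vertices of `X` that pass it for `c'` but not
  -- for `c`. Elements of `Y` can trade, and their only neighbours failing the threshold for `c` lie
  -- in `D`.
  obtain ⟨j, hj⟩ : ∃ j, c' x₀ = j + 1 := ⟨c' x₀ - 1, by omega⟩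
  let D : Set σ := {x | x ∈ X ∧ c x ≤ j ∧ j < c' x}
  let N : σ → Set σ := fun y => {x | x ∈ D ∧ H.Adj x y}
  let Y : Set σ := {y | y ∉ X ∧ k ≤ j + c y ∧ ∀ x, H.Adj x y → j < c x ∨ j < c' x}
  let Z : Set σ := {y | y ∈ Y ∧ (N y).Nonempty}
  have hx₀D : x₀ ∈ D := ⟨hx₀X, by omega, by omega⟩
  have hZ : Z.Nonempty := by
    obtain ⟨y, hxy, hk⟩ := exists_tight_edge hX hc' (v := x₀) (by omega)
    refine ⟨y, ⟨(hX _ _ hxy).1 hx₀X, ?_, fun x hx => Or.inr ?_⟩, x₀, hx₀D, hxy⟩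
    · have := hcU _ _ hxy
      omega
    · have := hcU' _ _ hx
      omega
  -- With `N y` smallest among the non-empty ones, the claim is that `N y` is a singleton; its
  -- element is the desired `x`.
  let y := Function.argminOn (fun y => (N y).ncard) Z hZ
  have hyZ : y ∈ Z := Function.argminOn_mem _ _ hZ
  have hymin : ∀ z ∈ Z, (N y).ncard ≤ (N z).ncard := fun z hz =>
    Function.argminOn_le (fun y => (N y).ncard) Z hz
  obtain ⟨⟨hyX, hyk, hynbr⟩, x₁, hx₁⟩ := hyZ
  have hDF : ∀ x ∈ D, ∀ z, z ∉ X → j + c z < k → ¬ H.Adj x z := by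
    intro x hx z _ hz hxz
    have := hcU _ _ hxz
    have := hx.2.1
    omega
  have huniq : ∀ x ∈ N y, x = x₁ := by
    intro x₂ hx₂
    by_contra hne
    -- `F` is independent and is chosen so that what remains outside its closed neighbourhood is the
    -- join of `N y` with the `z ∈ Y` having `N z = N y`. Two elements in `N y` would then
    -- contradict `IsCohenMacaulayGraph.false_of_join`.
    let F : Set σ := {v | (v ∈ X ∧ c v ≤ j ∧ c' v ≤ j) ∨ (v ∉ X ∧ j + c v < k) ∨
      (v ∈ D ∧ v ∉ N y) ∨ (v ∈ Y ∧ N v = ∅)}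
    have hcross : ∀ u ∈ F, ∀ v ∈ F, u ∈ X → ¬ H.Adj u v := by
      intro u hu v hv huX huv
      have hvX : v ∉ X := (hX u v huv).1 huX
      have hkuv := hcU u v huv
      rcases hu with ⟨-, h1, h2⟩ | ⟨h, -⟩ | ⟨h, h'⟩ | ⟨h, -⟩
      · rcases hv with ⟨h, -⟩ | ⟨-, h⟩ | ⟨h, -⟩ | ⟨h, -⟩
        · exact hvX h
        · omega
        · exact hvX h.1
        · rcases h.2.2 u huv with h | h <;> omega
      · exact h huX
      · rcases hv with ⟨h, -⟩ | ⟨-, h⟩ | ⟨h, -⟩ | ⟨-, hN⟩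
        · exact hvX h
        · have := (‹u ∈ D›).2.1
          omega
        · exact hvX h.1
        · exact Set.notMem_empty u (hN ▸ (⟨‹u ∈ D›, huv⟩ : u ∈ N v))
      · exact h.1 huX
    have hF : ∀ u ∈ F, ∀ v ∈ F, ¬ H.Adj u v := by
      intro u hu v hv huv
      by_cases huX : u ∈ X
      · exact hcross u hu v hv huX huv
      · exact hcross v hv u hu (hopp u v huv huX) huv.symm
    have hNF : ∀ x ∈ N y, x ∉ F ∧ ∀ u ∈ F, ¬ H.Adj x u := by
      intro x hx
      refine ⟨?_, fun u hu hxu => ?_⟩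
      · have h2 := hx.1.2.2
        rintro (⟨-, -, h⟩ | ⟨h, -⟩ | ⟨-, h⟩ | ⟨h, -⟩)
        · omega
        · exact h hx.1.1
        · exact h hx
        · exact h.1 hx.1.1
      · have huX : u ∉ X := (hX x u hxu).1 hx.1.1
        rcases hu with ⟨h, -⟩ | ⟨-, h⟩ | ⟨h, -⟩ | ⟨-, hN⟩
        · exact huX h
        · exact hDF x hx.1 u huX h hxu
        · exact huX h.1
        · exact Set.notMem_empty x (hN ▸ (⟨hx.1, hxu⟩ : x ∈ N u))
    refine hH.false_of_join (F := F) (A := N y) (B := {z | z ∈ Y ∧ N z = N y}) hF (fun v => ?_)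
      (fun a ha b hb => ?_) hx₁ (a₂ := x₂) (b := y) ⟨⟨hyX, hyk, hynbr⟩, rfl⟩ (Ne.symm hne) (fun h => ?_)
      (hNF x₁ hx₁) (hNF x₂ hx₂) ⟨?_, fun u hu hyu => ?_⟩
    · by_cases hvX : v ∈ X
      · by_cases hvj : c v ≤ j
        · by_cases hvj' : c' v ≤ j
          · exact Or.inl (Or.inl ⟨hvX, hvj, hvj'⟩)
          · have hvD : v ∈ D := ⟨hvX, hvj, by omega⟩
            by_cases hvN : v ∈ N y
            · exact Or.inr (Or.inr (Or.inl hvN))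
            · exact Or.inl (Or.inr (Or.inr (Or.inl ⟨hvD, hvN⟩)))
        · obtain ⟨u, hvu, hk⟩ := exists_tight_edge hX hc (v := v) (by omega)
          exact Or.inr (Or.inl ⟨u, Or.inr (Or.inl ⟨(hX v u hvu).1 hvX, by omega⟩), hvu.symm⟩)
      · by_cases hvk : j + c v < k
        · exact Or.inl (Or.inr (Or.inl ⟨hvX, hvk⟩))
        · by_cases hnb : ∀ x, H.Adj x v → j < c x ∨ j < c' x
          · have hvY : v ∈ Y := ⟨hvX, by omega, hnb⟩
            by_cases hN0 : N v = ∅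
            · exact Or.inl (Or.inr (Or.inr (Or.inr ⟨hvY, hN0⟩)))
            · by_cases hsub : N v ⊆ N y
              · refine Or.inr (Or.inr (Or.inr ⟨hvY, ?_⟩))
                exact Set.eq_of_subset_of_ncard_le hsub
                  (hymin v ⟨hvY, Set.nonempty_iff_ne_empty.2 hN0⟩)
              · obtain ⟨x, hx, hxy⟩ := Set.not_subset.1 hsub
                exact Or.inr (Or.inl ⟨x, Or.inr (Or.inr (Or.inl ⟨hx.1, hxy⟩)), hx.2⟩)
          · push Not at hnb
            obtain ⟨x, hxv, h1, h2⟩ := hnb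
            exact Or.inr (Or.inl ⟨x, Or.inl ⟨hopp v x hxv.symm hvX, h1, h2⟩, hxv⟩)
    · have : a ∈ N b := hb.2 ▸ ha
      exact this.2
    · exact (hX _ _ h).1 hx₁.1.1 hx₂.1.1
    · rintro (⟨h, -⟩ | ⟨-, h⟩ | ⟨h, -⟩ | ⟨-, h⟩)
      · exact hyX h
      · omega
      · exact hyX h.1
      · exact Set.notMem_empty x₁ (h ▸ hx₁)
    · rcases hu with ⟨-, h1, h2⟩ | ⟨h, -⟩ | ⟨h, h'⟩ | ⟨h, -⟩
      · rcases hynbr u hyu.symm with h | h <;> omega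
      · exact h (hopp y u hyu hyX)
      · exact h' ⟨h, hyu.symm⟩
      · exact h.1 (hopp y u hyu hyX)
  obtain ⟨hx₁D, hx₁y⟩ := hx₁
  refine ⟨x₁, hx₁D.1, y, hx₁D.2.1.trans_lt hx₁D.2.2, hx₁y, by omega, fun x' hne hx'y => ?_⟩
  have hx'X : x' ∈ X := hopp y x' hx'y.symm hyX
  have : j < c x' := by
    by_contra hle
    rcases hynbr x' hx'y with h | h
    · exact hle h
    · exact hne (huniq x' ⟨⟨hx'X, not_lt.1 hle, h⟩, hx'y⟩)
  omega

/-- Generators with larger total exponent on the colour class `X` come first, and `exists_exchange`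
moves one unit from `y` to `x`. -/
theorem linQuot_coverSums_of_cohenMacaulay {K : Type*} [Field K] [Finite σ]
    (hH : IsCohenMacaulayGraph K H) (hb : H.IsBipartite) (k : ℕ) : LinQuot (coverSums k H) := by
  classical
  have := Fintype.ofFinite σ
  obtain ⟨col⟩ := hb
  let X : Set σ := {v | col v = 0}
  have hX : ∀ u v, H.Adj u v → (u ∈ X ↔ v ∉ X) := by
    intro u v huv
    have h := col.valid huv
    change col u = 0 ↔ ¬ col v = 0
    omega
  refine LinQuotOn.of_key (α := ℕᵒᵈ) (finite_minElts _)
    (fun c => OrderDual.toDual (∑ x with x ∈ X, c x)) fun c hc c' hc' hne hle => ?_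
  have hle' : ∑ x with x ∈ X, c x ≤ ∑ x with x ∈ X, c' x := hle
  have hex : ∃ x ∈ X, c x < c' x := by
    by_contra hcon
    push Not at hcon
    have h1 : ∀ x ∈ Finset.univ.filter fun x => x ∈ X, c' x ≤ c x := fun x hx =>
      hcon x (Finset.mem_filter.1 hx).2
    have h2 := (Finset.sum_eq_sum_iff_of_le h1).1 (le_antisymm (Finset.sum_le_sum h1) hle')
    exact hne (eq_of_eq_on_side hX hc' hc fun x hx => h2 x (by simp [hx]))
  obtain ⟨x, hxX, y, hlt, hxy, hy0, hother⟩ := exists_exchange hH hX hc hc' hex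
  have hyX : y ∉ X := (hX x y hxy).1 hxX
  have hne' : x ≠ y := hxy.ne
  have hcU : ∀ u v, H.Adj u v → k ≤ c u + c v := fun u v => le_add_of_mem_coverSums hc.1
  have hsx : swapUp c x y x = c x + 1 := by simp [swapUp]
  have hsy : swapUp c x y y = c y - 1 := by simp [swapUp, hne'.symm]
  have hso : ∀ j, j ≠ x → j ≠ y → swapUp c x y j = c j := fun j h h' => by simp [swapUp, h, h']
  have hge : ∀ v, v ≠ y → c v ≤ swapUp c x y v := fun v hv => by
    by_cases hvx : v = x
    · subst hvx
      omega
    · rw [hso v hvx hv]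
  have hyedge : ∀ v, H.Adj v y → k ≤ swapUp c x y v + swapUp c x y y := fun v hv => by
    by_cases hvx : v = x
    · subst hvx
      have := hcU v y hxy
      omega
    · have := hother v hvx hv
      rw [hso v hvx hv.ne]
      omega
  have hmem : swapUp c x y ∈ coverSums k H := by
    refine mem_coverSums_of_bipartite hX fun u v huv => ?_
    by_cases hu : u = y
    · subst hu
      rw [add_comm]
      exact hyedge v huv.symm
    by_cases hv : v = y
    · subst hv
      exact hyedge u huv
    have := hcU u v huv
    have := hge u hu
    have := hge v hv
    omega
  obtain ⟨g, hg, hgle⟩ := exists_minElts_le hmem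
  have hgU : ∀ u v, H.Adj u v → k ≤ g u + g v := fun u v => le_add_of_mem_coverSums hg.1
  have hgle' : ∀ v, g v ≤ swapUp c x y v := hgle
  have htight : c x + c y = k := by
    obtain ⟨u, hyu, hk⟩ := exists_tight_edge hX hc hy0
    by_cases hux : u = x
    · subst hux
      omega
    · have := hother u hux hyu.symm
      omega
  have hgx : c x < g x := by
    have h1 := hgU x y hxy
    have h2 := hgle' y
    omega
  refine ⟨x, hlt, g, hg, ?_, (leUp_swapUp c x y).mono_left hgle⟩
  refine OrderDual.toDual_lt_toDual.2 (Finset.sum_lt_sum (fun v hv => ?_) ⟨x, by simp [hxX], hgx⟩)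
  have hvX : v ∈ X := (Finset.mem_filter.1 hv).2
  by_cases hvx : v = x
  · rw [hvx]
    exact hgx.le
  -- Passing to a minimal `g` loses nothing on `X`: a tight neighbour of `v` is not `y`, since `y`
  -- is tight only with `x`, so its exponent did not rise and `g v ≥ c v`.
  rcases Nat.eq_zero_or_pos (c v) with h0 | h0
  · rw [h0]
    exact Nat.zero_le _
  · obtain ⟨u, hvu, hk⟩ := exists_tight_edge hX hc h0
    have huy : u ≠ y := by
      rintro rfl
      have := hother v hvx hvu
      omega
    have hux : u ≠ x := fun h => (hX v u hvu).1 hvX (h ▸ hxX)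
    have h1 := hgU v u hvu
    have h2 := hgle' u
    rw [hso u hux huy] at h2
    omega

end Bipartite

end CoverPowers

namespace CoverPowers

/-! ### Cameron–Walker graphs -/

section CameronWalker

variable {σ : Type*} {H : SimpleGraph σ}

/-- The components are single vertices and edges. They are cliques in which every vertex is free. -/
theorem linQuot_coverSums_of_matching [Finite σ]
    (hdeg : ∀ u v w, H.Adj u v → H.Adj u w → v = w) (k : ℕ) : LinQuot (coverSums k H) := by
  have := Fintype.ofFinite σ
  let S : Setoid σ :=
    { r := fun u v => u = v ∨ H.Adj u v
      iseqv :=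
        { refl := fun u => Or.inl rfl
          symm := fun h => h.imp Eq.symm fun h => h.symm
          trans := by
            rintro u v w (rfl | huv) (rfl | hvw)
            · exact Or.inl rfl
            · exact Or.inr hvw
            · exact Or.inr huv
            · exact Or.inl (hdeg v u w huv.symm hvw) } }
  have hout : ∀ v : σ, (Quotient.mk S (Quotient.mk S v).out) = Quotient.mk S v := fun v =>
    Quotient.out_eq _
  refine linQuot_coverSums_of_cliques (ρ := fun v => (Quotient.mk S v).out) (fun v => ?_)
    (fun u v huv hne => ?_) (fun v w hvw => ?_) k
  · simp only [hout]
  · have h : Quotient.mk S u = Quotient.mk S v := by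
      rw [← hout u, ← hout v]
      exact congrArg _ huv
    exact (Quotient.exact h : u = v ∨ H.Adj u v).resolve_left hne
  · have h : Quotient.mk S w = Quotient.mk S v := by
      rw [← hout v]
      exact Quotient.sound (s := S) (Or.inr hvw.symm)
    simp only [h]

variable {B : Set σ}

/-- The neighbours of `v` outside `B`. -/
def outerNbrs (H : SimpleGraph σ) (B : Set σ) (v : σ) : Set σ := {w | w ∉ B ∧ H.Adj v w}

/-- A graph in which every vertex outside `B` has exactly one neighbour in `B`, and this neighbour
is the same for adjacent vertices outside `B`, is obtained from the induced graph on `B` by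
attaching to each vertex its neighbours outside `B`. -/
noncomputable def attachIso (hE : ∀ w ∉ B, ∃ v ∈ B, H.Adj v w)
    (hU : ∀ w ∉ B, ∀ v ∈ B, ∀ v' ∈ B, H.Adj v w → H.Adj v' w → v = v')
    (hT : ∀ w ∉ B, ∀ w' ∉ B, H.Adj w w' → ∀ v ∈ B, H.Adj v w → H.Adj v w') :
    attach (H.induce B) (fun v : B => H.induce (outerNbrs H B v)) ≃g H where
  toEquiv := Equiv.ofBijective
    (Sum.elim Subtype.val fun p => (p.2 : σ) : (B ⊕ Σ v : B, outerNbrs H B v) → σ) (by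
      constructor
      · rintro (v | ⟨v, w⟩) (v' | ⟨v', w'⟩) h
        · exact congrArg Sum.inl (Subtype.ext h)
        · have h : (v : σ) = w' := h
          exact absurd (h ▸ v.2) w'.2.1
        · have h : (w : σ) = v' := h
          exact absurd (h ▸ v'.2) w.2.1
        · obtain ⟨w, hw⟩ := w
          obtain ⟨w', hw'⟩ := w'
          have h : w = w' := h
          subst h
          have hv : v = v' := Subtype.ext (hU w hw.1 v v.2 v' v'.2 hw.2 hw'.2)
          subst hv
          rfl
      · intro w
        by_cases hw : w ∈ B
        · exact ⟨.inl ⟨w, hw⟩, rfl⟩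
        · obtain ⟨v, hv, hvw⟩ := hE w hw
          exact ⟨.inr ⟨⟨v, hv⟩, ⟨w, hw, hvw⟩⟩, rfl⟩)
  map_rel_iff' := by
    rintro (v | ⟨v, w⟩) (v' | ⟨v', w'⟩)
    · exact ⟨fun h => AttachAdj.base h, fun h => by cases h; assumption⟩
    · constructor
      · intro h
        have h : H.Adj v w' := h
        have hv : v = v' := Subtype.ext (hU w' w'.2.1 v v.2 v' v'.2 h w'.2.2)
        subst hv
        exact AttachAdj.up (W := fun v : B => outerNbrs H B v) v w'
      · intro h
        cases h with
        | up _ z => exact z.2.2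
    · constructor
      · intro h
        have h : H.Adj w v' := h
        have hv : v' = v := Subtype.ext (hU w w.2.1 v' v'.2 v v.2 h.symm w.2.2)
        subst hv
        exact AttachAdj.down (W := fun v : B => outerNbrs H B v) v' w
      · intro h
        cases h with
        | down => exact w.2.2.symm
    · constructor
      · intro h
        have h : H.Adj w w' := h
        have hv : v = v' := Subtype.ext (hU w' w'.2.1 v v.2 v' v'.2
          (hT w w.2.1 w' w'.2.1 h v v.2 w.2.2) w'.2.2)
        subst hv
        exact AttachAdj.fiber h
      · intro h
        cases h
        assumption

theorem mem_coverSums_of_outerNbrs (hE : ∀ w ∉ B, ∃ v ∈ B, H.Adj v w)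
    (hU : ∀ w ∉ B, ∀ v ∈ B, ∀ v' ∈ B, H.Adj v w → H.Adj v' w → v = v')
    (hT : ∀ w ∉ B, ∀ w' ∉ B, H.Adj w w' → ∀ v ∈ B, H.Adj v w → H.Adj v w') {k : ℕ} {t : σ → ℕ} :
    t ∈ coverSums k H ↔ ∃ a : B → ℕ, (a ∈ coverSums k (H.induce B) ∧ ∀ v, a v ≤ k) ∧
      (∀ v, a v ≤ t v) ∧ ∀ v : B, (fun w : outerNbrs H B v => t w) ∈
        shiftedCoverSums k (a v) (H.induce (outerNbrs H B v)) := by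
  rw [mem_coverSums_iso (attachIso hE hU hT).symm]
  exact mem_coverSums_attach

/-- The leaves and triangles are matchings attached to the bipartite part `B`. Vertices of `Y`
without triangles have empty fibre, so the strict drop fails for them; they are moved from the base
to one extra fibre `Z`. -/
theorem linQuot_coverSums_of_cameronWalker [Finite σ] (hH : IsCompleteCameronWalker H) (k : ℕ) :
    LinQuot (coverSums k H) := by
  classical
  have := Fintype.ofFinite σ
  obtain ⟨X, Y, hCW, hXY⟩ := hH
  set B : Set σ := X ∪ Y with hB
  have hdisj : ∀ v, v ∈ X → v ∉ Y := fun v hx hy => Set.disjoint_left.1 hCW.disjoint hx hy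
  have hE : ∀ w ∉ B, ∃ v ∈ B, H.Adj v w := by
    intro w hw
    rcases hCW.rest w hw with ⟨x, hx, hl⟩ | ⟨y, hy, v', hv', hl, -⟩
    · exact ⟨x, Or.inl hx, ((hl x).2 rfl).symm⟩
    · exact ⟨y, Or.inr hy, ((hl y).2 (Or.inl rfl)).symm⟩
  have hU : ∀ w ∉ B, ∀ v ∈ B, ∀ v' ∈ B, H.Adj v w → H.Adj v' w → v = v' := by
    intro w hw u hu u' hu' h h'
    rcases hCW.rest w hw with ⟨x, hx, hl⟩ | ⟨y, hy, v', hv', hl, -⟩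
    · exact ((hl u).1 h.symm).trans ((hl u').1 h'.symm).symm
    · have h1 := ((hl u).1 h.symm).resolve_right fun e => hv' (e ▸ hu)
      have h2 := ((hl u').1 h'.symm).resolve_right fun e => hv' (e ▸ hu')
      exact h1.trans h2.symm
  have hpart : ∀ w ∉ B, ∀ w' ∉ B, H.Adj w w' → ∃ y ∈ Y, IsPendantTriangleAt H y w w' := by
    intro w hw w' hw' h
    rcases hCW.rest w hw with ⟨x, hx, hl⟩ | ⟨y, hy, v', hv', hl⟩
    · exact absurd (Or.inl ((hl w').1 h ▸ hx)) hw'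
    · have h1 := ((hl.1 w').1 h).resolve_left fun e => hw' (Or.inr (e ▸ hy))
      exact ⟨y, hy, h1 ▸ hl⟩
  have hT : ∀ w ∉ B, ∀ w' ∉ B, H.Adj w w' → ∀ v ∈ B, H.Adj v w → H.Adj v w' := by
    intro w hw w' hw' h v hv hvw
    obtain ⟨y, hy, hl⟩ := hpart w hw w' hw' h
    have h1 := ((hl.1 v).1 hvw.symm).resolve_right fun e => hw' (e ▸ hv)
    rw [h1]
    exact ((hl.2 y).2 (Or.inl rfl)).symm
  have hdeg : ∀ u v w, u ∉ B → v ∉ B → w ∉ B → H.Adj u v → H.Adj u w → v = w := by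
    intro u v w hu hv hw huv huw
    obtain ⟨y, hy, hl⟩ := hpart u hu v hv huv
    exact (((hl.1 w).1 huw).resolve_left fun e => hw (Or.inr (e ▸ hy))).symm
  have hfib : ∀ v n, LinQuot (coverSums n (H.induce (outerNbrs H B v))) := fun v n =>
    linQuot_coverSums_of_matching (fun u w w' h h' =>
      Subtype.ext (hdeg u w w' u.2.1 w.2.1 w'.2.1 h h')) n
  have hbip : ∀ u v : B, (H.induce B).Adj u v → (u ∈ {v : B | (v : σ) ∈ X} ↔
      v ∉ {v : B | (v : σ) ∈ X}) := by
    rintro ⟨u, hu⟩ ⟨v, hv⟩ huv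
    have huv : H.Adj u v := huv
    change u ∈ X ↔ v ∉ X
    constructor
    · exact fun h h' => hCW.indep_left u h v h' huv
    · intro h
      rcases hu with h' | h'
      · exact h'
      · exact absurd huv (hCW.indep_right u h' v (hv.resolve_left h))
  let V' := {v : σ // v ∈ B ∧ (outerNbrs H B v).Nonempty}
  have hXne : ∀ x ∈ X, (outerNbrs H B x).Nonempty := fun x hx => by
    obtain ⟨v, hv, hl⟩ := hCW.exists_leaf x hx
    exact ⟨v, hv, ((hl x).2 rfl).symm⟩
  let Z : Set σ := {v | v ∈ B ∧ ¬ (outerNbrs H B v).Nonempty}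
  have hZ : ∀ v ∈ Z, v ∈ Y := fun v hv => hv.1.resolve_left fun h => hv.2 (hXne v h)
  let fibre : Option V' → Set σ := fun i => i.elim Z fun v => outerNbrs H B v
  let f : (V' ⊕ Σ i : Option V', fibre i) → σ := Sum.elim Subtype.val fun p => (p.2 : σ)
  have hf : Function.Bijective f := by
    constructor
    · rintro (v | ⟨_ | v, w, hw⟩) (v' | ⟨_ | v', w', hw'⟩) h
      · exact congrArg Sum.inl (Subtype.ext h)
      · have h : (v : σ) = w' := h
        have hw' : w' ∈ Z := hw'
        exact absurd v.2.2 (h ▸ hw'.2)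
      · have h : (v : σ) = w' := h
        have hw' : w' ∈ outerNbrs H B v' := hw'
        exact absurd (h ▸ v.2.1) hw'.1
      · have h : w = v' := h
        have hw : w ∈ Z := hw
        exact absurd (h ▸ v'.2.2) hw.2
      · have h : w = w' := h
        subst h
        rfl
      · have h : w = w' := h
        have hw : w ∈ Z := hw
        have hw' : w' ∈ outerNbrs H B v' := hw'
        exact absurd (h ▸ hw.1) hw'.1
      · have h : w = v' := h
        have hw : w ∈ outerNbrs H B v := hw
        exact absurd (h ▸ v'.2.1) hw.1
      · have h : w = w' := h
        have hw : w ∈ outerNbrs H B v := hw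
        have hw' : w' ∈ Z := hw'
        exact absurd (h ▸ hw'.1) hw.1
      · have h : w = w' := h
        subst h
        have hw : w ∈ outerNbrs H B v := hw
        have hw' : w ∈ outerNbrs H B v' := hw'
        have hv : v = v' := Subtype.ext (hU w hw.1 v v.2.1 v' v'.2.1 hw.2 hw'.2)
        subst hv
        rfl
    · intro w
      by_cases hw : w ∈ B
      · by_cases hne : (outerNbrs H B w).Nonempty
        · exact ⟨.inl ⟨w, hw, hne⟩, rfl⟩
        · exact ⟨.inr ⟨none, w, hw, hne⟩, rfl⟩
      · obtain ⟨v, hv, hvw⟩ := hE w hw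
        exact ⟨.inr ⟨some ⟨v, hv, w, hw, hvw⟩, w, hw, hvw⟩, rfl⟩
  let e := (Equiv.ofBijective f hf).symm
  let A : Set (V' → ℕ) := {a | (∀ v, a v ≤ k) ∧
    ∀ x y : V', (x : σ) ∈ X → (y : σ) ∈ Y → k ≤ a x + a y}
  let F : ∀ i : Option V', (V' → ℕ) → Set (fibre i → ℕ) := fun i a =>
    match i with
    | none => {s | ∀ (x : V') (y : Z), (x : σ) ∈ X → k ≤ a x + s y}
    | some v => shiftedCoverSums k (a v) (H.induce (outerNbrs H B v))
  have hmain : coverSums k H = {t : σ → ℕ | t ∘ e.symm ∈ fibered A F} := by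
    ext t
    rw [mem_coverSums_of_outerNbrs hE hU hT]
    constructor
    · rintro ⟨a, ⟨haG, hak⟩, hat, hfb⟩
      have hedge : ∀ x y : B, (x : σ) ∈ X → (y : σ) ∈ Y → k ≤ a x + a y := fun x y hx hy =>
        le_add_of_mem_coverSums haG (show (H.induce B).Adj x y from hXY x hx y hy)
      refine ⟨fun v => a ⟨v, v.2.1⟩, ⟨fun v => hak _, fun x y hx hy => hedge _ _ hx hy⟩,
        fun v => hat _, ?_⟩
      rintro (_ | v)
      · intro x y hx
        exact (hedge ⟨x, x.2.1⟩ ⟨y, y.2.1⟩ hx (hZ y y.2)).trans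
          (Nat.add_le_add_left (hat ⟨y, y.2.1⟩) _)
      · exact hfb ⟨v, v.2.1⟩
    · rintro ⟨a, ⟨hak, haA⟩, hat, hfb⟩
      have hat : ∀ v : V', a v ≤ t v := hat
      have hnone : ∀ (x : V') (y : Z), (x : σ) ∈ X → k ≤ a x + t y := hfb none
      -- On `Z` the base exponent is recovered from `t`. Truncation at `k` secures the bound `a' v ≤
      -- k` and preserves the edge inequalities.
      let a' : B → ℕ := fun v => if h : (outerNbrs H B v).Nonempty then a ⟨v, v.2, h⟩ else min (t v) k
      have ha1 : ∀ (v : B) (h : (outerNbrs H B v).Nonempty), a' v = a ⟨v, v.2, h⟩ :=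
        fun v h => dif_pos h
      have ha2 : ∀ v : B, ¬ (outerNbrs H B v).Nonempty → a' v = min (t v) k :=
        fun v h => dif_neg h
      have hedge : ∀ x y : B, (x : σ) ∈ X → (y : σ) ∈ Y → k ≤ a' x + a' y := by
        intro x y hx hy
        rw [ha1 x (hXne x hx)]
        by_cases hne : (outerNbrs H B y).Nonempty
        · rw [ha1 y hne]
          exact haA _ _ hx hy
        · rw [ha2 y hne]
          have := hnone ⟨x, x.2, hXne x hx⟩ ⟨y, y.2, hne⟩ hx
          simp only at this
          omega
      refine ⟨a', ⟨mem_coverSums_of_bipartite hbip fun u v huv => ?_, fun v => ?_⟩, fun v => ?_,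
        fun v => ?_⟩
      · have huv' := hbip u v huv
        by_cases hu : (u : σ) ∈ X
        · exact hedge u v hu (v.2.resolve_left (huv'.1 hu))
        · have hv : (v : σ) ∈ X := by
            by_contra hv
            exact hu (huv'.2 hv)
          rw [add_comm]
          exact hedge v u hv (u.2.resolve_left hu)
      · by_cases hne : (outerNbrs H B v).Nonempty
        · rw [ha1 v hne]
          exact hak _
        · rw [ha2 v hne]
          exact min_le_right _ _
      · by_cases hne : (outerNbrs H B v).Nonempty
        · rw [ha1 v hne]
          exact hat _
        · rw [ha2 v hne]
          exact min_le_left _ _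
      · by_cases hne : (outerNbrs H B v).Nonempty
        · rw [ha1 v hne]
          exact hfb (some ⟨v, v.2, hne⟩)
        · have hemp : ∀ w : outerNbrs H B v, False := fun w => hne ⟨w, w.2⟩
          exact ⟨0, ⟨fun _ => Set.univ, fun _ _ _ _ => Or.inl trivial, fun w => (hemp w).elim⟩,
            fun w => (hemp w).elim⟩
  rw [hmain]
  refine LinQuot.comp_equiv e (linQuot_fibered ?_ ?_ ?_ ?_)
  · intro a ha b hb v hv
    refine ⟨fun u => ?_, fun x y hx hy => (ha.2 x y hx hy).trans
      (Nat.add_le_add (Nat.le_add_right _ _) (Nat.le_add_right _ _))⟩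
    by_cases hu : u = v
    · subst hu
      have := hb.1 u
      simp only [Pi.add_apply, Pi.single_eq_same]
      omega
    · simpa [hu] using ha.1 u
  · rintro a ha b hb hab (_ | v)
    · exact fun s hs x y hx => (hs x y hx).trans (Nat.add_le_add_right (hab x) _)
    · exact shiftedCoverSums_mono (hab v) (hb.1 v)
  · intro a ha v hav
    have hlt : a v < k := by simpa using hav.1 v
    obtain ⟨w, hw⟩ := v.2.2
    refine ⟨some v, fun s hs => ?_⟩
    have := exists_lt_mem_shiftedCoverSums hlt ⟨w, hw⟩ hs
    simpa [F] using this
  · rintro a ha (_ | v)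
    -- For a fixed base the constraints on `Z` are just lower bounds, so this fibre is a principal
    -- ideal.
    · have : F none a = {s | (fun _ => Finset.univ.sup fun x : V' =>
          if (x : σ) ∈ X then k - a x else 0) ≤ s} := by
        ext s
        constructor
        · intro hs y
          refine Finset.sup_le fun x _ => ?_
          split_ifs with hx
          · have := hs x y hx
            change k - a x ≤ s y
            omega
          · exact Nat.zero_le _
        · intro hs x y hx
          have h1 : (Finset.univ.sup fun x : V' => if (x : σ) ∈ X then k - a x else 0) ≤ s y :=
            hs y
          have h2 := (Finset.le_sup (f := fun x : V' => if (x : σ) ∈ X then k - a x else 0)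
            (Finset.mem_univ x)).trans h1
          simp only [hx, if_true] at h2
          omega
      rw [this]
      exact linQuot_Ici _
    · exact (hfib v _).shiftedCoverSums k

end CameronWalker

end CoverPowers

theorem mainTheorem6 {K : Type*} [Field K] {V : Type*} [Finite V] (G : SimpleGraph V)
    {W : V → Type*} [∀ v, Finite (W v)] [∀ v, Nonempty (W v)] (H : ∀ v, SimpleGraph (W v))
    (hH : ∀ v,
      (CoverPowers.IsUnmixed (H v) ∧ CoverPowers.IsChordal (H v)) ∨
      (CoverPowers.IsCohenMacaulayGraph K (H v) ∧ (H v).IsBipartite) ∨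
      CoverPowers.IsPathGraph (H v) ∨
      CoverPowers.IsCompleteCameronWalker (H v))
    (k : ℕ) :
    CoverPowers.HasLinearQuotientsOnMinGens
        (CoverPowers.coverIdeal K (CoverPowers.attach G H) ^ k) ∧
      CoverPowers.IsComponentwiseLinear
        (CoverPowers.coverIdeal K (CoverPowers.attach G H) ^ k) := by
  have hfib : ∀ v n, CoverPowers.LinQuot (CoverPowers.coverSums n (H v)) := by
    intro v n
    rcases hH v with ⟨hu, hc⟩ | ⟨hcm, hb⟩ | hp | hcw
    · exact CoverPowers.linQuot_coverSums_of_chordal hu hc n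
    · exact CoverPowers.linQuot_coverSums_of_cohenMacaulay hcm hb n
    · exact CoverPowers.linQuot_coverSums_of_path hp n
    · exact CoverPowers.linQuot_coverSums_of_cameronWalker hcw n
  have hlq := CoverPowers.linQuot_coverSums_attach G H hfib k
  have hup := CoverPowers.isUpperSet_coverSums k (CoverPowers.attach G H)
  rw [CoverPowers.coverIdeal_pow_eq_span_mon]
  exact ⟨CoverPowers.hasLinearQuotientsOnMinGens_of_linQuot hup hlq,
    CoverPowers.isComponentwiseLinear_of_linQuot hup hlq⟩
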